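/- **Theorem.** $\mathrm{L}_2^{\mathrm P}\subseteq \mathrm P^{\mathrm{prSBP}}$. Here the classes are as follows. * $\mathrm{LOP}$ (Linear Ordering Principle) is the following total search problem. The input is a number $n$ and a Boolean circuit $E$ with $2n$ inputs and one output, which defines a relation on $\{0,1\}^n$ by $x<_E y \iff E(x,y)=1$. A correct output is either the minimum, i.e. an $x\in\{0,1\}^n$ with $x<_E y$ for all $y\in\{0,1\}^n\setminus\{x\}$, or a counterexample to $<_E$ being a strict linear order: a pair with $x<_E y<_E x$, or a pair $x\neq y$ with neither $x<_E y$ nor $y<_E x$, or a triple with $x<_E y<_E z<_E x$. * $\mathrm{L}_2^{\mathrm P}$ is the class of languages $L\subseteq\{0,1\}^*$ that are reducible to $\mathrm{LOP}$ by a $\mathrm P^{\mathrm{NP}}$-Turing reduction: there are a language $A\in\mathrm{NP}$ and a deterministic polynomial-time oracle Turing machine that, given oracle access to $A$ and to any function $f$ solving $\mathrm{LOP}$, decides $L$. * A promise problem is a pair $\Pi=(\Pi_{\mathrm{YES}},\Pi_{\mathrm{NO}})$ of disjoint sets of strings. It is in $\mathrm{prSBP}$ if there are a polynomial-time randomized algorithm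 $V$ (using $p(|x|)$ random bits for a polynomial $p$) and a polynomial $q$ such that $\Pr[V(x)=1]\ge 2^{-q(|x|)}$ for all $x\in\Pi_{\mathrm{YES}}$ and $\Pr[V(x)=1]\le \tfrac12\, 2^{-q(|x|)}$ for all $x\in\Pi_{\mathrm{NO}}$. * $\mathrm P^{\mathrm{prSBP}}$ is the class of languages $L$ for which there are a problem $\Pi\in\mathrm{prSBP}$ and a deterministic polynomial-time oracle Turing machine that decides $L$ whenever its oracle answers "yes" on queries in $\Pi_{\mathrm{YES}}$ and "no" on queries in $\Pi_{\mathrm{NO}}$; the answers to other queries are arbitrary, and may even differ for repetitions of the same query. -/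

import Mathlib

namespace Cplx

/-! ### Deterministic oracle machines with a step count

The machines are the multi-stack Turing machines `Turing.TM2` of Mathlib over the alphabet
`Bool` (a two-way infinite tape is a pair of stacks), extended by oracle calls. -/

/-- A deterministic oracle Turing machine: finitely many stacks of bits, finitely many labels,
finitely many internal states. A label carries either an ordinary `TM2` statement (`Sum.inl`) or
an oracle call (`Sum.inr l'`, after which the machine continues at `l'`). -/
structure OracleMachine where
  /-- index type of the stacks -/
  K : Type
  [decK : DecidableEq K]
  [finK : Fintype K]
  /-- labels of the program -/
  Lab : Type
  [finLab : Fintype Lab]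
  /-- internal states -/
  St : Type
  [finSt : Fintype St]
  /-- the stack that initially holds the input -/
  input : K
  /-- the stack that holds the result when the machine halts -/
  output : K
  /-- the stack on which oracle queries are written -/
  query : K
  /-- the stack on which oracle answers appear -/
  answer : K
  query_ne_answer : query ≠ answer
  main : Lab
  initState : St
  prog : Lab → Turing.TM2.Stmt (fun _ : K => Bool) Lab St ⊕ Lab

attribute [instance] OracleMachine.decK OracleMachine.finK OracleMachine.finLab
  OracleMachine.finSt

/-- An oracle, as the relation "`a` is an admissible answer to the query `q`".
It may leave several answers open, and may then answer a repeated query differently. -/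
abbrev Oracle := List Bool → List Bool → Prop

namespace OracleMachine

variable (M : OracleMachine)

/-- Configurations: current label (`none` when halted), internal state, contents of the stacks. -/
abbrev Cfg := Turing.TM2.Cfg (fun _ : M.K => Bool) M.Lab M.St

/-- The initial configuration on input `x`; the first bit of `x` is on top of the input stack. -/
def initCfg (x : List Bool) : M.Cfg :=
  ⟨some M.main, M.initState, Function.update (fun _ => []) M.input x⟩

/-- One computation step. An oracle call consumes the query: the query stack is emptied, and the
answer becomes the content of the answer stack. -/
inductive Step (A : Oracle) : M.Cfg → M.Cfg → Prop
  | stmt {l : M.Lab} {s : Turing.TM2.Stmt (fun _ : M.K => Bool) M.Lab M.St}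
      (h : M.prog l = Sum.inl s) (v : M.St) (S : M.K → List Bool) :
      Step A ⟨some l, v, S⟩ (Turing.TM2.stepAux s v S)
  | call {l l' : M.Lab} (h : M.prog l = Sum.inr l') (v : M.St) (S : M.K → List Bool)
      {a : List Bool} (ha : A (S M.query) a) :
      Step A ⟨some l, v, S⟩
        ⟨some l', v, Function.update (Function.update S M.query []) M.answer a⟩

/-- `M.HaltsWith A y t c`: started at `c`, the machine halts within `t` steps with output `y`,
whichever admissible answers the oracle gives. -/
inductive HaltsWith (A : Oracle) (y : List Bool) : ℕ → M.Cfg → Prop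
  | halted {t : ℕ} {c : M.Cfg} (hl : c.l = none) (hy : c.stk M.output = y) : HaltsWith A y t c
  | step {t : ℕ} {c : M.Cfg} (hex : ∃ c', M.Step A c c')
      (hall : ∀ c', M.Step A c c' → HaltsWith A y t c') : HaltsWith A y (t + 1) c

open Classical in
/-- `M` with oracle `A` decides the language `L` in time `p`, a polynomial in the input length:
on input `x` it stops after at most `p |x|` steps, with output `1` if `x ∈ L` and `0` if not. -/
def DecidesIn (A : Oracle) (L : Language Bool) (p : Polynomial ℕ) : Prop :=
  ∀ x : List Bool, M.HaltsWith A [decide (x ∈ L)] (p.eval x.length) (M.initCfg x)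

end OracleMachine

/-! ### The classes P, NP and prSBP, and polynomial time relative to promise problems -/

/-- The useless oracle: every answer is the empty string. -/
def noOracle : Oracle := fun _ a => a = []

/-- The class `P`. -/
def P : Set (Language Bool) :=
  {L | ∃ (M : OracleMachine) (p : Polynomial ℕ), M.DecidesIn noOracle L p}

/-- Injective encoding of a pair of strings: each bit of `x` is preceded by `1`, then `0` marks
the end of `x`, then `w` follows. -/
def pair (x w : List Bool) : List Bool :=
  x.flatMap (fun b => [true, b]) ++ false :: w

theorem pair_inj (x x' w w' : List Bool) (h : pair x w = pair x' w') : x = x' ∧ w = w' := by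
  induction x generalizing x' with
  | nil => cases x' <;> simp_all [pair]
  | cons b x ih => cases x' with
    | nil => simp [pair] at h
    | cons b' x' =>
      simp [pair] at h
      have := ih x' (by simpa [pair] using h.2)
      simp_all

/-- The class `NP`, by polynomial-time verifiers with witnesses of polynomial length. -/
def NP : Set (Language Bool) :=
  {L | ∃ V ∈ P, ∃ p : Polynomial ℕ, ∀ x : List Bool,
    x ∈ L ↔ ∃ w : List Bool, w.length = p.eval x.length ∧ pair x w ∈ V}

/-- A promise problem: disjoint sets of yes-instances and no-instances. -/
structure PromiseProblem where
  yes : Language Bool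
  no : Language Bool
  disj : ∀ x, x ∈ yes → x ∉ no

/-- The probability that `⟨x, w⟩ ∈ V` for a uniformly random string `w` of length `m`. -/
noncomputable def acceptProb (V : Language Bool) (m : ℕ) (x : List Bool) : ℚ :=
  (Set.ncard {w : List Bool | w.length = m ∧ pair x w ∈ V} : ℚ) / 2 ^ m

/-- The class `prSBP` (small bounded-error probability): for some polynomial-time randomized
algorithm (deciding `V`, with `p |x|` random bits) and some polynomial `q`, yes-instances are
accepted with probability at least `2 ^ (-q |x|)`, no-instances with at most half of that. -/
def prSBP : Set PromiseProblem :=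
  {Q | ∃ V ∈ P, ∃ p q : Polynomial ℕ,
    (∀ x ∈ Q.yes, (1 : ℚ) / 2 ^ q.eval x.length ≤ acceptProb V (p.eval x.length) x) ∧
    (∀ x ∈ Q.no, acceptProb V (p.eval x.length) x ≤ (1 / 2 ^ q.eval x.length) / 2)}

/-- Loose access to a promise problem: one-bit answers, correct on the promise, arbitrary (and
possibly inconsistent) outside of it. -/
def PromiseProblem.oracle (Q : PromiseProblem) : Oracle := fun q a =>
  ∃ b : Bool, a = [b] ∧ (q ∈ Q.yes → b = true) ∧ (q ∈ Q.no → b = false)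

/-- The class `P^C` for a class `C` of promise problems: languages decided in polynomial time by
a deterministic oracle machine with loose access to a problem of `C`. -/
def PWith (C : Set PromiseProblem) : Set (Language Bool) :=
  {L | ∃ Q ∈ C, ∃ (M : OracleMachine) (p : Polynomial ℕ), M.DecidesIn Q.oracle L p}

/-! ### Boolean circuits -/

/-- A gate of a Boolean circuit. `inp i` is the `i`-th input bit; in the other gates a wire `k`
leads from the `k`-th most recent gate (`0` is the immediately preceding one). -/
inductive Gate
  | const (b : Bool)
  | inp (i : ℕ)
  | not (j : ℕ)
  | and (j k : ℕ)
  | or (j k : ℕ)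

/-- The value of a gate on input `x`, given the values of the earlier gates (latest first). -/
def Gate.eval (x vals : List Bool) : Gate → Bool
  | .const b => b
  | .inp i => x.getD i false
  | .not j => !(vals.getD j false)
  | .and j k => vals.getD j false && vals.getD k false
  | .or j k => vals.getD j false || vals.getD k false

/-- A gate is admissible if it uses only the `m` inputs and the `s` earlier gates. -/
def Gate.WF (m s : ℕ) : Gate → Prop
  | .const _ => True
  | .inp i => i < m
  | .not j => j < s
  | .and j k => j < s ∧ k < s
  | .or j k => j < s ∧ k < s

/-- A (single-output) circuit is the list of its gates in topological order; the last gate is the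
output. Arbitrary fan-out is allowed. -/
abbrev Circuit := List Gate

/-- `C` is a Boolean circuit with `m` inputs. -/
def Circuit.WF (m : ℕ) (C : Circuit) : Prop :=
  C ≠ [] ∧ ∀ (s : ℕ) (h : s < C.length), Gate.WF m s C[s]

/-- The values of all gates on input `x`, the last gate first. -/
def Circuit.vals (x : List Bool) (C : Circuit) : List Bool :=
  C.foldl (fun vals g => g.eval x vals :: vals) []

/-- The output of the circuit on input `x`. -/
def Circuit.eval (C : Circuit) (x : List Bool) : Bool :=
  (Circuit.vals x C).headD false

/-- Self-delimiting unary code of a number. -/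
def encodeNat (k : ℕ) : List Bool := List.replicate k true ++ [false]

/-- Self-delimiting code of a gate. -/
def Gate.encode : Gate → List Bool
  | .const b => [false, false, false, b]
  | .inp i => [false, false, true] ++ encodeNat i
  | .not j => [false, true] ++ encodeNat j
  | .and j k => [true, false] ++ encodeNat j ++ encodeNat k
  | .or j k => [true, true] ++ encodeNat j ++ encodeNat k

/-! ### The linear ordering principle -/

/-- The relation on `{0,1}^n` given by a circuit with `2n` inputs. -/
def Circuit.Lt (E : Circuit) (x y : List Bool) : Prop := E.eval (x ++ y) = true

/-- The code of the instance of `LOP` given by the circuit `E` with `2n` inputs. -/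
def encodeLOP (n : ℕ) (E : Circuit) : List Bool :=
  encodeNat n ++ E.flatMap Gate.encode

theorem encodeNat_append_inj (a b : ℕ) (u v : List Bool)
    (h : encodeNat a ++ u = encodeNat b ++ v) : a = b ∧ u = v := by
  induction a generalizing b with
  | zero => cases b <;> simp_all [encodeNat, List.replicate_succ]
  | succ a ih =>
    cases b with
    | zero => simp [encodeNat, List.replicate_succ] at h
    | succ b =>
      have := ih b (by simpa [encodeNat, List.replicate_succ] using h)
      simpa using this

theorem Gate.encode_append_inj (g g' : Gate) (u v : List Bool)
    (h : g.encode ++ u = g'.encode ++ v) : g = g' ∧ u = v := by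
  cases g <;> cases g' <;> simp [Gate.encode] at h ⊢
  case const.const => exact h
  case inp.inp => exact encodeNat_append_inj _ _ _ _ h
  case not.not => exact encodeNat_append_inj _ _ _ _ h
  all_goals
    obtain ⟨h1, h2⟩ := encodeNat_append_inj _ _ _ _ h
    obtain ⟨h3, h4⟩ := encodeNat_append_inj _ _ _ _ h2
    exact ⟨⟨h1, h3⟩, h4⟩

theorem flatMap_encode_inj (C D : List Gate) (h : C.flatMap Gate.encode = D.flatMap Gate.encode) : C = D := by
  induction C generalizing D with
  | nil => cases D with
    | nil => rfl
    | cons g D => cases g <;> simp [Gate.encode] at h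
  | cons g C ih => cases D with
    | nil => cases g <;> simp [Gate.encode] at h
    | cons g' D =>
      simp only [List.flatMap_cons] at h
      obtain ⟨rfl, h2⟩ := Gate.encode_append_inj _ _ _ _ h
      rw [ih D h2]

/-- The encoding of instances is injective. -/
theorem encodeLOP_inj (n n' : ℕ) (E E' : Circuit) (h : encodeLOP n E = encodeLOP n' E') :
    n = n' ∧ E = E' := by
  obtain ⟨h1, h2⟩ := encodeNat_append_inj _ _ _ _ h
  exact ⟨h1, flatMap_encode_inj _ _ h2⟩

/-- `a` is a correct answer on the instance `E` with `2n` inputs: either the minimum, or a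
counterexample that shows that `E` does not describe a strict linear order on `{0,1}^n`. The
answers are tagged by their first bits. -/
inductive LOPAnswer (n : ℕ) (E : Circuit) : List Bool → Prop
  | min (x : List Bool) (hx : x.length = n)
      (h : ∀ y : List Bool, y.length = n → y ≠ x → E.Lt x y) :
      LOPAnswer n E (false :: x)
  | twoCycle (x y : List Bool) (hx : x.length = n) (hy : y.length = n)
      (hxy : E.Lt x y) (hyx : E.Lt y x) :
      LOPAnswer n E (true :: false :: (x ++ y))
  | incomparable (x y : List Bool) (hx : x.length = n) (hy : y.length = n)
      (hne : x ≠ y) (hxy : ¬ E.Lt x y) (hyx : ¬ E.Lt y x) :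
      LOPAnswer n E (true :: false :: (x ++ y))
  | threeCycle (x y z : List Bool) (hx : x.length = n) (hy : y.length = n) (hz : z.length = n)
      (hxy : E.Lt x y) (hyz : E.Lt y z) (hzx : E.Lt z x) :
      LOPAnswer n E (true :: true :: (x ++ y ++ z))

/-- `f` solves the total search problem `LOP`. -/
def SolvesLOP (f : List Bool → List Bool) : Prop :=
  ∀ (n : ℕ) (E : Circuit), E.WF (2 * n) → LOPAnswer n E (f (encodeLOP n E))

/-- The search problem is total. -/
theorem exists_LOPAnswer (n : ℕ) (E : Circuit) : ∃ a, LOPAnswer n E a := by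
  by_contra hno
  push Not at hno
  have h2 : ∀ x y : List Bool, x.length = n → y.length = n → E.Lt x y → ¬ E.Lt y x :=
    fun x y hx hy h h' => hno _ (.twoCycle x y hx hy h h')
  have h3 : ∀ x y : List Bool, x.length = n → y.length = n → x ≠ y → ¬ E.Lt x y → E.Lt y x :=
    fun x y hx hy hne h => by_contra fun h' => hno _ (.incomparable x y hx hy hne h h')
  have h4 : ∀ x y z : List Bool, x.length = n → y.length = n → z.length = n →
     E.Lt x y → E.Lt y z → ¬ E.Lt z x :=
    fun x y z hx hy hz h h' h'' => hno _ (.threeCycle x y z hx hy hz h h' h'')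
  let U := {x : List Bool // x.length = n}
  have : Finite U := (List.finite_length_eq Bool n)
  have : Nonempty U := ⟨⟨List.replicate n true, by simp⟩⟩
  let r : U → U → Prop := fun x y => E.Lt x.1 y.1
  have : IsTrans U r := ⟨fun x y z hxy hyz => by
    by_contra hxz
    by_cases e : x = z
    · subst e; exact h2 _ _ x.2 y.2 hxy hyz
    · exact h4 _ _ _ x.2 y.2 z.2 hxy hyz (h3 _ _ x.2 z.2 (fun h => e (Subtype.ext h)) hxz)⟩
  have : Std.Irrefl r := ⟨fun x h => h2 _ _ x.2 x.2 h h⟩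
  have wf : WellFounded r := Finite.wellFounded_of_trans_of_irrefl r
  obtain ⟨m, -, hm⟩ := wf.has_min Set.univ ⟨Classical.arbitrary U, trivial⟩
  refine hno _ (.min m.1 m.2 fun y hy hne => ?_)
  exact h3 _ _ hy m.2 hne (hm ⟨y, hy⟩ trivial)

/-- `LOP` has a solver. -/
theorem exists_solvesLOP : ∃ f, SolvesLOP f := by
  classical
  refine ⟨fun q => if h : ∃ p : ℕ × Circuit, encodeLOP p.1 p.2 = q then
    (exists_LOPAnswer h.choose.1 h.choose.2).choose else [], fun n E _ => ?_⟩
  have h : ∃ p : ℕ × Circuit, encodeLOP p.1 p.2 = encodeLOP n E := ⟨(n, E), rfl⟩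
  simp only [dif_pos h]
  have e := encodeLOP_inj _ _ _ _ h.choose_spec
  have key := (exists_LOPAnswer h.choose.1 h.choose.2).choose_spec
  generalize (exists_LOPAnswer h.choose.1 h.choose.2).choose = a at key ⊢
  rwa [e.1, e.2] at key

open Classical in
/-- The oracle that decides `A` on queries that begin with `0`, and applies `f` to queries that
begin with `1`. -/
noncomputable def joinOracle (A : Language Bool) (f : List Bool → List Bool) : Oracle
  | [], a => a = []
  | false :: q, a => a = [decide (q ∈ A)]
  | true :: q, a => a = f q

/-- The class `L₂ᵖ`: languages that are `P^NP`-Turing reducible to `LOP`, that is, decided in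
polynomial time by a deterministic machine with access to an `NP` oracle and to an arbitrary
solver of `LOP`. -/
def L2P : Set (Language Bool) :=
  {L | ∃ A ∈ NP, ∃ (M : OracleMachine) (p : Polynomial ℕ),
    ∀ f : List Bool → List Bool, SolvesLOP f → M.DecidesIn (joinOracle A f) L p}

end Cplx

namespace Cplx

/-! ### A structured language for stack programs -/

/-! The `P^NP` machine with a solver of `LOP` is simulated by a machine that answers every query
itself with the help of one promise problem in `prSBP`. Queries to the `NP` language are
existential, and such questions always satisfy a promise with exponentially small threshold: a
single witness already has noticeable probability, and without a witness the probability is zero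
(`oracle_false_iff`).

For a query `q` to `LOP` on strings of length `n`, a counterexample is sought by prefix search; this
again needs only existential questions (`exists_search_result`). If there is none, the relation is a
strict linear order and its minimum has to be found. Let `rank x` be the share of strings below `x`,
let `share x a` be the share of the interval `[a, x)`, and put `k = 2|q| + 2`, which is at least `2n
+ 2`. The density of `x` is the average over `a` of `[a < x] * share x a ^ k`: the probability that
a random `a` is below `x` and that `k` further random strings all fall into `[a, x)`. It can be
sampled in polynomial time, so the promise problem compares it, up to a factor 2, with powers of 2.
The extreme case where `a` is the minimum gives `rank x ^ k / 2 ^ n ≤ density x ≤ rank x ^ k` for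
every `x` other than the minimum (`IsOrder.rank_pow_le`, `density_nil_le`).

A round of the descent starts with `density x < 2ε`. Bit by bit it fixes an element `u` whose
contribution to the density is nearly maximal; each approximate comparison loses a factor 2
(`density_of_search`). If `density x ≥ ε`, then `share x u ^ k ≥ ε / 2 ^ (n + 1)`, whereas `rank x ^
k < 2 ^ (n + 1) * ε`. The quotient is above `2 ^ (-k)`, so `share x u > rank x / 2`: the rank of `u`
is at most half that of `x`, and `density u < ε` (`IsOrder.density_lt`). After polynomially many
rounds the density is below `2 ^ (-(nk + n))`, which only the minimum satisfies (`IsOrder.eq_min`).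

Outside the promise the oracle may answer inconsistently, so intermediate elements depend on the
run. The final answer does not: an existential search has forced answers, and the minimum is unique
(`exists_answer`). The procedure therefore defines a genuine function that solves `LOP`, and the
given machine decides `L` with this function as its oracle.

Polynomial time is established through a structured stack language, compiled to oracle machines
(`Ev.haltsWith`), and through the converse simulation of machines by programs (`Comp.of_decidesIn`).
-/

/-- Structured programs over stacks of bits, with oracle calls. -/
inductive Cmd (K : Type) : Type
  | skip : Cmd K
  | call : Cmd K
  | push (k : K) (b : Bool) : Cmd K
  /-- pop from `k` and branch on the result: empty, `true`, `false` -/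
  | pop (k : K) (n t f : Cmd K) : Cmd K
  | seq (a b : Cmd K) : Cmd K
  /-- as long as `true` is popped from `k`, run `a` -/
  | loop (k : K) (a : Cmd K) : Cmd K
  /-- pop the bits of `k` until it is empty, running `t` or `f` for each of them -/
  | each (k : K) (t f : Cmd K) : Cmd K

namespace Cmd

infixr:60 " ;; " => Cmd.seq

variable {K : Type}

/-- `Ev A qk ak c S t Q`: started on the stacks `S`, the program `c` stops within `t` steps with
stacks that satisfy `Q`, whichever admissible answers the oracle gives. -/
inductive Ev [DecidableEq K] (A : Oracle) (qk ak : K) :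
    Cmd K → (K → List Bool) → ℕ → ((K → List Bool) → Prop) → Prop
  | skip {S Q} : Q S → Ev A qk ak skip S 1 Q
  | call {S Q} : (∃ a, A (S qk) a) →
      (∀ a, A (S qk) a → Q (Function.update (Function.update S qk []) ak a)) →
      Ev A qk ak call S 1 Q
  | push {S Q k b} : Q (Function.update S k (b :: S k)) → Ev A qk ak (push k b) S 1 Q
  | pop_nil {S Q k n c d t} : S k = [] → Ev A qk ak n S t Q → Ev A qk ak (pop k n c d) S (t + 1) Q
  | pop_true {S Q k n c d t r} : S k = true :: r → Ev A qk ak c (Function.update S k r) t Q →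
      Ev A qk ak (pop k n c d) S (t + 1) Q
  | pop_false {S Q k n c d t r} : S k = false :: r → Ev A qk ak d (Function.update S k r) t Q →
      Ev A qk ak (pop k n c d) S (t + 1) Q
  -- The bound `t'` is uniform in the intermediate stacks, which may depend on the answers of the
  -- oracle.
  | seq {S Q R a b t t'} : Ev A qk ak a S t R → (∀ S', R S' → Ev A qk ak b S' t' Q) →
      Ev A qk ak (seq a b) S (t + t') Q
  | loop_nil {S Q k a} : S k = [] → Q S → Ev A qk ak (loop k a) S 1 Q
  | loop_false {S Q k a r} : S k = false :: r → Q (Function.update S k r) →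
      Ev A qk ak (loop k a) S 1 Q
  | loop_true {S Q R k a r t t'} : S k = true :: r → Ev A qk ak a (Function.update S k r) t R →
      (∀ S', R S' → Ev A qk ak (loop k a) S' t' Q) → Ev A qk ak (loop k a) S (t + t' + 1) Q
  | each_nil {S Q k c d} : S k = [] → Q S → Ev A qk ak (each k c d) S 1 Q
  | each_true {S Q R k c d r t t'} : S k = true :: r → Ev A qk ak c (Function.update S k r) t R →
      (∀ S', R S' → Ev A qk ak (each k c d) S' t' Q) → Ev A qk ak (each k c d) S (t + t' + 1) Q
  | each_false {S Q R k c d r t t'} : S k = false :: r → Ev A qk ak d (Function.update S k r) t R →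
      (∀ S', R S' → Ev A qk ak (each k c d) S' t' Q) → Ev A qk ak (each k c d) S (t + t' + 1) Q
  | mono {S Q Q' c t t'} : Ev A qk ak c S t Q → t ≤ t' → (∀ S', Q S' → Q' S') →
      Ev A qk ak c S t' Q'

/-! #### Compilation to oracle machines -/

/-- The program points of a program. -/
def Pos : Cmd K → Type
  | skip => Unit
  | call => Unit
  | push _ _ => Unit
  | pop _ n t f => Option (n.Pos ⊕ (t.Pos ⊕ f.Pos))
  | seq a b => a.Pos ⊕ b.Pos
  | loop _ a => Option a.Pos
  | each _ t f => Option (t.Pos ⊕ f.Pos)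

theorem finite_pos (c : Cmd K) : Finite c.Pos := by
  induction c <;> simp only [Pos] <;> infer_instance

/-- The point where the execution of a program begins. -/
def entry : (c : Cmd K) → c.Pos
  | skip => ()
  | call => ()
  | push _ _ => ()
  | pop _ _ _ _ => none
  | seq a _ => Sum.inl a.entry
  | loop _ _ => none
  | each _ _ _ => none

/-- The machine code of a program whose points are embedded by `e` into the labels, and which
continues at the label `x`. -/
def code {Lab : Type} : (c : Cmd K) → (c.Pos → Lab) → Lab → c.Pos →
    Turing.TM2.Stmt (fun _ : K => Bool) Lab (Option Bool) ⊕ Lab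
  | skip, _, x, _ => Sum.inl (.goto fun _ => x)
  | call, _, x, _ => Sum.inr x
  | push k b, _, x, _ => Sum.inl (.push k (fun _ => b) (.goto fun _ => x))
  -- The popped bit passes through the internal state, which the following jump reads; hence the
  -- states of the compiled machine are `Option Bool`.
  | pop k n t f, e, _, none => Sum.inl (.pop k (fun _ o => o) (.goto fun o =>
      o.elim (e (some (.inl n.entry)))
        fun b => bif b then e (some (.inr (.inl t.entry))) else e (some (.inr (.inr f.entry)))))
  | pop _ n _ _, e, x, some (.inl p) => n.code (fun p => e (some (.inl p))) x p
  | pop _ _ t _, e, x, some (.inr (.inl p)) => t.code (fun p => e (some (.inr (.inl p)))) x p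
  | pop _ _ _ f, e, x, some (.inr (.inr p)) => f.code (fun p => e (some (.inr (.inr p)))) x p
  | seq a b, e, _, .inl p => a.code (fun p => e (.inl p)) (e (.inr b.entry)) p
  | seq _ b, e, x, .inr p => b.code (fun p => e (.inr p)) x p
  | loop k a, e, x, none => Sum.inl (.pop k (fun _ o => o) (.goto fun o =>
      o.elim x fun b => bif b then e (some a.entry) else x))
  | loop _ a, e, _, some p => a.code (fun p => e (some p)) (e none) p
  | each k t f, e, x, none => Sum.inl (.pop k (fun _ o => o) (.goto fun o =>
      o.elim x fun b => bif b then e (some (.inl t.entry)) else e (some (.inr f.entry))))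
  | each _ t _, e, _, some (.inl p) => t.code (fun p => e (some (.inl p))) (e none) p
  | each _ _ f, e, _, some (.inr p) => f.code (fun p => e (some (.inr p))) (e none) p

end Cmd

theorem OracleMachine.HaltsWith.mono {M : OracleMachine} {A : Oracle} {y : List Bool} {t t' : ℕ}
    {c : M.Cfg} (h : M.HaltsWith A y t c) (ht : t ≤ t') : M.HaltsWith A y t' c := by
  induction h generalizing t' with
  | halted hl hy => exact .halted hl hy
  | step hex _ ih =>
    obtain ⟨s, rfl⟩ : ∃ s, t' = s + 1 := ⟨t' - 1, by omega⟩
    exact .step hex fun c' hc => ih c' hc (by omega)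

theorem OracleMachine.HaltsWith.congr {M : OracleMachine} {A : Oracle} {y : List Bool} {t : ℕ}
    {l : Option M.Lab} {v : M.St} {S S' : M.K → List Bool} (h : M.HaltsWith A y t ⟨l, v, S⟩)
    (hS : S' = S) : M.HaltsWith A y t ⟨l, v, S'⟩ := hS ▸ h

theorem OracleMachine.HaltsWith.stmt {M : OracleMachine} {A : Oracle} {y : List Bool} {t : ℕ}
    {l : M.Lab} {s : Turing.TM2.Stmt (fun _ : M.K => Bool) M.Lab M.St} (hs : M.prog l = Sum.inl s)
    {v : M.St} {S : M.K → List Bool} (h : M.HaltsWith A y t (Turing.TM2.stepAux s v S)) :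
    M.HaltsWith A y (t + 1) ⟨some l, v, S⟩ := by
  refine .step ⟨_, .stmt hs v S⟩ fun c' hc => ?_
  cases hc with
  | stmt h' => obtain rfl := Sum.inl.inj (hs.symm.trans h'); exact h
  | call h' => simp [hs] at h'

theorem OracleMachine.HaltsWith.ofCall {M : OracleMachine} {A : Oracle} {y : List Bool} {t : ℕ}
    {l l' : M.Lab} (hs : M.prog l = Sum.inr l')
    {v : M.St} {S : M.K → List Bool} (hex : ∃ a, A (S M.query) a)
    (h : ∀ a, A (S M.query) a → M.HaltsWith A y t
      ⟨some l', v, Function.update (Function.update S M.query []) M.answer a⟩) :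
    M.HaltsWith A y (t + 1) ⟨some l, v, S⟩ := by
  obtain ⟨a, ha⟩ := hex
  refine .step ⟨_, .call hs v S ha⟩ fun c' hc => ?_
  cases hc with
  | stmt h' => simp [hs] at h'
  | call h' _ _ ha => obtain rfl := Sum.inr.inj (hs.symm.trans h'); exact h _ ha

namespace Cmd

variable {K : Type} [DecidableEq K]

/-- The machine that runs the program `c`, with input and output on the stack `i`. -/
noncomputable def machine [Fintype K] (qk ak i : K) (h : qk ≠ ak) (c : Cmd K) : OracleMachine where
  K := K
  Lab := Option c.Pos
  finLab := by
    have := c.finite_pos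
    exact Fintype.ofFinite _
  St := Option Bool
  input := i
  output := i
  query := qk
  answer := ak
  query_ne_answer := h
  main := some c.entry
  initState := none
  prog l := match l with
    | none => Sum.inl .halt
    | some p => c.code some none p

theorem update_nil {S : K → List Bool} {k : K} (h : S k = []) : Function.update S k [] = S := by
  rw [← h, Function.update_eq_self]

/-- Correctness of the compilation in continuation form: the time `t'` after the exit label `x` is a
hypothesis. Since `e`, `x` and `t'` vary in the induction, a subprogram can use the entry of its
successor as its exit, and a loop body the head of the loop. -/
theorem Ev.haltsWith [Fintype K] {A : Oracle} {qk ak i : K} {h : qk ≠ ak} {c₀ c : Cmd K}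
    {S : K → List Bool} {t : ℕ} {Q : (K → List Bool) → Prop} (hc : Ev A qk ak c S t Q)
    {e : c.Pos → Option c₀.Pos} {x : Option c₀.Pos} {y : List Bool} {t' : ℕ}
    (he : ∀ p, (machine qk ak i h c₀).prog (e p) = c.code e x p)
    (hx : ∀ S', Q S' → ∀ v, (machine qk ak i h c₀).HaltsWith A y t' ⟨some x, v, S'⟩)
    (v : Option Bool) :
    (machine qk ak i h c₀).HaltsWith A y (t + t') ⟨some (e c.entry), v, S⟩ := by
  induction hc generalizing x t' v with
  | skip hq =>
    rw [add_comm]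
    exact .stmt (he _) (hx _ hq _)
  | call hex hq =>
    rw [add_comm]
    exact .ofCall (he _) hex fun a ha => hx _ (hq a ha) _
  | push hq =>
    rw [add_comm]
    exact .stmt (he _) (hx _ hq _)
  | @pop_nil S Q k n c d t hk hn ih =>
    rw [add_right_comm]
    refine .stmt (he none) ?_
    simp only [Turing.TM2.stepAux, hk, List.tail_nil, List.head?_nil, Option.elim]
    exact (ih (e := fun p => e (some (.inl p))) (fun p => he (some (.inl p))) hx _).congr
      (update_nil hk)
  | @pop_true S Q k n c d t r hk hn ih =>
    rw [add_right_comm]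
    refine .stmt (he none) ?_
    simp only [Turing.TM2.stepAux, hk, List.tail_cons, List.head?_cons, Option.elim]
    exact ih (e := fun p => e (some (.inr (.inl p)))) (fun p => he (some (.inr (.inl p)))) hx _
  | @pop_false S Q k n c d t r hk hn ih =>
    rw [add_right_comm]
    refine .stmt (he none) ?_
    simp only [Turing.TM2.stepAux, hk, List.tail_cons, List.head?_cons, Option.elim]
    exact ih (e := fun p => e (some (.inr (.inr p)))) (fun p => he (some (.inr (.inr p)))) hx _
  | @seq S Q R a b t t'' ha hb iha ihb =>
    rw [add_assoc]
    exact iha (e := fun p => e (.inl p)) (fun p => he (.inl p)) (fun S' hS' v' =>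
      ihb S' hS' (e := fun p => e (.inr p)) (fun p => he (.inr p)) hx v') v
  | @loop_nil S Q k a hk hq =>
    rw [add_comm]
    refine .stmt (he none) ?_
    simp only [Turing.TM2.stepAux, hk, List.tail_nil, List.head?_nil, Option.elim]
    exact (hx _ hq _).congr (update_nil hk)
  | @loop_false S Q k a r hk hq =>
    rw [add_comm]
    refine .stmt (he none) ?_
    simp only [Turing.TM2.stepAux, hk, List.tail_cons, List.head?_cons, Option.elim]
    exact hx _ hq _
  | @loop_true S Q R k a r t t'' hk ha hb iha ihb =>
    rw [add_right_comm, add_assoc t]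
    refine .stmt (he none) ?_
    simp only [Turing.TM2.stepAux, hk, List.tail_cons, List.head?_cons, Option.elim]
    exact iha (e := fun p => e (some p)) (fun p => he (some p)) (fun S' hS' v' =>
      ihb S' hS' he hx v') _
  | @each_nil S Q k c d hk hq =>
    rw [add_comm]
    refine .stmt (he none) ?_
    simp only [Turing.TM2.stepAux, hk, List.tail_nil, List.head?_nil, Option.elim]
    exact (hx _ hq _).congr (update_nil hk)
  | @each_true S Q R k c d r t t'' hk ha hb iha ihb =>
    rw [add_right_comm, add_assoc t]
    refine .stmt (he none) ?_
    simp only [Turing.TM2.stepAux, hk, List.tail_cons, List.head?_cons, Option.elim]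
    exact iha (e := fun p => e (some (.inl p))) (fun p => he (some (.inl p))) (fun S' hS' v' =>
      ihb S' hS' he hx v') _
  | @each_false S Q R k c d r t t'' hk ha hb iha ihb =>
    rw [add_right_comm, add_assoc t]
    refine .stmt (he none) ?_
    simp only [Turing.TM2.stepAux, hk, List.tail_cons, List.head?_cons, Option.elim]
    exact iha (e := fun p => e (some (.inr p))) (fun p => he (some (.inr p))) (fun S' hS' v' =>
      ihb S' hS' he hx v') _
  | mono _ ht hq ih =>
    exact (ih he (fun S' hS' => hx S' (hq S' hS')) v).mono (by omega)

theorem Ev.haltsWith_machine [Fintype K] {A : Oracle} {qk ak i : K} (h : qk ≠ ak) {c : Cmd K}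
    {x y : List Bool} {t : ℕ}
    (hc : Ev A qk ak c (Function.update (fun _ => []) i x) t fun S => S i = y) :
    (machine qk ak i h c).HaltsWith A y (t + 1) ((machine qk ak i h c).initCfg x) := by
  refine hc.haltsWith (e := some) (x := none) (t' := 1) (fun p => rfl) (fun S' hS' v => ?_) _
  -- The exit label `none` is a proper label of the compiled machine and carries `halt`; this costs
  -- the extra step.
  exact OracleMachine.HaltsWith.stmt (t := 0) (M := machine qk ak i h c) (l := none) (s := .halt)
    rfl (.halted rfl hS')

end Cmd

theorem eval_mono (p : Polynomial ℕ) {a b : ℕ} (h : a ≤ b) : p.eval a ≤ p.eval b := by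
  simp only [Polynomial.eval_eq_sum_range]
  gcongr

namespace Cmd

/-! #### Rules for programs -/

section rules

variable {K : Type} [DecidableEq K] {A : Oracle} {qk ak : K}

theorem Ev.seq_eq {a b : Cmd K} {S S' : K → List Bool} {t t' : ℕ} {Q : (K → List Bool) → Prop}
    (ha : Ev A qk ak a S t (· = S')) (hb : Ev A qk ak b S' t' Q) :
    Ev A qk ak (a ;; b) S (t + t') Q :=
  .seq ha fun _ h => h ▸ hb

theorem Ev.mono_left {c : Cmd K} {S : K → List Bool} {t t' : ℕ} {Q : (K → List Bool) → Prop}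
    (h : Ev A qk ak c S t Q) (ht : t ≤ t') : Ev A qk ak c S t' Q :=
  h.mono ht fun _ h => h

theorem Ev.mono_right {c : Cmd K} {S : K → List Bool} {t : ℕ} {Q Q' : (K → List Bool) → Prop}
    (h : Ev A qk ak c S t Q) (hQ : ∀ S, Q S → Q' S) : Ev A qk ak c S t Q' :=
  h.mono le_rfl hQ

/-- The invariant is indexed by the bits still to be read from `k`, so the body has to leave `k` as
it finds it. -/
theorem Ev.of_each {k : K} {c d : Cmd K} (I : List Bool → (K → List Bool) → Prop) {t : ℕ}
    (hI : ∀ l S, I l S → S k = l)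
    (hc : ∀ r S, I (true :: r) S → Ev A qk ak c (Function.update S k r) t (I r))
    (hd : ∀ r S, I (false :: r) S → Ev A qk ak d (Function.update S k r) t (I r))
    (l : List Bool) (S : K → List Bool) (h : I l S) :
    Ev A qk ak (.each k c d) S (l.length * (t + 1) + 1) (I []) := by
  induction l generalizing S with
  | nil => simpa using Ev.each_nil (hI _ _ h) h
  | cons b l ih =>
    have e : (b :: l).length * (t + 1) + 1 = t + (l.length * (t + 1) + 1) + 1 := by
      rw [List.length_cons]; ring
    rw [e]
    cases b
    · exact .each_false (hI _ _ h) (hd _ _ h) ih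
    · exact .each_true (hI _ _ h) (hc _ _ h) ih

/-- Here the body may itself pop from `k`; the length of that stack is the variant. -/
theorem Ev.of_loop {k : K} {c : Cmd K} (I : List Bool → (K → List Bool) → Prop)
    {Q : (K → List Bool) → Prop} {t : ℕ} (hI : ∀ l S, I l S → S k = l)
    (hc : ∀ r S, I (true :: r) S → Ev A qk ak c (Function.update S k r) t
      fun S' => ∃ l, l.length ≤ r.length ∧ I l S')
    (hnil : ∀ S, I [] S → Q S) (hf : ∀ r S, I (false :: r) S → Q (Function.update S k r))
    (n : ℕ) (l : List Bool) (hl : l.length ≤ n) (S : K → List Bool) (h : I l S) :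
    Ev A qk ak (.loop k c) S (n * (t + 1) + 1) Q := by
  induction n generalizing l S with
  | zero =>
    obtain rfl := List.length_eq_zero_iff.mp (Nat.le_zero.mp hl)
    simpa using Ev.loop_nil (hI _ _ h) (hnil _ h)
  | succ n ih =>
    match l with
    | [] => exact (Ev.loop_nil (hI _ _ h) (hnil _ h)).mono_left (by omega)
    | false :: r => exact (Ev.loop_false (hI _ _ h) (hf _ _ h)).mono_left (by omega)
    | true :: r =>
      have e : (n + 1) * (t + 1) + 1 = t + (n * (t + 1) + 1) + 1 := by ring
      rw [e]
      refine .loop_true (hI _ _ h) (hc _ _ h) fun S' ⟨l', hl', h'⟩ => ?_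
      exact ih l' (by simp at hl; omega) S' h'

/-- Move the contents of `k` to `k'`, reversing it. -/
def move (k k' : K) : Cmd K := .each k (.push k' true) (.push k' false)

theorem Ev.move {k k' : K} (h : k ≠ k') (S : K → List Bool) :
    Ev A qk ak (.move k k') S (2 * (S k).length + 1)
      (· = Function.update (Function.update S k []) k' ((S k).reverse ++ S k')) := by
  refine ((Ev.of_each (t := 1) (I := fun l T => ∃ m, S k = m ++ l ∧
    T = Function.update (Function.update S k l) k' (m.reverse ++ S k')) ?_ ?_ ?_ (S k) S
    ⟨[], by simp⟩).mono_left (by omega)).mono_right ?_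
  · rintro l T ⟨m, -, rfl⟩
    simp [h]
  · rintro r T ⟨m, hm, rfl⟩
    refine .push ⟨m ++ [true], by simp [hm], ?_⟩
    ext1 j
    by_cases h1 : j = k' <;> by_cases h2 : j = k <;> simp_all [Function.update_apply]
  · rintro r T ⟨m, hm, rfl⟩
    refine .push ⟨m ++ [false], by simp [hm], ?_⟩
    ext1 j
    by_cases h1 : j = k' <;> by_cases h2 : j = k <;> simp_all [Function.update_apply]
  · rintro T ⟨m, hm, rfl⟩
    simp [hm]

/-- Empty the stack `k`. -/
def clear (k : K) : Cmd K := .each k .skip .skip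

theorem Ev.clear (k : K) (S : K → List Bool) :
    Ev A qk ak (.clear k) S (2 * (S k).length + 1) (· = Function.update S k []) := by
  refine ((Ev.of_each (t := 1) (I := fun l T => T = Function.update S k l) ?_ ?_ ?_ (S k) S
    (by simp)).mono_left (by omega)).mono_right ?_
  · rintro l T rfl
    simp
  · rintro r T rfl
    exact .skip (by simp)
  · rintro r T rfl
    exact .skip (by simp)
  · rintro T rfl
    rfl

/-- A program that makes no oracle calls behaves in the same way with any oracle. -/
theorem Ev.of_empty {c : Cmd K} {S : K → List Bool} {t : ℕ} {Q : (K → List Bool) → Prop}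
    (h : Ev (fun _ _ => False) qk ak c S t Q) : Ev A qk ak c S t Q := by
  induction h with
  | skip hq => exact .skip hq
  | call hex => obtain ⟨a, ha⟩ := hex; exact ha.elim
  | push hq => exact .push hq
  | pop_nil h _ ih => exact .pop_nil h ih
  | pop_true h _ ih => exact .pop_true h ih
  | pop_false h _ ih => exact .pop_false h ih
  | seq _ _ iha ihb => exact .seq iha ihb
  | loop_nil h hq => exact .loop_nil h hq
  | loop_false h hq => exact .loop_false h hq
  | loop_true h _ _ iha ihb => exact .loop_true h iha ihb
  | each_nil h hq => exact .each_nil h hq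
  | each_true h _ _ iha ihb => exact .each_true h iha ihb
  | each_false h _ _ iha ihb => exact .each_false h iha ihb
  | mono _ ht hq ih => exact ih.mono ht hq

end rules

/-! ### Renaming of stacks -/

/-- Rename the stacks of a program. -/
def map {K K' : Type} (e : K → K') : Cmd K → Cmd K'
  | skip => skip
  | call => call
  | push k b => push (e k) b
  | pop k n t f => pop (e k) (n.map e) (t.map e) (f.map e)
  | seq a b => seq (a.map e) (b.map e)
  | loop k a => loop (e k) (a.map e)
  | each k t f => each (e k) (t.map e) (f.map e)

/-- A frame rule: stacks outside the range of `e` keep their contents, so programs with private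
stacks can be run next to each other. -/
theorem Ev.map {K K' : Type} [DecidableEq K] [DecidableEq K'] {A : Oracle} {qk ak : K} {e : K → K'}
    (he : Function.Injective e) {c : Cmd K} {S : K → List Bool} {t : ℕ}
    {Q : (K → List Bool) → Prop} (h : Ev A qk ak c S t Q) (T : K' → List Bool) (hT : T ∘ e = S) :
    Ev A (e qk) (e ak) (c.map e) T t
      fun T' => Q (T' ∘ e) ∧ ∀ k, k ∉ Set.range e → T' k = T k := by
  have upd : ∀ (T : K' → List Bool) (k : K) (r : List Bool),
      Function.update T (e k) r ∘ e = Function.update (T ∘ e) k r :=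
    fun T k r => Function.update_comp_eq_of_injective _ he _ _
  have off : ∀ (T : K' → List Bool) (k : K) (r : List Bool) (j : K'), j ∉ Set.range e →
      Function.update T (e k) r j = T j := fun T k r j hj =>
    Function.update_of_ne (fun h => hj ⟨k, h.symm⟩) _ _
  induction h generalizing T with
  | skip hq => exact .skip ⟨hT ▸ hq, fun _ _ => rfl⟩
  | call hex hq =>
    subst hT
    refine .call hex fun a ha => ⟨?_, fun j hj => ?_⟩
    · rw [upd, upd]; exact hq a ha
    · rw [off _ _ _ _ hj, off _ _ _ _ hj]
  | push hq =>
    subst hT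
    refine .push ⟨?_, fun j hj => off _ _ _ _ hj⟩
    rw [upd]; exact hq
  | pop_nil h _ ih =>
    subst hT
    exact .pop_nil h (ih _ rfl)
  | pop_true h _ ih =>
    subst hT
    refine .pop_true h ((ih _ (upd _ _ _)).mono_right fun T' h' => ⟨h'.1, fun j hj => ?_⟩)
    rw [h'.2 _ hj, off _ _ _ _ hj]
  | pop_false h _ ih =>
    subst hT
    refine .pop_false h ((ih _ (upd _ _ _)).mono_right fun T' h' => ⟨h'.1, fun j hj => ?_⟩)
    rw [h'.2 _ hj, off _ _ _ _ hj]
  | seq _ _ iha ihb =>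
    refine .seq (iha _ hT) fun T' h' => (ihb _ h'.1 _ rfl).mono_right fun T'' h'' =>
      ⟨h''.1, fun j hj => ?_⟩
    rw [h''.2 _ hj, h'.2 _ hj]
  | loop_nil h hq =>
    subst hT
    exact .loop_nil h ⟨hq, fun _ _ => rfl⟩
  | loop_false h hq =>
    subst hT
    refine .loop_false h ⟨?_, fun j hj => off _ _ _ _ hj⟩
    rw [upd]; exact hq
  | loop_true h _ _ iha ihb =>
    subst hT
    refine .loop_true h (iha _ (upd _ _ _)) fun T' h' => (ihb _ h'.1 _ rfl).mono_right
      fun T'' h'' => ⟨h''.1, fun j hj => ?_⟩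
    rw [h''.2 _ hj, h'.2 _ hj, off _ _ _ _ hj]
  | each_nil h hq =>
    subst hT
    exact .each_nil h ⟨hq, fun _ _ => rfl⟩
  | each_true h _ _ iha ihb =>
    subst hT
    refine .each_true h (iha _ (upd _ _ _)) fun T' h' => (ihb _ h'.1 _ rfl).mono_right
      fun T'' h'' => ⟨h''.1, fun j hj => ?_⟩
    rw [h''.2 _ hj, h'.2 _ hj, off _ _ _ _ hj]
  | each_false h _ _ iha ihb =>
    subst hT
    refine .each_false h (iha _ (upd _ _ _)) fun T' h' => (ihb _ h'.1 _ rfl).mono_right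
      fun T'' h'' => ⟨h''.1, fun j hj => ?_⟩
    rw [h''.2 _ hj, h'.2 _ hj, off _ _ _ _ hj]
  | mono _ ht hq ih => exact (ih _ hT).mono ht fun T' h' => ⟨hq _ h'.1, h'.2⟩

end Cmd

/-! ### Relations computed in polynomial time with an oracle -/

/-- Stacks of a program: for queries, for answers, for input and output, and for auxiliary data. -/
inductive Reg (K : Type) : Type
  | query : Reg K
  | answer : Reg K
  | io : Reg K
  | tmp (k : K) : Reg K
  deriving DecidableEq

namespace Reg

variable {K K' : Type}

instance [Finite K] : Finite (Reg K) :=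
  Finite.of_injective (β := Option (Option (Option K)))
    (fun r => match r with
      | query => none
      | answer => some none
      | io => some (some none)
      | tmp k => some (some (some k)))
    (by rintro (_ | _ | _ | k) (_ | _ | _ | k') <;> simp)

def map (e : K → K') : Reg K → Reg K'
  | query => query
  | answer => answer
  | io => io
  | tmp k => tmp (e k)

theorem map_injective {e : K → K'} (he : Function.Injective e) : Function.Injective (map e) := by
  rintro (_ | _ | _ | k) (_ | _ | _ | k') <;> simp [map]
  exact @he _ _

/-- Contents `x` of the input/output stack and `s` of the auxiliary stacks. -/
def st (x : List Bool) (s : K → List Bool) : Reg K → List Bool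
  | io => x
  | tmp k => s k
  | _ => []

/-- Only the input/output stack is not empty. -/
def clean (x : List Bool) : Reg K → List Bool := st x fun _ => []

@[simp] theorem st_io (x : List Bool) (s : K → List Bool) : st x s io = x := rfl
@[simp] theorem st_tmp (x : List Bool) (s : K → List Bool) (k : K) : st x s (tmp k) = s k := rfl

@[simp] theorem update_st_io [DecidableEq K] (x y : List Bool) (s : K → List Bool) :
    Function.update (st x s) io y = st y s := by
  ext1 (_ | _ | _ | k) <;> simp [st]

@[simp] theorem update_st_tmp [DecidableEq K] (x y : List Bool) (s : K → List Bool) (k : K) :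
    Function.update (st x s) (tmp k) y = st x (Function.update s k y) := by
  ext1 (_ | _ | _ | k) <;> simp [Function.update_apply, st]

theorem clean_eq_update [DecidableEq K] (x : List Bool) :
    (clean x : Reg K → List Bool) = Function.update (fun _ => []) io x := by
  ext1 (_ | _ | _ | k) <;> simp [st, clean]

end Reg

open Cmd

/-- `Comp A F`: some program with oracle `A` finds in polynomial time, on any input `x`, some `y`
of polynomial length with `F x y`. -/
def Comp (A : Oracle) (F : List Bool → List Bool → Prop) : Prop :=
  ∃ (K : Type) (_ : DecidableEq K) (_ : Finite K) (c : Cmd (Reg K)) (p : Polynomial ℕ), ∀ x,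
    Ev A Reg.query Reg.answer c (Reg.clean x) (p.eval x.length)
      fun S => ∃ y, F x y ∧ y.length ≤ p.eval x.length ∧ S = Reg.clean y

/-- The function `f` is computable in polynomial time. -/
@[fun_prop]
def FP (f : List Bool → List Bool) : Prop := Comp (fun _ _ => False) fun x y => y = f x

theorem Comp.of_FP {A : Oracle} {f : List Bool → List Bool} (h : FP f) :
    Comp A fun x y => y = f x := by
  obtain ⟨K, _, _, c, p, hc⟩ := h
  exact ⟨K, _, ‹_›, c, p, fun x => (hc x).of_empty⟩

theorem Comp.mono {A : Oracle} {F G : List Bool → List Bool → Prop} (h : Comp A F)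
    (hFG : ∀ x y, F x y → G x y) : Comp A G := by
  obtain ⟨K, _, _, c, p, hc⟩ := h
  exact ⟨K, _, ‹_›, c, p, fun x => (hc x).mono_right fun S ⟨y, hy, h⟩ => ⟨y, hFG _ _ hy, h⟩⟩

open Classical in
theorem Comp.decidesIn {A : Oracle} {L : Language Bool}
    (h : Comp A fun x y => y = [decide (x ∈ L)]) :
    ∃ (M : OracleMachine) (p : Polynomial ℕ), M.DecidesIn A L p := by
  obtain ⟨K, _, _, c, p, hc⟩ := h
  have := Fintype.ofFinite (Reg K)
  refine ⟨c.machine Reg.query Reg.answer Reg.io (by simp), p + 1, fun x => ?_⟩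
  simp only [Polynomial.eval_add, Polynomial.eval_one]
  refine Ev.haltsWith_machine _ ?_
  rw [← Reg.clean_eq_update]
  refine (hc x).mono_right ?_
  rintro S ⟨y, rfl, -, rfl⟩
  rfl

/-- Programs share the query, answer and input/output stacks, and a clean run leaves its private
stacks empty. Inside a larger program it therefore changes only the input/output stack. -/
theorem Cmd.Ev.embed {K K' : Type} [DecidableEq K] [DecidableEq K'] {A : Oracle} {c : Cmd (Reg K)}
    {x : List Bool} {t : ℕ} {F : List Bool → Prop}
    (h : Ev A Reg.query Reg.answer c (Reg.clean x) t fun S => ∃ y, F y ∧ S = Reg.clean y)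
    {e : K → K'} (he : Function.Injective e) {s : K' → List Bool} (hs : ∀ k, s (e k) = []) :
    Ev A Reg.query Reg.answer (c.map (Reg.map e)) (Reg.st x s) t
      fun S => ∃ y, F y ∧ S = Reg.st y s := by
  refine (h.map (Reg.map_injective he) (Reg.st x s) ?_).mono_right ?_
  · ext1 (_ | _ | _ | k) <;> simp [Reg.map, Reg.clean, Reg.st, hs]
  · rintro T ⟨⟨y, hy, hT⟩, hoff⟩
    refine ⟨y, hy, ?_⟩
    ext1 r
    by_cases hr : r ∈ Set.range (Reg.map e)
    · obtain ⟨r, rfl⟩ := hr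
      refine (congrFun hT r).trans ?_
      cases r <;> simp [Reg.map, Reg.clean, Reg.st, hs]
    · rw [hoff _ hr]
      rcases r with _ | _ | _ | k
      · exact (hr ⟨.query, rfl⟩).elim
      · exact (hr ⟨.answer, rfl⟩).elim
      · exact (hr ⟨.io, rfl⟩).elim
      · rfl

theorem Comp.bind {A : Oracle} {F G : List Bool → List Bool → Prop} (hF : Comp A F)
    (hG : Comp A G) : Comp A fun x z => ∃ y, F x y ∧ G y z := by
  obtain ⟨K, _, _, c, p, hc⟩ := hF
  obtain ⟨K', _, _, c', p', hc'⟩ := hG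
  refine ⟨K ⊕ K', inferInstance, inferInstance,
    c.map (Reg.map Sum.inl) ;; c'.map (Reg.map Sum.inr), p + p'.comp p, fun x => ?_⟩
  simp only [Polynomial.eval_add, Polynomial.eval_comp]
  simp only [← and_assoc] at hc hc'
  refine .seq (Ev.embed (hc x) Sum.inl_injective fun _ => rfl) ?_
  rintro S ⟨y, ⟨hy, hl⟩, rfl⟩
  have hm := eval_mono p' hl
  refine ((Ev.embed (hc' y) Sum.inr_injective fun _ => rfl).mono_left hm).mono_right ?_
  rintro S ⟨z, ⟨hz, hl'⟩, rfl⟩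
  exact ⟨z, ⟨y, hy, hz⟩, by omega, rfl⟩

@[fun_prop]
theorem FP.comp {f g : List Bool → List Bool} (hf : FP f) (hg : FP g) : FP fun x => f (g x) :=
  (Comp.bind hg hf).mono fun x z ⟨y, hy, hz⟩ => by rw [hz, hy]

/-! #### Programs with two auxiliary stacks -/

namespace Reg

variable {K : Type}

/-- The first auxiliary stack. -/
abbrev s₀ : Reg (K ⊕ Bool) := tmp (Sum.inr true)

/-- The second auxiliary stack. -/
abbrev s₁ : Reg (K ⊕ Bool) := tmp (Sum.inr false)

/-- Contents of the input/output stack and of two auxiliary stacks. -/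
def lay (x a b : List Bool) : Reg (K ⊕ Bool) → List Bool :=
  st x (Sum.elim (fun _ => []) fun i => cond i a b)

@[simp] theorem lay_io (x a b : List Bool) : (lay x a b : Reg (K ⊕ Bool) → _) io = x := rfl
@[simp] theorem lay_s₀ (x a b : List Bool) : (lay x a b : Reg (K ⊕ Bool) → _) s₀ = a := rfl
@[simp] theorem lay_s₁ (x a b : List Bool) : (lay x a b : Reg (K ⊕ Bool) → _) s₁ = b := rfl

theorem lay_nil (x : List Bool) : (lay x [] [] : Reg (K ⊕ Bool) → _) = clean x := by
  ext1 (_ | _ | _ | _ | _ | _) <;> rfl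

variable [DecidableEq K] (x a b y : List Bool)

@[simp] theorem update_lay_io :
    Function.update (lay x a b : Reg (K ⊕ Bool) → _) io y = lay y a b := by
  simp [lay]

@[simp] theorem update_lay_s₀ :
    Function.update (lay x a b : Reg (K ⊕ Bool) → _) s₀ y = lay x y b := by
  simp only [lay, update_st_tmp]
  congr 1
  ext1 (k | _ | _) <;> simp

@[simp] theorem update_lay_s₁ :
    Function.update (lay x a b : Reg (K ⊕ Bool) → _) s₁ y = lay x a y := by
  simp only [lay, update_st_tmp]
  congr 1
  ext1 (k | _ | _) <;> simp

end Reg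

section

open Reg

variable {K K' : Type} [DecidableEq K] [DecidableEq K'] {A : Oracle} {x a b : List Bool}

theorem Cmd.Ev.move_io_s₀ : Ev A query answer (.move io s₀) (lay x a b : Reg (K ⊕ Bool) → _)
    (2 * x.length + 1) (· = lay [] (x.reverse ++ a) b) := by
  simpa using Ev.move (A := A) (qk := query) (ak := answer) (k := io) (k' := s₀) (by simp)
    (lay x a b : Reg (K ⊕ Bool) → _)

theorem Cmd.Ev.move_io_s₁ : Ev A query answer (.move io s₁) (lay x a b : Reg (K ⊕ Bool) → _)
    (2 * x.length + 1) (· = lay [] a (x.reverse ++ b)) := by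
  simpa using Ev.move (A := A) (qk := query) (ak := answer) (k := io) (k' := s₁) (by simp)
    (lay x a b : Reg (K ⊕ Bool) → _)

theorem Cmd.Ev.move_s₀_io : Ev A query answer (.move s₀ io) (lay x a b : Reg (K ⊕ Bool) → _)
    (2 * a.length + 1) (· = lay (a.reverse ++ x) [] b) := by
  simpa using Ev.move (A := A) (qk := query) (ak := answer) (k := s₀) (k' := io) (by simp)
    (lay x a b : Reg (K ⊕ Bool) → _)

theorem Cmd.Ev.move_s₁_io : Ev A query answer (.move s₁ io) (lay x a b : Reg (K ⊕ Bool) → _)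
    (2 * b.length + 1) (· = lay (b.reverse ++ x) a []) := by
  simpa using Ev.move (A := A) (qk := query) (ak := answer) (k := s₁) (k' := io) (by simp)
    (lay x a b : Reg (K ⊕ Bool) → _)

theorem Cmd.Ev.move_s₀_s₁ : Ev A query answer (.move s₀ s₁) (lay x a b : Reg (K ⊕ Bool) → _)
    (2 * a.length + 1) (· = lay x [] (a.reverse ++ b)) := by
  simpa using Ev.move (A := A) (qk := query) (ak := answer) (k := s₀) (k' := s₁) (by simp)
    (lay x a b : Reg (K ⊕ Bool) → _)

theorem Cmd.Ev.clear_io : Ev A query answer (.clear io) (lay x a b : Reg (K ⊕ Bool) → _)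
    (2 * x.length + 1) (· = lay [] a b) := by
  simpa using Ev.clear (A := A) (qk := query) (ak := answer) io (lay x a b : Reg (K ⊕ Bool) → _)

theorem Cmd.Ev.push_io {c : Bool} : Ev A query answer (.push io c)
    (lay x a b : Reg (K ⊕ Bool) → _) 1 (· = lay (c :: x) a b) :=
  .push (by simp)

theorem Cmd.Ev.push_s₀ {c : Bool} : Ev A query answer (.push s₀ c)
    (lay x a b : Reg (K ⊕ Bool) → _) 1 (· = lay x (c :: a) b) :=
  .push (by simp)

theorem Cmd.Ev.push_s₁ {c : Bool} : Ev A query answer (.push s₁ c)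
    (lay x a b : Reg (K ⊕ Bool) → _) 1 (· = lay x a (c :: b)) :=
  .push (by simp)

/-- Run a program on the input/output stack, keeping two stacks. -/
theorem Cmd.Ev.embed_lay {c : Cmd (Reg K)} {x : List Bool} {t : ℕ} {F : List Bool → Prop}
    (h : Ev A query answer c (clean x) t fun S => ∃ y, F y ∧ S = clean y)
    {e : K → K'} (he : Function.Injective e) :
    Ev A query answer (c.map (Reg.map (Sum.inl ∘ e))) (lay x a b : Reg (K' ⊕ Bool) → _) t
      fun S => ∃ y, F y ∧ S = lay y a b :=
  Ev.embed h (Sum.inl_injective.comp he) fun _ => rfl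

theorem Comp.of_linear {F : List Bool → List Bool → Prop} (c : Cmd (Reg (Empty ⊕ Bool))) (m : ℕ)
    (h : ∀ x, Ev A query answer c (lay x [] []) (m * x.length + m)
      fun S => ∃ y, F x y ∧ y.length ≤ m * x.length + m ∧ S = lay y [] []) : Comp A F := by
  refine ⟨_, inferInstance, inferInstance, c, Polynomial.C m * Polynomial.X + Polynomial.C m,
    fun x => ?_⟩
  simpa [lay_nil] using h x

theorem FP.of_linear {f : List Bool → List Bool} (c : Cmd (Reg (Empty ⊕ Bool))) (m : ℕ)
    (hf : ∀ x, (f x).length ≤ m * x.length + m)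
    (h : ∀ x, Ev (fun _ _ => False) query answer c (lay x [] []) (m * x.length + m)
      (· = lay (f x) [] [])) : FP f :=
  Comp.of_linear c m fun x => (h x).mono_right fun _ hS => ⟨_, rfl, hf x, hS⟩

end

end Cplx

namespace Cplx
open Cmd

/-! #### Pairs -/

/-- The first component of the code of a pair. -/
def pairFst : List Bool → List Bool
  | true :: b :: l => b :: pairFst l
  | _ => []

/-- The second component of the code of a pair. -/
def pairSnd : List Bool → List Bool
  | true :: _ :: l => pairSnd l
  | false :: l => l
  | _ => []

@[simp] theorem pair_nil (w : List Bool) : pair [] w = false :: w := rfl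

@[simp] theorem pair_cons (b : Bool) (x w : List Bool) :
    pair (b :: x) w = true :: b :: pair x w := rfl

@[simp] theorem pairFst_pair (x w : List Bool) : pairFst (pair x w) = x := by
  induction x with
  | nil => simp [pairFst]
  | cons b x ih => simp [pairFst, ih]

@[simp] theorem pairSnd_pair (x w : List Bool) : pairSnd (pair x w) = w := by
  induction x with
  | nil => simp [pairSnd]
  | cons b x ih => simp [pairSnd, ih]

@[simp] theorem length_pair (x w : List Bool) : (pair x w).length = 2 * x.length + w.length + 1 := by
  induction x with
  | nil => simp
  | cons b x ih => simp [ih]; ring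

/-- The bound holds for strings that code no pair as well, and it matches `length_pair` up to one
bit: taking a state apart and rebuilding it does not make it grow multiplicatively. -/
theorem two_mul_length_pairFst_add_length_pairSnd_le (x : List Bool) :
    2 * (pairFst x).length + (pairSnd x).length ≤ x.length := by
  fun_induction pairFst x with
  | case1 b l ih => simp [pairSnd]; omega
  | case2 l h =>
    match l with
    | [] => simp [pairSnd]
    | [true] => simp [pairSnd]
    | false :: l => simp [pairSnd]
    | true :: b :: l => exact (h _ _ rfl).elim

theorem length_pairFst_le (x : List Bool) : (pairFst x).length ≤ x.length := by
  have := two_mul_length_pairFst_add_length_pairSnd_le x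
  omega

theorem length_pairSnd_le (x : List Bool) : (pairSnd x).length ≤ x.length := by
  have := two_mul_length_pairFst_add_length_pairSnd_le x
  omega

/-- `n`-fold composition of a relation with itself. -/
def Iter (F : List Bool → List Bool → Prop) : ℕ → List Bool → List Bool → Prop
  | 0, a, b => b = a
  | n + 1, a, b => ∃ c, Iter F n a c ∧ F c b

section

open Reg

variable {K : Type} [DecidableEq K] {A : Oracle}

/-- Split a pair: leave its second component, and move the first one (reversed) to `s₀`. -/
def Cmd.split : Cmd (Reg (K ⊕ Bool)) :=
  -- The loop pops the tag `1` and its body the data bit; the separator `0` ends the loop.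
  .loop io (.pop io .skip (.push s₀ true) (.push s₀ false))

theorem Cmd.Ev.split (x : List Bool) :
    Ev A query answer .split (lay x [] [] : Reg (K ⊕ Bool) → _) (3 * x.length + 1)
      (· = lay (pairSnd x) (pairFst x).reverse []) := by
  refine (Ev.of_loop (t := 2) (I := fun l S => ∃ acc, S = lay l acc [] ∧
    acc.reverse ++ pairFst l = pairFst x ∧ pairSnd l = pairSnd x) ?_ ?_ ?_ ?_
    x.length x le_rfl _ ⟨[], by simp⟩).mono_left (by omega)
  · rintro l S ⟨acc, rfl, -, -⟩
    simp
  · rintro r S ⟨acc, rfl, h1, h2⟩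
    rw [update_lay_io]
    match r with
    | [] => exact .pop_nil (by simp) (.skip ⟨[], by simp, acc, rfl, h1, h2⟩)
    | false :: r =>
      refine .pop_false (r := r) (by simp) (.push ⟨r, by simp, false :: acc, by simp, ?_, h2⟩)
      simpa [pairFst] using h1
    | true :: r =>
      refine .pop_true (r := r) (by simp) (.push ⟨r, by simp, true :: acc, by simp, ?_, h2⟩)
      simpa [pairFst] using h1
  · rintro S ⟨acc, rfl, h1, h2⟩
    simp [← h1, ← h2, pairFst, pairSnd]
  · rintro r S ⟨acc, rfl, h1, h2⟩
    simp [← h1, ← h2, pairFst, pairSnd]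

theorem Cmd.Ev.clear_s₀ {x a b : List Bool} : Ev A query answer (.clear s₀)
    (lay x a b : Reg (K ⊕ Bool) → _) (2 * a.length + 1) (· = lay x [] b) := by
  simpa using Ev.clear (A := A) (qk := query) (ak := answer) s₀ (lay x a b : Reg (K ⊕ Bool) → _)

theorem FP.pairFst' : FP pairFst := by
  refine FP.of_linear (.split ;; .clear io ;; .move s₀ io) 7
    (fun x => (length_pairFst_le x).trans (by omega)) fun x => ?_
  have h1 := length_pairFst_le x
  have h2 := length_pairSnd_le x
  refine ((Ev.split x).seq_eq (Ev.clear_io.seq_eq Ev.move_s₀_io)).mono ?_ ?_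
  · simp; omega
  · rintro S rfl
    simp

theorem FP.pairSnd' : FP pairSnd := by
  refine FP.of_linear (.split ;; .clear s₀) 5
    (fun x => (length_pairSnd_le x).trans (by omega)) fun x => ?_
  have h1 := length_pairFst_le x
  refine ((Ev.split x).seq_eq Ev.clear_s₀).mono_left ?_
  simp; omega

theorem FP.append_pair : FP fun x => pairFst x ++ pairSnd x := by
  have h (x : List Bool) := two_mul_length_pairFst_add_length_pairSnd_le x
  refine FP.of_linear (.split ;; .move s₀ io) 5 (fun x => ?_) fun x => ?_
  · have := h x
    simp; omega
  · have := h x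
    refine ((Ev.split x).seq_eq Ev.move_s₀_io).mono ?_ ?_
    · simp; omega
    · rintro S rfl
      simp

theorem FP.reverse' : FP List.reverse := by
  refine FP.of_linear (.move io s₀ ;; .move s₀ s₁ ;; .move s₁ io) 6
    (fun x => by simp; omega) fun x => ?_
  refine (Ev.move_io_s₀.seq_eq (Ev.move_s₀_s₁.seq_eq Ev.move_s₁_io)).mono ?_ ?_
  · simp; omega
  · rintro S rfl
    simp

theorem FP.nil : FP fun _ => [] := by
  refine FP.of_linear (.clear io) 2 (fun x => by simp) fun x => ?_
  exact (Ev.clear_io (x := x)).mono_left (by omega)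

@[fun_prop]
theorem FP.id : FP fun x => x := by
  refine FP.of_linear .skip 1 (fun x => by simp) fun x => ?_
  exact (Ev.skip (Q := (· = lay x [] [])) rfl).mono_left (by omega)

theorem FP.cons' (b : Bool) : FP (List.cons b) := by
  refine FP.of_linear (.push io b) 2 (fun x => by simp; omega) fun x => ?_
  exact (Ev.push_io (x := x)).mono_left (by omega)

theorem FP.tail' : FP List.tail := by
  refine FP.of_linear (.pop io .skip .skip .skip) 2 (fun x => by simp; omega) fun x => ?_
  match x with
  | [] => exact (Ev.pop_nil (t := 1) (by simp) (.skip (by simp))).mono_left (by simp)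
  | true :: r =>
    exact (Ev.pop_true (r := r) (t := 1) (by simp) (.skip (by simp))).mono_left (by simp)
  | false :: r =>
    exact (Ev.pop_false (r := r) (t := 1) (by simp) (.skip (by simp))).mono_left (by simp)

theorem FP.isEmpty' : FP fun x => [x.isEmpty] := by
  refine FP.of_linear (.pop io (.push io true) (.clear io ;; .push io false)
    (.clear io ;; .push io false)) 6 (fun x => by simp) fun x => ?_
  match x with
  | [] => exact (Ev.pop_nil (t := 1) (by simp) (.push (by simp))).mono_left (by simp)
  | true :: r =>
    refine (Ev.pop_true (r := r) (t := (2 * r.length + 1) + 1) (by simp) ?_).mono_left (by simp; omega)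
    rw [update_lay_io]
    exact Ev.clear_io.seq_eq Ev.push_io
  | false :: r =>
    refine (Ev.pop_false (r := r) (t := (2 * r.length + 1) + 1) (by simp) ?_).mono_left (by simp; omega)
    rw [update_lay_io]
    exact Ev.clear_io.seq_eq Ev.push_io

/-! ### Unary prefixes -/

/-- The leading ones of a string. -/
def ones : List Bool → List Bool
  | true :: l => true :: ones l
  | _ => []

/-- What follows the first zero of a string. -/
def dropOnes : List Bool → List Bool
  | true :: l => dropOnes l
  | false :: l => l
  | [] => []

theorem length_ones_add_length_dropOnes_le (x : List Bool) :
    (ones x).length + (dropOnes x).length ≤ x.length := by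
  induction x with
  | nil => simp [ones, dropOnes]
  | cons b x ih => cases b <;> simp [ones, dropOnes]; omega

theorem ones_eq_replicate (x : List Bool) : ones x = List.replicate (ones x).length true := by
  induction x with
  | nil => simp [ones]
  | cons b x ih =>
    cases b
    · simp [ones]
    · simpa [ones, List.replicate_succ] using ih

theorem Cmd.Ev.loop_ones (x : List Bool) : Ev A query answer (.loop io (.push s₀ true))
    (lay x [] [] : Reg (K ⊕ Bool) → _) (2 * x.length + 1) (· = lay (dropOnes x) (ones x) []) := by
  have rep (n : ℕ) (l : List Bool) :
      List.replicate n true ++ true :: l = List.replicate (n + 1) true ++ l := by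
    rw [List.replicate_succ', List.append_assoc, List.singleton_append]
  refine (Ev.of_loop (t := 1) (I := fun l S => ∃ n, S = lay l (List.replicate n true) [] ∧
    List.replicate n true ++ ones l = ones x ∧ dropOnes l = dropOnes x) ?_ ?_ ?_ ?_
    x.length x le_rfl _ ⟨0, by simp⟩).mono_left (by omega)
  · rintro l S ⟨acc, rfl, -, -⟩
    simp
  · rintro r S ⟨n, rfl, h1, h2⟩
    rw [update_lay_io]
    refine .push ⟨r, le_rfl, n + 1, by simp [List.replicate_succ], ?_, h2⟩
    rw [← rep]
    exact h1
  · rintro S ⟨n, rfl, h1, h2⟩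
    simp [← h1, ← h2, ones, dropOnes]
  · rintro r S ⟨n, rfl, h1, h2⟩
    simp [← h1, ← h2, ones, dropOnes]

theorem FP.ones' : FP ones := by
  have h (x : List Bool) := length_ones_add_length_dropOnes_le x
  refine FP.of_linear (.loop io (.push s₀ true) ;; .clear io ;; .move s₀ io) 6
    (fun x => by have := h x; omega) fun x => ?_
  have := h x
  refine ((Ev.loop_ones x).seq_eq (Ev.clear_io.seq_eq Ev.move_s₀_io)).mono ?_ ?_
  · omega
  · rintro S rfl
    -- The move reverses the stack, which has no effect on a string of ones.
    rw [ones_eq_replicate]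
    simp

theorem FP.dropOnes' : FP dropOnes := by
  have h (x : List Bool) := length_ones_add_length_dropOnes_le x
  refine FP.of_linear (.loop io (.push s₀ true) ;; .clear s₀) 4
    (fun x => by have := h x; omega) fun x => ?_
  have := h x
  refine ((Ev.loop_ones x).seq_eq Ev.clear_s₀).mono_left ?_
  omega

end

/-! ### Branching, pairing, iteration and oracle queries -/

open Reg in
-- The empty string takes the branch of `g`, in accordance with the default `false` for the head.
theorem FP.branch {f g : List Bool → List Bool} (hf : FP f) (hg : FP g) :
    FP fun x => if x.headD false then f x.tail else g x.tail := by
  obtain ⟨K, _, _, c, p, hc⟩ := hf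
  obtain ⟨K', _, _, c', p', hc'⟩ := hg
  simp only [← and_assoc] at hc hc'
  refine ⟨K ⊕ K', inferInstance, inferInstance, .pop io (c'.map (Reg.map Sum.inr))
    (c.map (Reg.map Sum.inl)) (c'.map (Reg.map Sum.inr)), p + p' + 1, fun x => ?_⟩
  simp only [Polynomial.eval_add, Polynomial.eval_one]
  match x with
  | [] =>
    refine ((Ev.pop_nil (by simp) ((hc' []).embed Sum.inr_injective fun _ => rfl))).mono
      (by simp) ?_
    rintro S ⟨y, ⟨rfl, hl⟩, rfl⟩
    exact ⟨_, rfl, by simp at hl ⊢; omega, rfl⟩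
  | true :: r =>
    refine Ev.mono (Ev.pop_true (r := r) (by simp [clean]) (Q := fun S => ∃ y,
      (y = f r ∧ y.length ≤ p.eval r.length) ∧ S = clean y) (t := p.eval r.length) ?_) ?_ ?_
    · rw [clean, update_st_io]
      exact (hc r).embed Sum.inl_injective fun _ => rfl
    · have := eval_mono p (Nat.le_succ r.length)
      simp at this ⊢; omega
    · rintro S ⟨y, ⟨rfl, hl⟩, rfl⟩
      have := eval_mono p (Nat.le_succ r.length)
      refine ⟨_, rfl, by simp at this ⊢; omega, rfl⟩
  | false :: r =>
    refine Ev.mono (Ev.pop_false (r := r) (by simp [clean]) (Q := fun S => ∃ y,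
      (y = g r ∧ y.length ≤ p'.eval r.length) ∧ S = clean y) (t := p'.eval r.length) ?_) ?_ ?_
    · rw [clean, update_st_io]
      exact (hc' r).embed Sum.inr_injective fun _ => rfl
    · have := eval_mono p' (Nat.le_succ r.length)
      simp at this ⊢; omega
    · rintro S ⟨y, ⟨rfl, hl⟩, rfl⟩
      have := eval_mono p' (Nat.le_succ r.length)
      refine ⟨_, rfl, by simp at this ⊢; omega, rfl⟩

open Reg in
theorem Comp.pair {A : Oracle} {F G : List Bool → List Bool → Prop} (hF : Comp A F)
    (hG : Comp A G) : Comp A fun x z => ∃ a b, F x a ∧ G x b ∧ z = pair a b := by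
  obtain ⟨K, _, _, c, p, hc⟩ := hF
  obtain ⟨K', _, _, c', p', hc'⟩ := hG
  simp only [← and_assoc] at hc hc'
  -- The input is duplicated because each program consumes its own copy. The first result waits in
  -- reverse on `s₁`; at the end its bits, each with a tag `1` in front, are pushed before the
  -- separator and the second result.
  refine ⟨(K ⊕ K') ⊕ Bool, inferInstance, inferInstance,
    .each io (.push s₀ true ;; .push s₁ true) (.push s₀ false ;; .push s₁ false) ;;
    .move s₁ io ;; c.map (Reg.map (Sum.inl ∘ Sum.inl)) ;; .move io s₁ ;; .move s₀ io ;;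
    c'.map (Reg.map (Sum.inl ∘ Sum.inr)) ;; .push io false ;;
    .each s₁ (.push io true ;; .push io true) (.push io false ;; .push io true),
    7 * Polynomial.X + 6 * p + 2 * p' + 6, fun x => ?_⟩
  simp only [Polynomial.eval_add, Polynomial.eval_mul, Polynomial.eval_X, Polynomial.eval_ofNat,
    ← lay_nil]
  have h1 : Ev A query answer
      (.each io (.push s₀ true ;; .push s₁ true) (.push s₀ false ;; .push s₁ false))
      (lay x [] [] : Reg ((K ⊕ K') ⊕ Bool) → _) (x.length * (2 + 1) + 1)
      (· = lay [] x.reverse x.reverse) := by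
    refine (Ev.of_each (t := 2) (I := fun l S => ∃ m, x = m ++ l ∧
      S = lay l m.reverse m.reverse) ?_ ?_ ?_ _ _ ⟨[], by simp⟩).mono_right ?_
    · rintro l S ⟨m, -, rfl⟩
      simp
    · rintro l S ⟨m, hm, rfl⟩
      rw [update_lay_io]
      refine (Ev.push_s₀.seq_eq Ev.push_s₁).mono_right ?_
      rintro S rfl
      exact ⟨m ++ [true], by simp [hm], by simp⟩
    · rintro l S ⟨m, hm, rfl⟩
      rw [update_lay_io]
      refine (Ev.push_s₀.seq_eq Ev.push_s₁).mono_right ?_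
      rintro S rfl
      exact ⟨m ++ [false], by simp [hm], by simp⟩
    · rintro S ⟨m, hm, rfl⟩
      simp [hm]
  have h2 (a b : List Bool) : Ev A query answer
      (.each s₁ (.push io true ;; .push io true) (.push io false ;; .push io true))
      (lay (false :: b) [] a.reverse : Reg ((K ⊕ K') ⊕ Bool) → _) (a.reverse.length * (2 + 1) + 1)
      (· = lay (Cplx.pair a b) [] []) := by
    refine (Ev.of_each (t := 2) (I := fun l S => ∃ m, a = l.reverse ++ m ∧
      S = lay (Cplx.pair m b) [] l) ?_ ?_ ?_ _ _ ⟨[], by simp⟩).mono_right ?_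
    · rintro l S ⟨m, -, rfl⟩
      simp
    · rintro l S ⟨m, hm, rfl⟩
      rw [update_lay_s₁]
      refine (Ev.push_io.seq_eq Ev.push_io).mono_right ?_
      rintro S rfl
      exact ⟨true :: m, by simp [hm], by simp⟩
    · rintro l S ⟨m, hm, rfl⟩
      rw [update_lay_s₁]
      refine (Ev.push_io.seq_eq Ev.push_io).mono_right ?_
      rintro S rfl
      exact ⟨false :: m, by simp [hm], by simp⟩
    · rintro S ⟨m, hm, rfl⟩
      simp [hm]
  have h3 (a : List Bool) (ha : a.length ≤ p.eval x.length) :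
      Ev A query answer (.move io s₁ ;; .move s₀ io ;;
        c'.map (Reg.map (Sum.inl ∘ Sum.inr)) ;; .push io false ;;
        .each s₁ (.push io true ;; .push io true) (.push io false ;; .push io true))
      (lay a x.reverse [] : Reg ((K ⊕ K') ⊕ Bool) → _)
      (2 * x.length + 5 * p.eval x.length + p'.eval x.length + 4)
      fun S => ∃ b, (G x b ∧ b.length ≤ p'.eval x.length) ∧ S = lay (Cplx.pair a b) [] [] := by
    refine (Ev.move_io_s₁.seq_eq (Ev.move_s₀_io.seq_eq (t' := p'.eval x.length +
      (1 + (a.length * 3 + 1))) ?_)).mono_left ?_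
    · simp only [List.reverse_reverse, List.append_nil]
      refine .seq ((hc' x).embed_lay Sum.inr_injective) ?_
      rintro S ⟨b, hb, rfl⟩
      refine Ev.push_io.seq_eq (((h2 a b).mono_left (by simp)).mono_right ?_)
      rintro S rfl
      exact ⟨b, hb, rfl⟩
    · simp; omega
  refine (h1.seq_eq (Ev.move_s₁_io.seq_eq (t' := p.eval x.length +
    (2 * x.length + 5 * p.eval x.length + p'.eval x.length + 4))
    (Q := fun S => ∃ a b, (F x a ∧ a.length ≤ p.eval x.length) ∧
      (G x b ∧ b.length ≤ p'.eval x.length) ∧ S = lay (Cplx.pair a b) [] []) ?_)).mono ?_ ?_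
  · simp only [List.reverse_reverse, List.append_nil]
    refine .seq ((hc x).embed_lay Sum.inl_injective) ?_
    rintro S ⟨a, ha, rfl⟩
    exact (h3 a ha.2).mono_right fun S ⟨b, hb, hS⟩ => ⟨a, b, ha, hb, hS⟩
  · simp; omega
  · rintro S ⟨a, b, ⟨ha, hal⟩, ⟨hb, hbl⟩, rfl⟩
    exact ⟨_, ⟨a, b, ha, hb, rfl⟩, by simp; omega, rfl⟩

-- The number of rounds is given in unary and waits on `s₀`. A polynomial bound for a single round
-- does not survive iteration, so a bound `B` for all reachable states is required; as `F` is a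
-- relation, it has to cover every run.
open Reg in
theorem Comp.iter {A : Oracle} {F : List Bool → List Bool → Prop} (hF : Comp A F)
    (hB : ∃ B : Polynomial ℕ, ∀ x s i, i ≤ (pairFst x).length → Iter F i (pairSnd x) s →
      s.length ≤ B.eval x.length) :
    Comp A fun x y => Iter F (pairFst x).length (pairSnd x) y := by
  obtain ⟨K, _, _, c, p, hc⟩ := hF
  obtain ⟨B, hB⟩ := hB
  simp only [← and_assoc] at hc
  refine ⟨K ⊕ Bool, inferInstance, inferInstance, .split ;;
    .each s₀ (c.map (Reg.map (Sum.inl ∘ id))) (c.map (Reg.map (Sum.inl ∘ id))),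
    3 * Polynomial.X + Polynomial.X * (p.comp B + 1) + B + 2, fun x => ?_⟩
  simp only [Polynomial.eval_add, Polynomial.eval_mul, Polynomial.eval_X, Polynomial.eval_ofNat,
    Polynomial.eval_comp, Polynomial.eval_one, ← lay_nil]
  have key : Ev A query answer
      (.each s₀ (c.map (Reg.map (Sum.inl ∘ id))) (c.map (Reg.map (Sum.inl ∘ id))))
      (lay (pairSnd x) (pairFst x).reverse [] : Reg (K ⊕ Bool) → _)
      ((pairFst x).reverse.length * (p.eval (B.eval x.length) + 1) + 1)
      fun S => ∃ y, Iter F (pairFst x).length (pairSnd x) y ∧ S = lay y [] [] := by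
    have step (b : Bool) (l : List Bool) (i : ℕ) (s : List Bool)
        (hi : i + (b :: l).length = (pairFst x).length) (hs : Iter F i (pairSnd x) s) :
        Ev A query answer (c.map (Reg.map (Sum.inl ∘ id))) (lay s l [] : Reg (K ⊕ Bool) → _)
        (p.eval (B.eval x.length)) fun S => ∃ i s, i + l.length = (pairFst x).length ∧
          Iter F i (pairSnd x) s ∧ S = lay s l [] := by
      refine ((hc s).embed_lay Function.injective_id).mono
        (eval_mono p (hB x s i (by omega) hs)) ?_
      rintro S ⟨y, ⟨hy, -⟩, rfl⟩
      exact ⟨i + 1, y, by simp at hi; omega, ⟨s, hs, hy⟩, rfl⟩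
    refine (Ev.of_each (I := fun l S => ∃ i s, i + l.length = (pairFst x).length ∧
      Iter F i (pairSnd x) s ∧ S = lay s l []) ?_ ?_ ?_ _ _
      ⟨0, pairSnd x, by simp, rfl, rfl⟩).mono_right ?_
    · rintro l S ⟨i, s, -, -, rfl⟩
      simp
    · rintro l S ⟨i, s, hi, hs, rfl⟩
      rw [update_lay_s₀]
      exact step true l i s hi hs
    · rintro l S ⟨i, s, hi, hs, rfl⟩
      rw [update_lay_s₀]
      exact step false l i s hi hs
    · rintro S ⟨i, s, hi, hs, rfl⟩
      obtain rfl : i = (pairFst x).length := by simpa using hi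
      exact ⟨s, hs, rfl⟩
  refine ((Ev.split x).seq_eq key).mono ?_ ?_
  · have := Nat.mul_le_mul_right (p.eval (B.eval x.length) + 1) (length_pairFst_le x)
    simp; omega
  · rintro S ⟨y, hy, rfl⟩
    have := hB x y _ le_rfl hy
    exact ⟨y, hy, by omega, rfl⟩

open Reg in
/-- An oracle query is a computation with the oracle. -/
theorem Comp.ask {A : Oracle} (hex : ∀ q, ∃ a, A q a) (hlen : ∀ q a, A q a → a.length = 1) :
    Comp A A := by
  refine ⟨Unit, inferInstance, inferInstance,
    .move io (tmp ()) ;; .move (tmp ()) query ;; .call ;;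
    .pop answer .skip (.push io true) (.push io false), 4 * Polynomial.X + 6, fun x => ?_⟩
  simp only [Polynomial.eval_add, Polynomial.eval_mul, Polynomial.eval_X, Polynomial.eval_ofNat]
  have hS : Function.update (Function.update (clean x : Reg Unit → _) io []) (tmp ())
      ((clean x (io : Reg Unit)).reverse ++ clean x (tmp ())) = st [] fun _ => x.reverse := by
    ext1 (_ | _ | _ | _) <;> simp [clean, st]
  have hT : Function.update (Function.update (st [] fun _ => x.reverse : Reg Unit → _) (tmp ()) [])
      query (x.reverse.reverse ++ []) = Function.update (clean []) query x := by
    ext1 (_ | _ | _ | _) <;> simp [clean, st]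
  refine ((Ev.move (k := io) (k' := tmp ()) (by simp) _).seq_eq (((Ev.move (k := tmp ())
    (k' := query) (by simp) _).mono_left (t' := 2 * x.length + 1) ?_).seq_eq
    (Ev.seq (t := 1) (t' := 2)
    (R := fun S => ∃ a, A x a ∧ S = Function.update (clean []) answer a) ?_ ?_))).mono_left ?_
  · simp [clean, st]
  · rw [hS, st_tmp]
    have : (st [] fun _ => x.reverse : Reg Unit → _) query = [] := rfl
    rw [this, hT]
    refine .call (by simpa using hex x) fun a ha => ⟨a, by simpa using ha, ?_⟩
    ext1 (_ | _ | _ | _) <;> simp [clean, st]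
  · rintro S ⟨a, ha, rfl⟩
    have hu (b : Bool) : Function.update (Function.update (Function.update (clean []) answer [b])
        answer []) io [b] = (clean [b] : Reg Unit → _) := by
      ext1 (_ | _ | _ | _) <;> simp [clean, st]
    match a, hlen x a ha with
    | [true], _ =>
      refine .pop_true (r := []) (t := 1) (by simp) (.push ⟨_, ha, by simp, ?_⟩)
      simpa [clean, st] using hu true
    | [false], _ =>
      refine .pop_false (r := []) (t := 1) (by simp) (.push ⟨_, ha, by simp, ?_⟩)
      simpa [clean, st] using hu false
  · simp [clean]; omega

end Cplx

namespace Cplx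
open Cmd

/-! ### Simulation of oracle machines by programs -/

namespace Simulation

open Reg Turing.TM2

variable (M : OracleMachine) {KH : Type}

/-- The stacks of the simulation of a machine: those of the machine, those of a program that
answers its queries, one for the label and the internal state, and one for moving data. -/
abbrev SimReg (KH : Type) := Reg (M.K ⊕ (KH ⊕ Bool))

variable {M}

/-- The stack of the simulation that stands for the stack `k` of the machine. -/
abbrev stack (k : M.K) : (SimReg M KH) := tmp (.inl k)

/-- The stack of the simulation that holds label and internal state. -/
abbrev pc : (SimReg M KH) := tmp (.inr (.inr true))

/-- The stack of the simulation for moving data. -/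
abbrev buf : (SimReg M KH) := tmp (.inr (.inr false))

/-- Contents of the stacks of the simulation. -/
def sim (x : List Bool) (S : M.K → List Bool) (p z : List Bool) : SimReg M KH → List Bool :=
  st x (Sum.elim S (Sum.elim (fun _ => []) fun i => cond i p z))

section sim

variable (x : List Bool) (S : M.K → List Bool) (p z y : List Bool) (k : M.K)

@[simp] theorem sim_io : (sim x S p z : SimReg M KH → _) io = x := rfl
@[simp] theorem sim_stack : (sim x S p z : SimReg M KH → _) (stack k) = S k := rfl
@[simp] theorem sim_pc : (sim x S p z : SimReg M KH → _) pc = p := rfl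
@[simp] theorem sim_buf : (sim x S p z : SimReg M KH → _) buf = z := rfl

theorem sim_nil : (sim x (fun _ => []) [] [] : SimReg M KH → _) = clean x := by
  ext1 (_ | _ | _ | _ | _ | _ | _) <;> rfl

variable [DecidableEq KH]

@[simp] theorem update_sim_io :
    Function.update (sim x S p z : SimReg M KH → _) io y = sim y S p z := by
  simp only [sim, update_st_io]

@[simp] theorem update_sim_stack : Function.update (sim x S p z : SimReg M KH → _) (stack k) y =
    sim x (Function.update S k y) p z := by
  simp only [sim, update_st_tmp, Sum.update_elim_inl]

@[simp] theorem update_sim_pc :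
    Function.update (sim x S p z : SimReg M KH → _) pc y = sim x S y z := by
  simp only [sim, update_st_tmp]
  congr 1
  ext1 (k | k | _ | _) <;> simp

@[simp] theorem update_sim_buf :
    Function.update (sim x S p z : SimReg M KH → _) buf y = sim x S p y := by
  simp only [sim, update_st_tmp]
  congr 1
  ext1 (k | k | _ | _) <;> simp

end sim

/-- Number of a label and an internal state. -/
noncomputable def stateCode (l : M.Lab) (v : M.St) : ℕ :=
  Fintype.equivFin (M.Lab × M.St) (l, v)

/-- The number of pairs of a label and an internal state. -/
noncomputable def numStates (M : OracleMachine) : ℕ := Fintype.card (M.Lab × M.St)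

theorem stateCode_lt (l : M.Lab) (v : M.St) : stateCode l v < numStates M :=
  (Fintype.equivFin (M.Lab × M.St) (l, v)).2

/-- Unary code of the label and internal state of a configuration; a halted machine has code
`[]`. -/
noncomputable def pcCode (l : Option M.Lab) (v : M.St) : List Bool :=
  l.elim [] fun l => List.replicate (stateCode l v + 1) true

/-- Set the label and the internal state. -/
noncomputable def setPc (n : ℕ) : Cmd ((SimReg M KH)) :=
  n.rec .skip fun _ c => .push pc true ;; c

/-- The program for a statement of the machine in the internal state `v`. -/
noncomputable def tr : Stmt (fun _ : M.K => Bool) M.Lab M.St → M.St → Cmd ((SimReg M KH))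
  -- The internal state is a parameter of the translation, so values such as `f v` are constants of
  -- the program. This is possible because there are only finitely many states.
  | .push k f q, v => .push (stack k) (f v) ;; tr q v
  | .peek k f q, v => .pop (stack k) (tr q (f v none))
      (.push (stack k) true ;; tr q (f v (some true)))
      (.push (stack k) false ;; tr q (f v (some false)))
  | .pop k f q, v => .pop (stack k) (tr q (f v none)) (tr q (f v (some true)))
      (tr q (f v (some false)))
  | .load a q, v => tr q (a v)
  | .branch b q₁ q₂, v => cond (b v) (tr q₁ v) (tr q₂ v)
  | .goto l, v => setPc (stateCode (l v) v + 1)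
  | .halt, _ => .skip

/-- A bound for the number of steps of the program for a statement. -/
noncomputable def cost : Stmt (fun _ : M.K => Bool) M.Lab M.St → ℕ
  | .push _ _ q => cost q + 1
  | .peek _ _ q => cost q + 2
  | .pop _ _ q => cost q + 1
  | .load _ q => cost q
  | .branch _ q₁ q₂ => cost q₁ + cost q₂
  | .goto _ => numStates M + 1
  | .halt => 1

/-- `cost` counts every push, so it bounds the growth of a stack as well as the time. -/
theorem length_stepAux_le (s : Stmt (fun _ : M.K => Bool) M.Lab M.St) (v : M.St)
    (S : M.K → List Bool) (k : M.K) :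
    ((stepAux s v S).stk k).length ≤ (S k).length + cost s := by
  induction s generalizing v S with
  | push k' f q ih =>
    refine (ih _ _).trans ?_
    by_cases h : k = k'
    · subst h; simp [cost]; omega
    · simp [h, cost]
  | peek k' f q ih => exact (ih _ _).trans (by simp [cost])
  | pop k' f q ih =>
    refine (ih _ _).trans ?_
    by_cases h : k = k'
    · subst h; simp [cost]; omega
    · simp [h, cost]
  | load a q ih => exact ih _ _
  | branch b q₁ q₂ ih₁ ih₂ =>
    simp only [stepAux, cost]
    cases b v
    · exact (ih₂ _ _).trans (by omega)
    · exact (ih₁ _ _).trans (by omega)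
  | goto l => simp [stepAux]
  | halt => simp [stepAux]

variable [DecidableEq KH] {A : Oracle}

theorem ev_setPc (n : ℕ) (S : M.K → List Bool) (p : List Bool) :
    Ev A query answer (setPc n) (sim [] S p [] : SimReg M KH → _) (n + 1)
      (· = sim [] S (List.replicate n true ++ p) []) := by
  induction n generalizing p with
  | zero => exact .skip rfl
  | succ n ih =>
    have h : Ev A query answer (.push pc true) (sim [] S p [] : SimReg M KH → _) 1
        (· = sim [] S (true :: p) []) := .push (by simp)
    refine (h.seq_eq (ih (true :: p))).mono (by omega) ?_
    rintro T rfl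
    rw [List.replicate_succ', List.append_assoc, List.singleton_append]

theorem ev_tr (s : Stmt (fun _ : M.K => Bool) M.Lab M.St) (v : M.St) (S : M.K → List Bool) :
    Ev A query answer (tr s v) (sim [] S [] [] : SimReg M KH → _) (cost s)
      (· = sim [] (stepAux s v S).stk (pcCode (stepAux s v S).l (stepAux s v S).var) []) := by
  induction s generalizing v S with
  | push k f q ih =>
    have h : Ev A query answer (.push (stack k) (f v)) (sim [] S [] [] : SimReg M KH → _) 1
      (· = sim [] (Function.update S k (f v :: S k)) [] []) := .push (by simp)
    exact (h.seq_eq (ih v _)).mono_left (by simp [cost]; omega)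
  | peek k f q ih =>
    have h (b : Bool) (r : List Bool) (hk : S k = b :: r) : Ev A query answer (.push (stack k) b)
        (sim [] (Function.update S k r) [] [] : SimReg M KH → _) 1 (· = sim [] S [] []) :=
      .push (by simp [← hk])
    have hc : cost q + 2 = (1 + cost q) + 1 := by omega
    simp only [tr, cost, hc, stepAux]
    match hk : S k with
    | [] => exact .pop_nil (by simpa) ((ih _ _).mono_left (by omega))
    | true :: r =>
      refine .pop_true (r := r) (by simpa) ?_
      rw [update_sim_stack]
      exact (h _ _ hk).seq_eq (ih _ _)
    | false :: r =>
      refine .pop_false (r := r) (by simpa) ?_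
      rw [update_sim_stack]
      exact (h _ _ hk).seq_eq (ih _ _)
  | pop k f q ih =>
    simp only [tr, cost, stepAux]
    match hk : S k with
    | [] =>
      refine .pop_nil (by simpa) ?_
      have := ih (f v none) S
      simpa only [List.tail_nil, List.head?_nil, update_nil hk] using this
    | true :: r =>
      refine .pop_true (r := r) (by simpa) ?_
      rw [update_sim_stack]
      exact ih _ _
    | false :: r =>
      refine .pop_false (r := r) (by simpa) ?_
      rw [update_sim_stack]
      exact ih _ _
  | load a q ih => exact ih _ _
  | branch b q₁ q₂ ih₁ ih₂ =>
    simp only [tr, cost, stepAux]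
    cases b v
    · exact (ih₂ _ _).mono_left (by omega)
    · exact (ih₁ _ _).mono_left (by omega)
  | goto l =>
    have := stateCode_lt (l v) v
    refine (ev_setPc _ S []).mono (by simp only [cost]; omega) ?_
    rintro T rfl
    simp [stepAux, pcCode]
  | halt => exact .skip rfl

/-- Continue with the program that belongs to the number on the stack `pc`. -/
noncomputable def dispatch (n : ℕ) : (ℕ → Cmd ((SimReg M KH))) → Cmd ((SimReg M KH)) :=
  n.rec (fun _ => .skip) fun _ d f => .pop pc (f 0) (d fun i => f (i + 1)) .skip

theorem ev_dispatch {n i : ℕ} (hi : i < n) (f : ℕ → Cmd ((SimReg M KH))) {S : M.K → List Bool}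
    {t : ℕ} {Q : ((SimReg M KH) → List Bool) → Prop}
    (h : Ev A query answer (f i) (sim [] S [] []) t Q) :
    Ev A query answer (dispatch n f) (sim [] S (List.replicate i true) []) (t + i + 1) Q := by
  induction n generalizing i f with
  | zero => omega
  | succ n ih =>
    cases i with
    | zero => exact .pop_nil rfl h
    | succ i =>
      refine .pop_true (r := List.replicate i true) rfl ?_
      rw [update_sim_pc]
      exact ih (by omega) _ h

/-- Answer a query of the machine by the program `c`. -/
noncomputable def answerQuery (c : Cmd (Reg KH)) : Cmd ((SimReg M KH)) :=
  .move (stack M.query) buf ;; .move buf io ;; c.map (Reg.map (.inr ∘ .inl)) ;;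
  .clear (stack M.answer) ;; .move io buf ;; .move buf (stack M.answer)

/-- One step of the machine in the state with number `i`. -/
noncomputable def stepCmd (c : Cmd (Reg KH)) (i : ℕ) : Cmd ((SimReg M KH)) :=
  if h : i < numStates M then
    let (l, v) := (Fintype.equivFin (M.Lab × M.St)).symm ⟨i, h⟩
    match M.prog l with
    | .inl s => tr s v
    | .inr l' => answerQuery c ;; setPc (stateCode l' v + 1)
  else .skip

theorem stepCmd_stateCode {KH : Type} (c : Cmd (Reg KH)) (l : M.Lab) (v : M.St) :
    stepCmd c (stateCode l v) = match M.prog l with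
      | .inl s => tr s v
      | .inr l' => answerQuery c ;; setPc (stateCode l' v + 1) := by
  have h := stateCode_lt l v
  rw [stepCmd, dif_pos h]
  simp [stateCode]

variable {g : List Bool → List Bool} {c : Cmd (Reg KH)} {p : Polynomial ℕ}

theorem ev_answerQuery
    (hc : ∀ x, Ev A query answer c (clean x) (p.eval x.length) fun S => ∃ y, y = g x ∧ S = clean y)
    (S : M.K → List Bool) {B₁ B₂ : ℕ} (h₁ : (S M.query).length ≤ B₁)
    (h₂ : (S M.answer).length ≤ B₂) (h₃ : (g (S M.query)).length ≤ B₂) :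
    Ev A query answer (answerQuery c) (sim [] S [] [] : SimReg M KH → _)
      (4 * B₁ + p.eval B₁ + 6 * B₂ + 5)
      (· = sim [] (Function.update (Function.update S M.query []) M.answer (g (S M.query))) [] []) := by
  set q := S M.query with hq
  have e₁ : Ev A query answer (.move (stack M.query) buf) (sim [] S [] [] : SimReg M KH → _)
      (2 * B₁ + 1) (· = sim [] (Function.update S M.query []) [] q.reverse) := by
    refine (Ev.move (by simp) _).mono (by simp; omega) ?_
    rintro T rfl
    simp [hq]
  set S₁ := Function.update S M.query [] with hS₁
  have e₂ : Ev A query answer (.move buf io) (sim [] S₁ [] q.reverse : SimReg M KH → _)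
      (2 * B₁ + 1) (· = sim q S₁ [] []) := by
    refine (Ev.move (by simp) _).mono (by simp; omega) ?_
    rintro T rfl
    simp
  have e₃ : Ev A query answer (c.map (Reg.map (.inr ∘ .inl))) (sim q S₁ [] [] : SimReg M KH → _)
      (p.eval B₁) (· = sim (g q) S₁ [] []) := by
    refine ((hc q).embed (Sum.inr_injective.comp Sum.inl_injective) fun k => rfl).mono
      (eval_mono p h₁) ?_
    rintro T ⟨_, rfl, rfl⟩
    rfl
  have e₄ : Ev A query answer (.clear (stack M.answer)) (sim (g q) S₁ [] [] : SimReg M KH → _)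
      (2 * B₂ + 1) (· = sim (g q) (Function.update S₁ M.answer []) [] []) := by
    refine (Ev.clear _ _).mono ?_ ?_
    · simp [hS₁, Function.update_of_ne M.query_ne_answer.symm]; omega
    rintro T rfl
    simp
  set S₂ := Function.update S₁ M.answer [] with hS₂
  have e₅ : Ev A query answer (.move io buf) (sim (g q) S₂ [] [] : SimReg M KH → _)
      (2 * B₂ + 1) (· = sim [] S₂ [] (g q).reverse) := by
    refine (Ev.move (by simp) _).mono (by simp; omega) ?_
    rintro T rfl
    simp
  have e₆ : Ev A query answer (.move buf (stack M.answer))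
      (sim [] S₂ [] (g q).reverse : SimReg M KH → _)
      (2 * B₂ + 1) (· = sim [] (Function.update S₁ M.answer (g q)) [] []) := by
    refine (Ev.move (by simp) _).mono (by simp; omega) ?_
    rintro T rfl
    simp [hS₂]
  exact (e₁.seq_eq (e₂.seq_eq (e₃.seq_eq (e₄.seq_eq (e₅.seq_eq e₆))))).mono_left (by omega)

/-- A bound for the cost of all statements of the machine. -/
noncomputable def maxCost (M : OracleMachine) : ℕ :=
  ∑ l : M.Lab, (M.prog l).elim cost fun _ => 0

theorem cost_le_maxCost {l : M.Lab} {s : Stmt (fun _ : M.K => Bool) M.Lab M.St}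
    (h : M.prog l = .inl s) : cost s ≤ maxCost M := by
  have := Finset.single_le_sum (f := fun l : M.Lab => (M.prog l).elim cost fun _ => 0)
    (fun _ _ => Nat.zero_le _) (Finset.mem_univ l)
  simpa [h, maxCost] using this

/-- An answer overwrites the answer stack and touches no other except the emptied query stack. The
query stack thus grows by at most `maxCost M` per step, however long the answers are; `B₁` bounds
all queries without reference to `g`, and long answers cannot be fed back into ever longer queries.
`B₂` bounds all stacks, including a fresh answer and its later growth. -/
theorem ev_loop
    (hc : ∀ x, Ev A query answer c (clean x) (p.eval x.length) fun S => ∃ y, y = g x ∧ S = clean y)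
    {B₁ B₂ D : ℕ} (hB : ∀ q, q.length ≤ B₁ → (g q).length + B₁ ≤ B₂)
    (hD : D = 4 * B₁ + p.eval B₁ + 6 * B₂ + 5 + maxCost M + 2 * numStates M + 2)
    {y : List Bool} {t : ℕ} {a : M.Cfg} (h : M.HaltsWith (fun q a => a = g q) y t a)
    (h₁ : (a.stk M.query).length + maxCost M * t ≤ B₁)
    (h₂ : ∀ k, (a.stk k).length + maxCost M * t ≤ B₂) :
    Ev A query answer (.loop pc (dispatch (numStates M) (stepCmd c)))
      (sim [] a.stk (pcCode a.l a.var) [] : SimReg M KH → _) (t * (D + 1) + 1)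
      fun T => ∃ S, S M.output = y ∧ (∀ k, (S k).length ≤ B₂) ∧ T = sim [] S [] [] := by
  induction h with
  | @halted t a hl hy =>
    rw [hl]
    exact (Ev.loop_nil rfl ⟨_, hy, fun k => (Nat.le_add_right _ _).trans (h₂ k), rfl⟩).mono_left
      (by omega)
  | @step t a hex hall ih =>
    obtain ⟨a', ha'⟩ := hex
    have et : (t + 1) * (D + 1) + 1 = D + (t * (D + 1) + 1) + 1 := by ring
    have ct : maxCost M * (t + 1) = maxCost M * t + maxCost M := by ring
    rw [et]
    have ih := ih a' ha'
    cases ha' with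
    | @stmt l s hs v S =>
      refine .loop_true (R := (· = sim [] (stepAux s v S).stk
        (pcCode (stepAux s v S).l (stepAux s v S).var) [])) (r := List.replicate (stateCode l v) true) rfl ?_ fun T hT => hT ▸ ih ?_ ?_
      · rw [update_sim_pc]
        have := stateCode_lt l v
        have := cost_le_maxCost hs
        refine (ev_dispatch (stateCode_lt l v) (stepCmd c) (t := cost s) ?_).mono_left (by omega)
        rw [stepCmd_stateCode, hs]
        exact ev_tr s v S
      · have := cost_le_maxCost hs
        have := length_stepAux_le s v S M.query
        simp only at h₁; omega
      · intro k
        have := cost_le_maxCost hs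
        have := length_stepAux_le s v S k
        have := h₂ k
        simp only at this; omega
    | @call l l' hs v S b hb =>
      subst hb
      simp only at h₁ h₂ ih
      have hq := hB (S M.query) (by omega)
      refine .loop_true (R := (· = sim []
        (Function.update (Function.update S M.query []) M.answer (g (S M.query)))
        (pcCode (some l') v) [])) (r := List.replicate (stateCode l v) true) rfl ?_ fun T hT => hT ▸ ih ?_ ?_
      · rw [update_sim_pc]
        have := stateCode_lt l v
        have := stateCode_lt l' v
        have := h₂ M.answer
        refine (ev_dispatch (stateCode_lt l v) (stepCmd c)
          (t := 4 * B₁ + p.eval B₁ + 6 * B₂ + 5 + (stateCode l' v + 1 + 1)) ?_).mono_left (by omega)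
        rw [stepCmd_stateCode, hs]
        refine (ev_answerQuery hc S (B₁ := B₁) (B₂ := B₂) (by omega) (by omega)
          (by omega)).seq_eq ((ev_setPc _ _ _).mono_right ?_)
        rintro T rfl
        simp [pcCode]
      · simp [Function.update_of_ne M.query_ne_answer]; omega
      · intro k
        by_cases hk : k = M.answer
        · subst hk; simp; omega
        · have := h₂ k
          by_cases hk' : k = M.query
          · subst hk'; simp [Function.update_of_ne M.query_ne_answer]; omega
          · simp [hk, hk']; omega

/-- Empty the stacks of the machine in a list. -/
noncomputable def clearAll (l : List M.K) : Cmd ((SimReg M KH)) :=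
  l.foldr (fun k c => .clear (stack k) ;; c) .skip

theorem ev_clearAll (l : List M.K) (S : M.K → List Bool) (z : List Bool) {B : ℕ}
    (hB : ∀ k, (S k).length ≤ B) :
    Ev A query answer (clearAll l) (sim [] S [] z : SimReg M KH → _) (l.length * (2 * B + 1) + 1)
      (· = sim [] (fun k => if k ∈ l then [] else S k) [] z) := by
  induction l generalizing S with
  | nil =>
    refine (Ev.skip (S := (sim [] S [] z : SimReg M KH → _)) (Q := (· = sim [] S [] z))
      rfl).mono (by simp) ?_
    rintro T rfl
    simp
  | cons k l ih =>
    have h : Ev A query answer (.clear (stack k)) (sim [] S [] z : SimReg M KH → _) (2 * B + 1)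
        (· = sim [] (Function.update S k []) [] z) := by
      refine (Ev.clear _ _).mono (by have := hB k; simp; omega) ?_
      rintro T rfl
      simp
    refine (h.seq_eq (ih _ fun k' => ?_)).mono (by simp; ring_nf; omega) ?_
    · by_cases hk : k' = k
      · subst hk; simp
      · simpa [hk] using hB k'
    · rintro T rfl
      congr 1
      ext1 k'
      by_cases hk : k' = k
      · subst hk; simp
      · simp [hk]

end Simulation

/-! ### Replacing a function oracle by a program -/

open Simulation Reg in
open Classical in
/-- A language that is decided in polynomial time with an oracle for a function is computed in
polynomial time by programs that can compute the function. -/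
theorem Comp.of_decidesIn {A : Oracle} {M : OracleMachine} {g : List Bool → List Bool}
    {L : Language Bool} {p : Polynomial ℕ} (hM : M.DecidesIn (fun q a => a = g q) L p)
    (hg : Comp A fun q a => a = g q) {r : Polynomial ℕ}
    (hr : ∀ q, (g q).length ≤ r.eval q.length) : Comp A fun x y => y = [decide (x ∈ L)] := by
  obtain ⟨KH, _, _, c, ph, hc⟩ := hg
  replace hc : ∀ x, Ev A query answer c (clean x) (ph.eval x.length)
      fun S => ∃ y, y = g x ∧ S = clean y :=
    fun x => (hc x).mono_right fun S ⟨y, h1, _, h2⟩ => ⟨y, h1, h2⟩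
  set B₁ : Polynomial ℕ := Polynomial.X + Polynomial.C (maxCost M) * p with hB₁
  set B₂ : Polynomial ℕ := B₁ + r.comp B₁ with hB₂
  set D : Polynomial ℕ := 4 * B₁ + ph.comp B₁ + 6 * B₂ + 5 + Polynomial.C (maxCost M) +
    2 * Polynomial.C (numStates M) + 2 with hD
  refine ⟨M.K ⊕ (KH ⊕ Bool), inferInstance, inferInstance,
    .move io buf ;; .move buf (stack M.input) ;; setPc (stateCode M.main M.initState + 1) ;;
    .loop pc (dispatch (numStates M) (stepCmd c)) ;;
    .move (stack M.output) buf ;; clearAll (Finset.univ : Finset M.K).toList ;; .move buf io,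
    4 * Polynomial.X + Polynomial.C (numStates M) + p * (D + 1) +
      Polynomial.C (Fintype.card M.K) * (2 * B₂ + 1) + 12,
    fun x => ?_⟩
  have e₁ : Ev A query answer (.move io buf) (clean x : SimReg M KH → _)
      (2 * x.length + 1) (· = sim [] (fun _ => []) [] x.reverse) := by
    rw [← sim_nil]
    refine (Ev.move (by simp) _).mono (by simp) ?_
    rintro T rfl
    simp
  have e₂ : Ev A query answer (.move buf (stack M.input))
      (sim [] (fun _ => []) [] x.reverse : SimReg M KH → _)
      (2 * x.length + 1) (· = sim [] (M.initCfg x).stk [] []) := by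
    refine (Ev.move (by simp) _).mono (by simp) ?_
    rintro T rfl
    simp [OracleMachine.initCfg]
  have e₃ : Ev A query answer (setPc (stateCode M.main M.initState + 1))
      (sim [] (M.initCfg x).stk [] [] : SimReg M KH → _) (numStates M + 1)
      (· = sim [] (M.initCfg x).stk (pcCode (M.initCfg x).l (M.initCfg x).var) []) := by
    have := stateCode_lt M.main M.initState
    refine (ev_setPc _ _ _).mono (by omega) ?_
    rintro T rfl
    simp [OracleMachine.initCfg, pcCode]
  have hlen (k : M.K) : ((M.initCfg x).stk k).length ≤ x.length := by
    by_cases hk : k = M.input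
    · subst hk; simp [OracleMachine.initCfg]
    · simp [OracleMachine.initCfg, hk]
  have e₄ := ev_loop (A := A) hc (B₁ := B₁.eval x.length) (B₂ := B₂.eval x.length)
    (D := D.eval x.length) (fun q hq => ?_) (by simp [hD]) (hM x) ?_ ?_
  rotate_left
  · have := (hr q).trans (eval_mono r hq)
    simp only [hB₂, Polynomial.eval_add, Polynomial.eval_comp]; omega
  · have := hlen M.query
    simp [hB₁]; omega
  · intro k
    have := hlen k
    simp [hB₁, hB₂]; omega
  have e₅ (S : M.K → List Bool) (hS : ∀ k, (S k).length ≤ B₂.eval x.length) (b : Bool)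
      (ho : S M.output = [b]) :
      Ev A query answer (.move (stack M.output) buf ;; clearAll (Finset.univ : Finset M.K).toList ;;
        .move buf io) (sim [] S [] [] : SimReg M KH → _)
      (3 + ((Fintype.card M.K * (2 * B₂.eval x.length + 1) + 1) + 3)) (· = clean [b]) := by
    have f₁ : Ev A query answer (.move (stack M.output) buf)
        (sim [] S [] [] : SimReg M KH → _) 3
        (· = sim [] (Function.update S M.output []) [] [b]) := by
      refine (Ev.move (by simp) _).mono (by simp [ho]) ?_
      rintro T rfl
      simp [ho]
    have f₂ := ev_clearAll (KH := KH) (A := A) (Finset.univ : Finset M.K).toList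
      (Function.update S M.output []) [b] (B := B₂.eval x.length) fun k => by
        by_cases hk : k = M.output
        · subst hk; simp
        · simpa [hk] using hS k
    simp only [Finset.length_toList, Finset.mem_toList, Finset.mem_univ, if_true,
      Finset.card_univ] at f₂
    have f₃ : Ev A query answer (.move buf io)
        (sim [] (fun _ => []) [] [b] : SimReg M KH → _) 3 (· = clean [b]) := by
      refine (Ev.move (by simp) _).mono (by simp) ?_
      rintro T rfl
      simp [← sim_nil]
    exact f₁.seq_eq (f₂.seq_eq f₃)
  refine (e₁.seq_eq (e₂.seq_eq (e₃.seq_eq (Ev.seq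
    (t' := 3 + ((Fintype.card M.K * (2 * B₂.eval x.length + 1) + 1) + 3))
    (Q := (· = clean [decide (x ∈ L)])) e₄ fun T hT => ?_)))).mono ?_ ?_
  · obtain ⟨S, hy, hS, rfl⟩ := hT
    exact e₅ S hS _ hy
  · simp; omega
  · rintro T rfl
    exact ⟨_, rfl, by simp, rfl⟩

/-! ### Functions computable in polynomial time -/

/-- The predicate `c` on strings is decidable in polynomial time. -/
@[fun_prop]
def FB (c : List Bool → Bool) : Prop := FP fun z => [c z]

section closure

variable {f g : List Bool → List Bool} {b c : List Bool → Bool}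

theorem FP.congr (hf : FP f) (h : ∀ z, f z = g z) : FP g := funext h ▸ hf

theorem FB.congr (hb : FB b) (h : ∀ z, b z = c z) : FB c := funext h ▸ hb

@[fun_prop]
theorem FP.pairFst (hf : FP f) : FP fun z => pairFst (f z) := FP.pairFst'.comp hf

@[fun_prop]
theorem FP.pairSnd (hf : FP f) : FP fun z => pairSnd (f z) := FP.pairSnd'.comp hf

@[fun_prop]
theorem FP.tail (hf : FP f) : FP fun z => (f z).tail := FP.tail'.comp hf

@[fun_prop]
theorem FP.ones (hf : FP f) : FP fun z => ones (f z) := FP.ones'.comp hf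

@[fun_prop]
theorem FP.dropOnes (hf : FP f) : FP fun z => dropOnes (f z) := FP.dropOnes'.comp hf

@[fun_prop]
theorem FP.reverse (hf : FP f) : FP fun z => (f z).reverse := FP.reverse'.comp hf

@[fun_prop]
theorem FP.pair (hf : FP f) (hg : FP g) : FP fun z => pair (f z) (g z) :=
  (Comp.pair hf hg).mono fun _ _ ⟨_, _, ha, hb, h⟩ => by rw [h, ha, hb]

@[fun_prop]
theorem FP.append (hf : FP f) (hg : FP g) : FP fun z => f z ++ g z := by
  simpa using FP.append_pair.comp (hf.pair hg)

@[fun_prop]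
theorem FP.const (l : List Bool) : FP fun _ => l := by
  induction l with
  | nil => exact FP.nil
  | cons b l ih => exact (FP.cons' b).comp ih

@[fun_prop]
theorem FP.cons (hb : FB b) (hf : FP f) : FP fun z => b z :: f z :=
  FP.append hb hf

@[fun_prop]
theorem FP.cond (hb : FB b) (hf : FP f) (hg : FP g) : FP fun z => cond (b z) (f z) (g z) := by
  have h := (FP.branch (FP.pairFst (FP.tail FP.id)) (FP.pairSnd (FP.tail FP.id))).comp
    (FP.tail (hb.pair (hf.pair hg)))
  refine h.congr fun z => ?_
  cases b z <;> simp

@[fun_prop]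
theorem FB.const (a : Bool) : FB fun _ => a := FP.const [a]

theorem FB.singleton (hb : FB b) : FP fun z => [b z] := hb

theorem FB.comp (hb : FB b) (hf : FP f) : FB fun z => b (f z) := FP.comp hb hf

@[fun_prop]
theorem FB.cond {a : List Bool → Bool} (ha : FB a) (hb : FB b) (hc : FB c) :
    FB fun z => cond (a z) (b z) (c z) := by
  refine FP.congr (FP.cond ha hb hc) fun z => ?_
  dsimp only
  cases a z <;> rfl

@[fun_prop]
theorem FB.and (hb : FB b) (hc : FB c) : FB fun z => b z && c z := by
  refine (FB.cond hb hc (FB.const false)).congr fun z => ?_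
  cases b z <;> rfl

@[fun_prop]
theorem FB.or (hb : FB b) (hc : FB c) : FB fun z => b z || c z := by
  refine (FB.cond hb (FB.const true) hc).congr fun z => ?_
  cases b z <;> rfl

@[fun_prop]
theorem FB.not (hb : FB b) : FB fun z => !b z := by
  refine (FB.cond hb (FB.const false) (FB.const true)).congr fun z => ?_
  cases b z <;> rfl

@[fun_prop]
theorem FB.headD (hf : FP f) : FB fun z => (f z).headD false := by
  refine FP.congr ((FP.branch (FP.const [true]) (FP.const [false])).comp hf) fun z => ?_
  dsimp only
  cases (f z).headD false <;> rfl

@[fun_prop]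
theorem FB.isEmpty (hf : FP f) : FB fun z => (f z).isEmpty := FP.isEmpty'.comp hf

theorem Iter.eq_iterate {F : List Bool → List Bool} {n : ℕ} {a b : List Bool}
    (h : Iter (fun x y => y = F x) n a b) : b = F^[n] a := by
  induction n generalizing b with
  | zero => exact h
  | succ n ih =>
    obtain ⟨c, hc, rfl⟩ := h
    rw [Function.iterate_succ_apply', ← ih hc]

/-- Iteration of a function with parameters that increases the length by a bounded amount. -/
theorem FP.iterate {step : List Bool → List Bool → List Bool} {cnt init : List Bool → List Bool}
    (hs : FP fun y => step (Cplx.pairFst y) (Cplx.pairSnd y)) (hc : FP cnt) (hi : FP init)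
    (hb : ∃ p : Polynomial ℕ, ∀ z s, (step z s).length ≤ s.length + p.eval z.length) :
    FP fun z => (step z)^[(cnt z).length] (init z) := by
  obtain ⟨p, hp⟩ := hb
  -- The parameter `z` is carried along in the state, so that a single function is iterated.
  set F : List Bool → List Bool :=
    fun y => Cplx.pair (Cplx.pairFst y) (step (Cplx.pairFst y) (Cplx.pairSnd y)) with hF
  have key (z : List Bool) (n : ℕ) (s : List Bool) :
      F^[n] (Cplx.pair z s) = Cplx.pair z ((step z)^[n] s) := by
    induction n generalizing s with
    | zero => rfl
    | succ n ih => simp [hF, ← ih]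
  have hlen (z : List Bool) (n : ℕ) (s : List Bool) :
      ((step z)^[n] s).length ≤ s.length + n * p.eval z.length := by
    induction n with
    | zero => simp
    | succ n ih =>
      rw [Function.iterate_succ_apply']
      have := hp z ((step z)^[n] s)
      rw [Nat.succ_mul]
      omega
  have hFP : FP F := FP.pair (FP.pairFst FP.id) hs
  have hiter := Comp.iter hFP ⟨5 * Polynomial.X + (Polynomial.X + 1) * p + p + 1, ?_⟩
  · have h := (hiter.mono (G := fun x y => y = F^[(Cplx.pairFst x).length] (Cplx.pairSnd x))
      fun x y h => h.eq_iterate)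
    replace h : FP fun x => F^[(Cplx.pairFst x).length] (Cplx.pairSnd x) := h
    have := FP.pairSnd (h.comp (hc.pair (FP.id.pair hi)))
    simpa only [pairFst_pair, pairSnd_pair, key] using this
  · intro x s i hi h
    rw [h.eq_iterate]
    have h₁ := length_pairFst_le x
    have h₂ := length_pairSnd_le x
    simp only [Polynomial.eval_add, Polynomial.eval_mul, Polynomial.eval_X, Polynomial.eval_ofNat,
      Polynomial.eval_one]
    -- `pairSnd x` need not be the code of a pair; after one application of `F` the state is one,
    -- and `key` applies.
    cases i with
    | zero => simp; omega
    | succ i =>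
      set w := Cplx.pairSnd x
      have h₃ := length_pairFst_le w
      have h₄ := length_pairSnd_le w
      rw [Function.iterate_succ_apply]
      simp only [hF]
      rw [← hF, key, length_pair]
      have h₅ := hlen (Cplx.pairFst w) i (step (Cplx.pairFst w) (Cplx.pairSnd w))
      have h₆ := hp (Cplx.pairFst w) (Cplx.pairSnd w)
      have h₇ := eval_mono p (h₃.trans h₂)
      have h₈ : i * p.eval (Cplx.pairFst w).length ≤ (x.length + 1) * p.eval x.length :=
        Nat.mul_le_mul (by omega) h₇
      omega

/-! ### Truncation of strings, and values of polynomials in unary -/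

theorem tail_iterate (n : ℕ) (l : List Bool) : List.tail^[n] l = l.drop n := by
  induction n generalizing l with
  | zero => rfl
  | succ n ih => cases l <;> simp [ih]

@[fun_prop]
theorem FP.drop (hf : FP f) (hg : FP g) : FP fun z => (g z).drop (f z).length := by
  have := FP.iterate (step := fun _ => List.tail) (by fun_prop) hf hg ⟨0, fun z s => by simp⟩
  simpa only [tail_iterate] using this

@[fun_prop]
theorem FP.take (hf : FP f) (hg : FP g) : FP fun z => (g z).take (f z).length := by
  have : FP fun z => ((g z).reverse.drop ((g z).drop (f z).length).length).reverse := by fun_prop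
  refine this.congr fun z => ?_
  rw [List.reverse_drop, List.reverse_reverse]
  simp only [List.length_drop, List.length_reverse]
  rcases le_total (f z).length (g z).length with h | h
  · rw [Nat.sub_sub_self h]
  · simp [Nat.sub_eq_zero_of_le h, List.take_of_length_le h]

theorem FP.replicate_mul_length (hf : FP f) :
    FP fun z => List.replicate ((f z).length * z.length) true := by
  have h₁ : FP fun z => List.replicate z.length true := by
    have := FP.iterate (step := fun _ s => true :: s) (by fun_prop) FP.id FP.nil
      ⟨1, fun z s => by simp⟩
    refine this.congr fun z => ?_
    induction z.length with
    | zero => rfl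
    | succ n ih => rw [Function.iterate_succ_apply', ih, List.replicate_succ]
  have h₂ := FP.iterate (step := fun z s => List.replicate z.length true ++ s)
    (FP.append (h₁.comp (by fun_prop)) (by fun_prop)) hf FP.nil
    ⟨Polynomial.X, fun z s => by simp [add_comm]⟩
  refine h₂.congr fun z => ?_
  induction (f z).length with
  | zero => simp
  | succ n ih =>
    rw [Function.iterate_succ_apply', ih, ← List.replicate_add]
    congr 1
    ring

/-- Polynomials of the length are computable in unary. -/
theorem FP.replicate_eval (p : Polynomial ℕ) :
    FP fun z => List.replicate (p.eval z.length) true := by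
  induction p using Polynomial.induction_on' with
  | add p q hp hq =>
    simp only [Polynomial.eval_add, List.replicate_add]
    exact hp.append hq
  | monomial n a =>
    induction n with
    | zero => simpa using FP.const _
    | succ n ih =>
      refine (FP.replicate_mul_length ih).congr fun z => ?_
      simp only [Polynomial.eval_monomial, List.length_replicate]
      congr 1
      ring

end closure

/-! #### Evaluation of circuits -/

@[simp] theorem ones_encodeNat_append (k : ℕ) (u : List Bool) :
    ones (encodeNat k ++ u) = List.replicate k true := by
  induction k with
  | zero => simp [encodeNat, ones]
  | succ k ih => simpa [encodeNat, List.replicate_succ, ones] using ih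

@[simp] theorem dropOnes_encodeNat_append (k : ℕ) (u : List Bool) :
    dropOnes (encodeNat k ++ u) = u := by
  induction k with
  | zero => simp [encodeNat, dropOnes]
  | succ k ih => simpa [encodeNat, List.replicate_succ, dropOnes] using ih

/-- The bit of `l` at the position that is given in unary at the beginning of `u`. -/
def getBit (l u : List Bool) : Bool := (l.drop (ones u).length).headD false

@[fun_prop]
theorem FB.getBit {f g : List Bool → List Bool} (hf : FP f) (hg : FP g) :
    FB fun z => getBit (f z) (g z) := by
  unfold Cplx.getBit
  fun_prop

theorem getBit_encodeNat_append (l : List Bool) (k : ℕ) (u : List Bool) :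
    getBit l (encodeNat k ++ u) = l.getD k false := by
  rw [getBit, ones_encodeNat_append, List.length_replicate, List.getD_eq_getElem?_getD,
    List.headD_eq_head?_getD, List.head?_drop]

/-- The value of the first gate in the code `c`. -/
def gateBit (inp c vals : List Bool) : Bool :=
  bif c.headD false then
    bif c.tail.headD false then
      getBit vals c.tail.tail || getBit vals (dropOnes c.tail.tail)
    else getBit vals c.tail.tail && getBit vals (dropOnes c.tail.tail)
  else bif c.tail.headD false then !getBit vals c.tail.tail
  else bif c.tail.tail.headD false then getBit inp c.tail.tail.tail
  else c.tail.tail.tail.headD false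

/-- What follows the first gate in the code `c`. -/
def gateRest (c : List Bool) : List Bool :=
  bif c.headD false then dropOnes (dropOnes c.tail.tail)
  else bif c.tail.headD false then dropOnes c.tail.tail
  else bif c.tail.tail.headD false then dropOnes c.tail.tail.tail
  else c.tail.tail.tail.tail

theorem gateBit_encode_append (inp vals u : List Bool) (g : Gate) :
    gateBit inp (g.encode ++ u) vals = g.eval inp vals := by
  cases g <;> simp [Gate.encode, gateBit, Gate.eval, getBit_encodeNat_append]

theorem gateRest_encode_append (u : List Bool) (g : Gate) : gateRest (g.encode ++ u) = u := by
  cases g <;> simp [Gate.encode, gateRest]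

theorem length_gateRest_le (c : List Bool) : (gateRest c).length ≤ c.length := by
  have h (l : List Bool) : (dropOnes l).length ≤ l.length := by
    have := length_ones_add_length_dropOnes_le l
    omega
  have h₁ := h (dropOnes c.tail.tail)
  have h₂ := h c.tail.tail
  have h₃ := h c.tail.tail.tail
  simp only [List.length_tail] at h₂ h₃
  simp only [gateRest]
  cases c.headD false <;> cases c.tail.headD false <;> cases c.tail.tail.headD false <;>
    (simp; omega)

/-- Evaluate the first gate of a circuit; the state consists of the code of the remaining circuit
and the values of the earlier gates. -/
def evalStep (inp s : List Bool) : List Bool :=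
  bif (pairFst s).isEmpty then s
  else pair (gateRest (pairFst s)) (gateBit inp (pairFst s) (pairSnd s) :: pairSnd s)

theorem length_evalStep_le (inp s : List Bool) : (evalStep inp s).length ≤ s.length + 2 := by
  have h₁ := length_gateRest_le (pairFst s)
  have h₂ := two_mul_length_pairFst_add_length_pairSnd_le s
  simp only [evalStep]
  cases (pairFst s).isEmpty
  · simp; omega
  · simp

/-- The value on input `inp` of the circuit with code `c`. -/
def evalCode (c inp : List Bool) : Bool :=
  (pairSnd ((evalStep inp)^[c.length] (pair c []))).headD false

/-- Rounds after the last gate are idle, so every number of rounds from the number of gates on will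
do, in particular the length of the code. -/
theorem iterate_evalStep (inp : List Bool) (C : Circuit) (n : ℕ) (hn : C.length ≤ n)
    (vals : List Bool) : (evalStep inp)^[n] (pair (C.flatMap Gate.encode) vals) =
      pair [] (C.foldl (fun vals g => g.eval inp vals :: vals) vals) := by
  induction C generalizing n vals with
  | nil =>
    induction n with
    | zero => rfl
    | succ n ih =>
      rw [Function.iterate_succ_apply, ← ih (by simp)]
      congr 1
  | cons g C ih =>
    obtain ⟨n, rfl⟩ : ∃ m, n = m + 1 := ⟨n - 1, by simp at hn; omega⟩
    have h : ((g :: C).flatMap Gate.encode).isEmpty = false := by cases g <;> simp [Gate.encode]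
    rw [Function.iterate_succ_apply, List.foldl_cons, ← ih n (by simpa using hn)]
    congr 1
    rw [evalStep, pairFst_pair, h, pairSnd_pair, List.flatMap_cons, gateRest_encode_append,
      gateBit_encode_append]
    rfl

theorem evalCode_flatMap_encode (C : Circuit) (inp : List Bool) :
    evalCode (C.flatMap Gate.encode) inp = C.eval inp := by
  have h : C.length ≤ (C.flatMap Gate.encode).length := by
    induction C with
    | nil => simp
    | cons g C ih =>
      have : 1 ≤ g.encode.length := by cases g <;> simp [Gate.encode]
      simp only [List.flatMap_cons, List.length_append, List.length_cons]
      omega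
  rw [evalCode, iterate_evalStep inp C _ h, pairSnd_pair]
  rfl

@[fun_prop]
theorem FB.evalCode {f g : List Bool → List Bool} (hf : FP f) (hg : FP g) :
    FB fun z => evalCode (f z) (g z) := by
  have h : FP fun y => evalStep (pairFst y) (pairSnd y) := by
    unfold evalStep gateRest gateBit
    fun_prop
  have h' : FP fun y => evalStep (pairSnd (pairFst y)) (pairSnd y) := by
    simpa using h.comp (g := fun y => pair (pairSnd (pairFst y)) (pairSnd y)) (by fun_prop)
  have h₂ := FP.iterate (step := fun z s => evalStep (pairSnd z) s)
    h'
    (cnt := pairFst) (init := fun z => pair (pairFst z) []) (by fun_prop) (by fun_prop)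
    ⟨2, fun z s => by simpa using length_evalStep_le _ s⟩
  refine ((FB.headD (FP.pairSnd h₂)).comp (hf.pair hg)).congr fun z => ?_
  simp [Cplx.evalCode]

/-! ### Averages over strings -/

/-- The average of `f` over the strings of length `n`. -/
def avg : ℕ → (List Bool → ℚ) → ℚ
  | 0, f => f []
  | n + 1, f => (avg n (fun w => f (false :: w)) + avg n (fun w => f (true :: w))) / 2

theorem avg_congr {n : ℕ} {f g : List Bool → ℚ} (h : ∀ w, w.length = n → f w = g w) :
    avg n f = avg n g := by
  induction n generalizing f g with
  | zero => exact h _ rfl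
  | succ n ih =>
    rw [avg, avg, ih fun w hw => h _ (by simp [hw]), ih fun w hw => h _ (by simp [hw])]

theorem avg_mono {n : ℕ} {f g : List Bool → ℚ} (h : ∀ w, w.length = n → f w ≤ g w) :
    avg n f ≤ avg n g := by
  induction n generalizing f g with
  | zero => exact h _ rfl
  | succ n ih =>
    rw [avg, avg]
    gcongr <;> exact ih fun w hw => h _ (by simp [hw])

theorem avg_const (n : ℕ) (c : ℚ) : avg n (fun _ => c) = c := by
  induction n with
  | zero => rfl
  | succ n ih => rw [avg, ih]; ring

theorem avg_nonneg {n : ℕ} {f : List Bool → ℚ} (h : ∀ w, w.length = n → 0 ≤ f w) : 0 ≤ avg n f :=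
  (avg_const n 0).symm.le.trans (avg_mono h)

theorem avg_mul_const (n : ℕ) (f : List Bool → ℚ) (c : ℚ) :
    avg n (fun w => f w * c) = avg n f * c := by
  induction n generalizing f with
  | zero => rfl
  | succ n ih => rw [avg, avg, ih, ih]; ring

theorem avg_add (n : ℕ) (f g : List Bool → ℚ) :
    avg n (fun w => f w + g w) = avg n f + avg n g := by
  induction n generalizing f g with
  | zero => rfl
  | succ n ih => rw [avg, avg, avg, ih, ih]; ring

theorem avg_add_length (m n : ℕ) (f : List Bool → ℚ) :
    avg (m + n) f = avg m fun u => avg n fun w => f (u ++ w) := by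
  induction m generalizing f with
  | zero => simp [avg]
  | succ m ih => rw [Nat.succ_add, avg, avg, ih, ih]; rfl

theorem avg_take_drop (m n : ℕ) (f : List Bool → List Bool → ℚ) :
    avg (m + n) (fun w => f (w.take m) (w.drop m)) = avg m fun u => avg n fun w => f u w := by
  rw [avg_add_length]
  refine avg_congr fun u hu => avg_congr fun w hw => ?_
  rw [List.take_left' hu, List.drop_left' hu]

/-- Superfluous random bits do not change a probability. This lets queries of all kinds share one
number of random bits. -/
theorem avg_take (m n : ℕ) (f : List Bool → ℚ) :
    avg (m + n) (fun w => f (w.take m)) = avg m f := by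
  rw [avg_take_drop m n fun u _ => f u]
  simp only [avg_const]

/-- A nonnegative function is at most `2 ^ n` times its average over the strings of length `n`. -/
theorem le_avg_mul {n : ℕ} {f : List Bool → ℚ} (h : ∀ w, w.length = n → 0 ≤ f w) {v : List Bool}
    (hv : v.length = n) : f v ≤ avg n f * 2 ^ n := by
  induction n generalizing f v with
  | zero =>
    obtain rfl := List.length_eq_zero_iff.mp hv
    simp [avg]
  | succ n ih =>
    obtain ⟨b, v, rfl⟩ := List.exists_cons_of_length_eq_add_one hv
    have h₀ : 0 ≤ avg n fun w => f (false :: w) := avg_nonneg fun w hw => h _ (by simp [hw])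
    have h₁ : 0 ≤ avg n fun w => f (true :: w) := avg_nonneg fun w hw => h _ (by simp [hw])
    have e : avg (n + 1) f * 2 ^ (n + 1) =
        (avg n fun w => f (false :: w)) * 2 ^ n + (avg n fun w => f (true :: w)) * 2 ^ n := by
      rw [avg, pow_succ]; ring
    rw [e]
    cases b
    · have := ih (f := fun w => f (false :: w)) (fun w hw => h _ (by simp [hw])) (v := v)
        (by simpa using hv)
      have : 0 ≤ (avg n fun w => f (true :: w)) * 2 ^ n := by positivity
      linarith
    · have := ih (f := fun w => f (true :: w)) (fun w hw => h _ (by simp [hw])) (v := v)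
        (by simpa using hv)
      have : 0 ≤ (avg n fun w => f (false :: w)) * 2 ^ n := by positivity
      linarith

/-! ### Indicators, acceptance probabilities and independent blocks -/

/-- The indicator of a boolean. -/
def ind (b : Bool) : ℚ := cond b 1 0

@[simp] theorem ind_true : ind true = 1 := rfl
@[simp] theorem ind_false : ind false = 0 := rfl

theorem ind_nonneg (b : Bool) : 0 ≤ ind b := by cases b <;> simp

theorem ind_le_one (b : Bool) : ind b ≤ 1 := by cases b <;> simp

theorem ind_and (a b : Bool) : ind (a && b) = ind a * ind b := by cases a <;> simp

theorem ind_mono {a b : Bool} (h : a = true → b = true) : ind a ≤ ind b := by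
  cases a
  · exact ind_nonneg b
  · rw [h rfl]

theorem acceptProb_eq_avg {V : Language Bool} {c : List Bool → Bool} {m : ℕ} {x : List Bool}
    (h : ∀ w, pair x w ∈ V ↔ c w = true) : acceptProb V m x = avg m fun w => ind (c w) := by
  simp only [acceptProb, h]
  clear h
  induction m generalizing c with
  | zero =>
    have : {w : List Bool | w.length = 0 ∧ c w = true} = if c [] then {[]} else ∅ := by
      ext w
      cases hc : c []
      · simp only [Set.mem_ofPred_eq, List.length_eq_zero_iff]
        simp; rintro rfl; exact hc
      · simp only [Set.mem_ofPred_eq, List.length_eq_zero_iff]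
        simp; rintro rfl; exact hc
    rw [this, avg]
    cases c [] <;> simp
  | succ m ih =>
    have hs (b : Bool) : Set.Finite {w : List Bool | w.length = m ∧ c (b :: w) = true} :=
      (List.finite_length_eq Bool m).subset fun w hw => hw.1
    have e : {w : List Bool | w.length = m + 1 ∧ c w = true} =
        List.cons false '' {w | w.length = m ∧ c (false :: w) = true} ∪
        List.cons true '' {w | w.length = m ∧ c (true :: w) = true} := by
      ext w
      cases w with
      | nil => simp
      | cons b w => cases b <;> simp
    rw [e, Set.ncard_union_eq ?_ ((hs _).image _) ((hs _).image _),
      Set.ncard_image_of_injective _ List.cons_injective,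
      Set.ncard_image_of_injective _ List.cons_injective, avg,
      ← ih (c := fun w => c (false :: w)), ← ih (c := fun w => c (true :: w)), pow_succ]
    · push_cast
      ring
    · rw [Set.disjoint_left]
      rintro _ ⟨w, -, rfl⟩ ⟨w', -, h⟩
      simp at h

/-- All of the first `k` blocks of length `n` satisfy `c`. -/
def allBlocks (c : List Bool → Bool) (n : ℕ) : ℕ → List Bool → Bool
  | 0, _ => true
  | k + 1, w => c (w.take n) && allBlocks c n k (w.drop n)

/-- Disjoint blocks are independent, so the probability is a power; the last `r` bits are not read.
-/
theorem avg_allBlocks (c : List Bool → Bool) (n k r : ℕ) :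
    avg (k * n + r) (fun w => ind (allBlocks c n k w)) = avg n (fun w => ind (c w)) ^ k := by
  induction k with
  | zero => simp [allBlocks, avg_const]
  | succ k ih =>
    have e : (k + 1) * n + r = n + (k * n + r) := by ring
    simp only [allBlocks, ind_and]
    rw [e, avg_take_drop n (k * n + r) fun u w => ind (c u) * ind (allBlocks c n k w)]
    have h (u : List Bool) : (avg (k * n + r) fun w => ind (c u) * ind (allBlocks c n k w)) =
        ind (c u) * avg n (fun w => ind (c w)) ^ k := by
      simp only [mul_comm (ind (c u))]
      rw [avg_mul_const, ih]
    simp only [h]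
    rw [avg_mul_const, pow_succ']

/-- At least `f` ones at the beginning. -/
theorem avg_ones (f n : ℕ) (c : List Bool → Bool) :
    avg (f + n) (fun w => ind (decide (f ≤ (ones w).length) && c (w.drop f))) =
      avg n (fun w => ind (c w)) / 2 ^ f := by
  induction f with
  | zero => simp
  | succ f ih =>
    rw [Nat.succ_add, avg]
    simp only [ones, List.length_nil, List.length_cons, List.drop_succ_cons,
      Nat.add_le_add_iff_right]
    rw [ih]
    simp [avg_const, pow_succ]
    ring

/-! ### The relation of an instance of `LOP` -/

/-- The relation described by the code `q` of an instance of `LOP`. -/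
def codeLt (q x y : List Bool) : Bool := evalCode (dropOnes q) (x ++ y)

/-- The length of the strings that the instance with code `q` is about. -/
def codeLen (q : List Bool) : ℕ := (ones q).length

theorem codeLen_le (q : List Bool) : codeLen q ≤ q.length := by
  have := length_ones_add_length_dropOnes_le q
  rw [codeLen]; omega

theorem codeLt_encodeLOP (n : ℕ) (E : Circuit) (x y : List Bool) :
    codeLt (encodeLOP n E) x y = true ↔ E.Lt x y := by
  rw [codeLt, encodeLOP, dropOnes_encodeNat_append, evalCode_flatMap_encode, Circuit.Lt]

theorem codeLen_encodeLOP (n : ℕ) (E : Circuit) : codeLen (encodeLOP n E) = n := by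
  rw [codeLen, encodeLOP, ones_encodeNat_append, List.length_replicate]

section

variable {f g h k : List Bool → List Bool}

@[fun_prop]
theorem FB.codeLt (hf : FP f) (hg : FP g) (hh : FP h) :
    FB fun z => codeLt (f z) (g z) (h z) := by
  unfold Cplx.codeLt
  fun_prop

@[fun_prop]
theorem FP.take_codeLen (hf : FP f) (hg : FP g) : FP fun z => (g z).take (codeLen (f z)) := by
  unfold codeLen
  fun_prop

@[fun_prop]
theorem FP.drop_codeLen (hf : FP f) (hg : FP g) : FP fun z => (g z).drop (codeLen (f z)) := by
  unfold codeLen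
  fun_prop

end

/-! #### Equality of strings -/

/-- Compare the first bits of two strings; the result is in front of the second string. -/
def eqStep (s : List Bool) : List Bool :=
  pair (pairFst s).tail (((pairSnd s).headD false && bif (pairFst s).headD false then
    (pairSnd s).tail.headD false else !(pairSnd s).tail.headD false) :: (pairSnd s).tail.tail)

/-- Equality of strings of the same length. -/
def eqBits (a b : List Bool) : Bool :=
  (pairSnd (eqStep^[a.length] (pair a (true :: b)))).headD false

theorem iterate_eqStep (a b : List Bool) (h : a.length = b.length) (c : Bool) :
    eqStep^[a.length] (pair a (c :: b)) = pair [] [c && decide (a = b)] := by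
  induction a generalizing b c with
  | nil =>
    obtain rfl := List.length_eq_zero_iff.mp h.symm
    simp
  | cons x a ih =>
    match b, h with
    | y :: b, h =>
      have e : eqStep (pair (x :: a) (c :: y :: b)) = pair a ((c && decide (x = y)) :: b) := by
        cases x <;> cases y <;> simp [eqStep, pairFst, pairSnd]
      rw [List.length_cons, Function.iterate_succ_apply, e, ih b (by simpa using h)]
      simp [Bool.and_assoc]

theorem eqBits_eq {a b : List Bool} (h : a.length = b.length) : eqBits a b = decide (a = b) := by
  rw [eqBits, iterate_eqStep a b h]
  simp [pairSnd]

@[fun_prop]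
theorem FB.eqBits {f g : List Bool → List Bool} (hf : FP f) (hg : FP g) :
    FB fun z => eqBits (f z) (g z) := by
  have h := FP.iterate (step := fun _ s => eqStep s) (cnt := Cplx.pairFst)
    (init := fun z => Cplx.pair (Cplx.pairFst z) (true :: Cplx.pairSnd z))
    (by unfold eqStep; fun_prop) (by fun_prop) (by fun_prop) ⟨2, fun z s => by
      have := two_mul_length_pairFst_add_length_pairSnd_le s
      simp [eqStep]; omega⟩
  refine ((FB.headD (FP.pairSnd h)).comp (hf.pair hg)).congr fun z => ?_
  simp [Cplx.eqBits]

/-! #### Blocks -/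

/-- Check the next block `b`: it has to be below `x`, but not below `a`. The state is a flag
followed by the remaining string. -/
def blockStep (q x a s : List Bool) : List Bool :=
  (s.headD false && (codeLt q (s.tail.take (codeLen q)) x &&
    !codeLt q (s.tail.take (codeLen q)) a)) :: s.tail.drop (codeLen q)

/-- The number of blocks. -/
def numBlocks (q : List Bool) : ℕ := (true :: true :: (q ++ q)).length

/-- Halving the rank in one round needs an exponent of at least `2 * codeLen q + 2`
(`IsOrder.density_lt`), and `q.length` bounds `codeLen q`. Defining the number as the length of an
explicit string makes it available in unary. -/
theorem numBlocks_eq (q : List Bool) : numBlocks q = 2 * q.length + 2 := by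
  simp [numBlocks]; ring

theorem iterate_blockStep (q x a : List Bool) (k : ℕ) (c : Bool) (w : List Bool) :
    ((blockStep q x a)^[k] (c :: w)).headD false =
      (c && allBlocks (fun z => codeLt q z x && !codeLt q z a) (codeLen q) k w) := by
  induction k generalizing c w with
  | zero => simp [allBlocks]
  | succ k ih =>
    rw [Function.iterate_succ_apply, blockStep, ih, allBlocks]
    simp [Bool.and_assoc]

/-- All blocks of `w` are below `x`, but not below `a`. -/
def blocksOK (q x a w : List Bool) : Bool :=
  allBlocks (fun z => codeLt q z x && !codeLt q z a) (codeLen q) (numBlocks q) w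

@[fun_prop]
theorem FB.blocksOK {f g h k : List Bool → List Bool} (hf : FP f) (hg : FP g) (hh : FP h)
    (hk : FP k) : FB fun z => blocksOK (f z) (g z) (h z) (k z) := by
  have H := FP.iterate
    (step := fun z s => blockStep (Cplx.pairFst z) (Cplx.pairFst (Cplx.pairSnd z))
      (Cplx.pairFst (Cplx.pairSnd (Cplx.pairSnd z))) s)
    (cnt := fun z => true :: true :: (Cplx.pairFst z ++ Cplx.pairFst z))
    (init := fun z => true :: Cplx.pairSnd (Cplx.pairSnd (Cplx.pairSnd z)))
    (by unfold blockStep; fun_prop) (by fun_prop) (by fun_prop) ⟨1, fun z s => by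
      simp [blockStep]⟩
  refine ((FB.headD H).comp (hf.pair (hg.pair (hh.pair hk)))).congr fun z => ?_
  rw [iterate_blockStep]
  simp [Cplx.blocksOK, numBlocks]

/-! #### Counterexamples -/

/-- `v = c :: x ++ y ++ z` consists of the type of a counterexample and of its elements. -/
def isCex (q v : List Bool) : Bool :=
  bif v.headD false then
    codeLt q (v.tail.take (codeLen q)) ((v.tail.drop (codeLen q)).take (codeLen q)) &&
    codeLt q ((v.tail.drop (codeLen q)).take (codeLen q))
      (((v.tail.drop (codeLen q)).drop (codeLen q)).take (codeLen q)) &&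
    codeLt q (((v.tail.drop (codeLen q)).drop (codeLen q)).take (codeLen q))
      (v.tail.take (codeLen q))
  else
    (codeLt q (v.tail.take (codeLen q)) ((v.tail.drop (codeLen q)).take (codeLen q)) &&
      codeLt q ((v.tail.drop (codeLen q)).take (codeLen q)) (v.tail.take (codeLen q))) ||
    (!codeLt q (v.tail.take (codeLen q)) ((v.tail.drop (codeLen q)).take (codeLen q)) &&
      !codeLt q ((v.tail.drop (codeLen q)).take (codeLen q)) (v.tail.take (codeLen q)) &&
      !eqBits (v.tail.take (codeLen q)) ((v.tail.drop (codeLen q)).take (codeLen q)))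

@[fun_prop]
theorem FB.isCex {f g : List Bool → List Bool} (hf : FP f) (hg : FP g) :
    FB fun z => isCex (f z) (g z) := by
  unfold Cplx.isCex
  fun_prop

theorem isCex_true (q x y z : List Bool) (hx : x.length = codeLen q) (hy : y.length = codeLen q)
    (hz : z.length = codeLen q) : isCex q (true :: (x ++ y ++ z)) =
      (codeLt q x y && codeLt q y z && codeLt q z x) := by
  simp [isCex, ← hx]
  simp [hx, ← hy]
  simp [hy, ← hz]

/-- For a counterexample that is a pair, `z` is padding: all candidates have the same length, as the
prefix search requires. -/
theorem isCex_false (q x y z : List Bool) (hx : x.length = codeLen q) (hy : y.length = codeLen q) :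
    isCex q (false :: (x ++ y ++ z)) = ((codeLt q x y && codeLt q y x) ||
      (!codeLt q x y && !codeLt q y x && !decide (x = y))) := by
  simp [isCex, ← hx]
  simp [hx, ← hy]
  rw [eqBits_eq (hx.trans hy.symm)]

/-- The length of counterexamples. -/
def cexLen (q : List Bool) : ℕ := (true :: (ones q ++ ones q ++ ones q)).length

theorem cexLen_eq (q : List Bool) : cexLen q = 3 * codeLen q + 1 := by
  simp [cexLen, codeLen]; ring

@[fun_prop]
theorem FP.take_cexLen {f g : List Bool → List Bool} (hf : FP f) (hg : FP g) :
    FP fun z => (g z).take (cexLen (f z)) := by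
  unfold cexLen
  fun_prop

theorem exists_of_length_eq_cexLen {q v : List Bool} (hv : v.length = cexLen q) :
    ∃ c x y z, x.length = codeLen q ∧ y.length = codeLen q ∧ z.length = codeLen q ∧
      v = c :: (x ++ y ++ z) := by
  rw [cexLen_eq] at hv
  obtain ⟨c, v, rfl⟩ := List.exists_cons_of_length_eq_add_one hv
  simp only [List.length_cons, Nat.add_right_cancel_iff] at hv
  refine ⟨c, v.take (codeLen q), (v.drop (codeLen q)).take (codeLen q),
    (v.drop (codeLen q)).drop (codeLen q), ?_, ?_, ?_, ?_⟩
  · simp; omega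
  · simp; omega
  · simp; omega
  · rw [List.append_assoc, List.take_append_drop, List.take_append_drop]

/-! ### The verifier -/

/-- Does the random string `w` show that `u` can be continued to a counterexample? -/
def cexCheck (q u w : List Bool) : Bool := isCex q ((u ++ w).take (cexLen q))

/-- The random string `w` continues `u` to an element `a` below `x`, which is followed by blocks
below `x` that are not below `a`. -/
def minCheck (q x u w : List Bool) : Bool :=
  codeLt q ((u ++ w).take (codeLen q)) x &&
    blocksOK q x ((u ++ w).take (codeLen q)) (w.drop (codeLen q))

/-- The number of ones that is required at the beginning of the random string. -/
noncomputable def numOnes (Q : Polynomial ℕ) (X j u : List Bool) : ℕ :=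
  Q.eval X.length - (j.length + u.length)

/-- The verifier for the query `X` with random string `w`. Queries that begin with `0` are passed
to `c`. -/
noncomputable def verify (c : List Bool → Bool) (p Q : Polynomial ℕ) (X w : List Bool) : Bool :=
  bif X.isEmpty then false
  else bif X.headD false then
    bif X.tail.headD false then
      decide (numOnes Q X (pairSnd (pairSnd (pairFst X.tail.tail))) (pairSnd X.tail.tail) ≤
        (ones w).length) &&
      minCheck (pairFst (pairFst X.tail.tail)) (pairFst (pairSnd (pairFst X.tail.tail)))
        (pairSnd X.tail.tail)
        (w.drop (numOnes Q X (pairSnd (pairSnd (pairFst X.tail.tail))) (pairSnd X.tail.tail)))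
    else cexCheck (pairFst X.tail.tail) (pairSnd X.tail.tail) w
  else c (pair X.tail (w.take (p.eval X.tail.length)))

theorem FB.verify {c : List Bool → Bool} (hc : FB c) (p Q : Polynomial ℕ) :
    FB fun v => verify c p Q (pairFst v) (pairSnd v) := by
  have h₁ : FB fun v => c (pair (pairFst v).tail
      ((pairSnd v).take (List.replicate (p.eval (pairFst v).tail.length) true).length)) :=
    hc.comp (FP.pair (by fun_prop) (FP.take ((FP.replicate_eval p).comp (by fun_prop))
      (by fun_prop)))
  have h₂ : FP fun v => ((List.replicate (Q.eval (pairFst v).length) true).drop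
      (pairSnd (pairSnd (pairFst (pairFst v).tail.tail)) ++
        pairSnd (pairFst v).tail.tail).length) :=
    FP.drop (by fun_prop) ((FP.replicate_eval Q).comp (by fun_prop))
  -- Numbers are handled as lengths of strings: truncated subtraction is `drop`, and a comparison
  -- asks whether a `drop` is empty.
  have e (v : List Bool) : numOnes Q (pairFst v)
      (pairSnd (pairSnd (pairFst (pairFst v).tail.tail))) (pairSnd (pairFst v).tail.tail) =
      ((List.replicate (Q.eval (pairFst v).length) true).drop
      (pairSnd (pairSnd (pairFst (pairFst v).tail.tail)) ++
        pairSnd (pairFst v).tail.tail).length).length := by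
    simp [numOnes]
  have d (a b : List Bool) : decide (a.length ≤ b.length) = (a.drop b.length).isEmpty := by
    rw [Bool.eq_iff_iff]
    simp
  unfold Cplx.verify
  simp only [e, d]
  simp only [List.length_replicate] at h₁
  unfold cexCheck minCheck
  refine FB.cond (by fun_prop) (by fun_prop) (FB.cond (by fun_prop) (FB.cond (by fun_prop)
    (FB.and (FB.isEmpty (FP.drop (by fun_prop) h₂)) ?_) (by fun_prop)) h₁)
  have h₃ := FP.drop h₂ (g := pairSnd) (by fun_prop)
  fun_prop

/-! ### The promise problem -/

theorem FB.mem_P {c : List Bool → Bool} (hc : FB c) {V : Language Bool}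
    (hV : ∀ v, v ∈ V ↔ c v = true) : V ∈ P := by
  classical
  refine Comp.decidesIn ((Comp.of_FP hc).mono ?_)
  rintro x y rfl
  simp [hV]

open Classical in
theorem FB.of_mem_P {V : Language Bool} (hV : V ∈ P) : FB fun v => decide (v ∈ V) := by
  obtain ⟨M, p, hM⟩ := hV
  -- `noOracle` is the oracle of the constant function `[]`.
  exact Comp.of_decidesIn (g := fun _ => []) hM FP.nil (r := 0) (by simp)

/-- The promise problem of the verifier `V` with `p` random bits and threshold `2 ^ (-q)`. -/
noncomputable def sbpProblem (V : Language Bool) (p q : Polynomial ℕ) : PromiseProblem where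
  yes := {x : List Bool | (1 : ℚ) / 2 ^ q.eval x.length ≤ acceptProb V (p.eval x.length) x}
  no := {x : List Bool | acceptProb V (p.eval x.length) x ≤ (1 / 2 ^ q.eval x.length) / 2}
  disj x h₁ h₂ := by
    have h₃ : (1 : ℚ) / 2 ^ q.eval x.length ≤ (1 / 2 ^ q.eval x.length) / 2 := le_trans h₁ h₂
    have h₄ : (0 : ℚ) < 1 / 2 ^ q.eval x.length := by positivity
    linarith

theorem sbpProblem_mem {V : Language Bool} (hV : V ∈ P) (p q : Polynomial ℕ) :
    sbpProblem V p q ∈ prSBP :=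
  ⟨V, hV, p, q, fun _ h => h, fun _ h => h⟩

theorem PromiseProblem.exists_oracle (Q : PromiseProblem) (q : List Bool) : ∃ a, Q.oracle q a := by
  by_cases h : q ∈ Q.yes
  · exact ⟨[true], true, rfl, fun _ => rfl, fun h' => (Q.disj q h h').elim⟩
  · exact ⟨[false], false, rfl, fun h' => (h h').elim, fun _ => rfl⟩

theorem PromiseProblem.length_of_oracle (Q : PromiseProblem) (q a : List Bool)
    (h : Q.oracle q a) : a.length = 1 := by
  obtain ⟨b, rfl, -⟩ := h
  rfl

theorem PromiseProblem.oracle_singleton {Q : PromiseProblem} {q : List Bool} {b : Bool}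
    (h : Q.oracle q [b]) : (q ∈ Q.yes → b = true) ∧ (q ∈ Q.no → b = false) := by
  obtain ⟨b', hb, h⟩ := h
  obtain rfl : b = b' := by simpa using hb
  exact h

/-- One witness among `2 ^ l` strings already reaches the threshold, and without a witness the
probability is zero (`avg_ind_eq_zero`). Existential questions thus never leave the promise; this is
why `prSBP` covers `NP`. -/
theorem le_avg_ind {l N : ℕ} {c : List Bool → Bool} (hl : l ≤ N)
    (h : ∃ w : List Bool, w.length = l ∧ c w = true) :
    (1 : ℚ) / 2 ^ N ≤ avg l fun w => ind (c w) := by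
  obtain ⟨w, hw, hc⟩ := h
  have h₁ := le_avg_mul (f := fun w => ind (c w)) (fun w _ => ind_nonneg _) hw
  simp only [hc, ind_true] at h₁
  have h₂ : (2 : ℚ) ^ l ≤ 2 ^ N := pow_le_pow_right₀ (by norm_num) hl
  rw [div_le_iff₀ (by positivity)]
  refine h₁.trans ?_
  have : 0 ≤ avg l fun w => ind (c w) := avg_nonneg fun w _ => ind_nonneg _
  gcongr

theorem avg_ind_eq_zero {l : ℕ} {c : List Bool → Bool}
    (h : ¬ ∃ w : List Bool, w.length = l ∧ c w = true) : avg l (fun w => ind (c w)) = 0 := by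
  rw [← avg_const l 0]
  refine avg_congr fun w hw => ?_
  have : c w = false := by
    by_contra hc
    exact h ⟨w, hw, by simpa using hc⟩
  rw [this, ind_false]

/-! ### Share and density -/

/-- The share of the strings that are below `x`, but not below `a`. -/
def share (q x a : List Bool) : ℚ :=
  avg (codeLen q) fun z => ind (codeLt q z x && !codeLt q z a)

/-- The probability that a random continuation of `u` is below `x`, and that random blocks are
below `x` but not below that continuation. -/
def density (q x u : List Bool) : ℚ :=
  avg (codeLen q - u.length) fun v => ind (codeLt q (u ++ v) x) * share q x (u ++ v) ^ numBlocks q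

theorem take_append_eq (u w : List Bool) {l : ℕ} (h : u.length ≤ l) :
    (u ++ w).take l = u ++ w.take (l - u.length) := by
  rw [List.take_append, List.take_of_length_le h]

/-- A full block of `codeLen q` random bits is reserved for completing `u`, although only its
beginning is read; the position of the other blocks then does not depend on `u`. -/
theorem avg_minCheck {q x u : List Bool} (hu : u.length ≤ codeLen q) (r : ℕ) :
    avg (codeLen q + (numBlocks q * codeLen q + r)) (fun w => ind (minCheck q x u w)) =
      density q x u := by
  set n := codeLen q with hn
  have h (w : List Bool) : ind (minCheck q x u w) =
      ind (codeLt q ((u ++ w.take n).take n) x) *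
        ind (blocksOK q x ((u ++ w.take n).take n) (w.drop n)) := by
    have e : (u ++ w.take n).take n = (u ++ w).take n := by
      rw [take_append_eq _ _ hu, take_append_eq _ _ hu, List.take_take, min_eq_left (by omega)]
    rw [e, ← ind_and]
    rfl
  simp only [h]
  rw [avg_take_drop n (numBlocks q * n + r) fun v w => ind (codeLt q ((u ++ v).take n) x) *
    ind (blocksOK q x ((u ++ v).take n) w)]
  have h' (v : List Bool) : (avg (numBlocks q * n + r) fun w =>
      ind (codeLt q ((u ++ v).take n) x) * ind (blocksOK q x ((u ++ v).take n) w)) =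
      ind (codeLt q (u ++ v.take (n - u.length)) x) *
        share q x (u ++ v.take (n - u.length)) ^ numBlocks q := by
    simp only [mul_comm (ind (codeLt q ((u ++ v).take n) x))]
    rw [avg_mul_const, mul_comm, take_append_eq _ _ hu]
    simp only [blocksOK, ← hn]
    rw [avg_allBlocks]
    rfl
  simp only [h', density, ← hn]
  have e : n = n - u.length + u.length := by omega
  conv_lhs => rw [e]
  simp only [Nat.add_sub_cancel]
  rw [avg_take (n - u.length) u.length fun v => ind (codeLt q (u ++ v) x) *
    share q x (u ++ v) ^ numBlocks q]

/-! ### What the oracle answers reveal about the three kinds of queries -/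

section

variable (c : List Bool → Bool) (p : Polynomial ℕ)

/-- The exponent of the threshold. -/
noncomputable def thresholdPoly : Polynomial ℕ := p + 3 * Polynomial.X + 1

/-- The number of random bits. -/
noncomputable def randomPoly : Polynomial ℕ :=
  thresholdPoly p + Polynomial.X + (2 * Polynomial.X + 2) * Polynomial.X

/-- The language of the verifier. -/
def verifyLang : Language Bool :=
  {v : List Bool | verify c p (thresholdPoly p) (pairFst v) (pairSnd v) = true}

/-- The promise problem of the verifier. -/
noncomputable def verifyProblem : PromiseProblem :=
  sbpProblem (verifyLang c p) (randomPoly p) (thresholdPoly p)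

theorem verifyProblem_mem {c : List Bool → Bool} (hc : FB c) : verifyProblem c p ∈ prSBP :=
  sbpProblem_mem ((FB.verify hc p (thresholdPoly p)).mem_P fun _ => Iff.rfl) _ _

/-- The term `p.eval n` covers the `NP` witnesses, and `3 * n + 1` covers both the length of
counterexamples and the exponents that occur in the descent. -/
theorem eval_thresholdPoly (n : ℕ) : (thresholdPoly p).eval n = p.eval n + 3 * n + 1 := by
  simp [thresholdPoly]

/-- The summands make room for the leading ones, for the completion of `u`, and for the blocks. -/
theorem eval_randomPoly (n : ℕ) : (randomPoly p).eval n =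
    (thresholdPoly p).eval n + n + (2 * n + 2) * n := by
  simp [randomPoly]

theorem acceptProb_verifyLang (m : ℕ) (X : List Bool) : acceptProb (verifyLang c p) m X =
    avg m fun w => ind (verify c p (thresholdPoly p) X w) := by
  refine acceptProb_eq_avg fun w => ?_
  change verify c p (thresholdPoly p) (pairFst (pair X w)) (pairSnd (pair X w)) = true ↔ _
  rw [pairFst_pair, pairSnd_pair]

variable {c p}

theorem mem_yes_iff {X : List Bool} : X ∈ (verifyProblem c p).yes ↔
    1 / 2 ^ (thresholdPoly p).eval X.length ≤
      avg ((randomPoly p).eval X.length) fun w => ind (verify c p (thresholdPoly p) X w) := by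
  rw [← acceptProb_verifyLang]
  rfl

theorem mem_no_iff {X : List Bool} : X ∈ (verifyProblem c p).no ↔
    (avg ((randomPoly p).eval X.length) fun w => ind (verify c p (thresholdPoly p) X w)) ≤
      1 / 2 ^ (thresholdPoly p).eval X.length / 2 := by
  rw [← acceptProb_verifyLang]
  rfl

/-- Queries that begin with `0` are existential queries about `c`. -/
theorem oracle_false_iff {y : List Bool} {b : Bool}
    (h : (verifyProblem c p).oracle (false :: y) [b]) :
    b = true ↔ ∃ w : List Bool, w.length = p.eval y.length ∧ c (pair y w) = true := by
  obtain ⟨hy, hn⟩ := PromiseProblem.oracle_singleton h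
  have hm : (false :: y).length = y.length + 1 := rfl
  have hp : p.eval y.length ≤ p.eval (y.length + 1) := eval_mono p (Nat.le_succ _)
  have hT : p.eval y.length ≤ (thresholdPoly p).eval (false :: y).length := by
    rw [hm, eval_thresholdPoly]; omega
  have hR : (randomPoly p).eval (false :: y).length =
      p.eval y.length + ((randomPoly p).eval (false :: y).length - p.eval y.length) := by
    rw [eval_randomPoly]; omega
  have e : (avg ((randomPoly p).eval (false :: y).length) fun w =>
      ind (verify c p (thresholdPoly p) (false :: y) w)) =
      avg (p.eval y.length) fun w => ind (c (pair y w)) := by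
    rw [hR]
    exact avg_take _ _ fun w => ind (c (pair y w))
  rw [mem_yes_iff, e] at hy
  rw [mem_no_iff, e] at hn
  constructor
  · rintro rfl
    by_contra hw
    have := hn (by rw [avg_ind_eq_zero hw]; positivity)
    simp at this
  · intro hw
    exact hy (le_avg_ind hT hw)

/-- Queries that begin with `10` are existential queries about counterexamples. -/
theorem oracle_true_false_iff {q u : List Bool} {b : Bool} (hu : u.length ≤ cexLen q)
    (h : (verifyProblem c p).oracle (true :: false :: pair q u) [b]) :
    b = true ↔ ∃ w : List Bool, w.length = cexLen q - u.length ∧ isCex q (u ++ w) = true := by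
  obtain ⟨hy, hn⟩ := PromiseProblem.oracle_singleton h
  set X := true :: false :: pair q u with hX
  have hm : X.length = 2 * q.length + u.length + 3 := by simp [hX]
  have hq := codeLen_le q
  have hc := cexLen_eq q
  have hT : cexLen q - u.length ≤ (thresholdPoly p).eval X.length := by
    rw [eval_thresholdPoly]; omega
  have hR : (randomPoly p).eval X.length =
      (cexLen q - u.length) + ((randomPoly p).eval X.length - (cexLen q - u.length)) := by
    rw [eval_randomPoly]; omega
  have e : (avg ((randomPoly p).eval X.length) fun w =>
      ind (verify c p (thresholdPoly p) X w)) =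
      avg (cexLen q - u.length) fun w => ind (isCex q (u ++ w)) := by
    rw [hR, ← avg_take _ ((randomPoly p).eval X.length - (cexLen q - u.length))
      fun w => ind (isCex q (u ++ w))]
    refine avg_congr fun w _ => ?_
    simp [verify, hX, cexCheck, take_append_eq _ _ hu]
  rw [mem_yes_iff, e] at hy
  rw [mem_no_iff, e] at hn
  constructor
  · rintro rfl
    by_contra hw
    have := hn (by rw [avg_ind_eq_zero hw]; positivity)
    simp at this
  · intro hw
    exact hy (le_avg_ind hT hw)

/-- Queries that begin with `11` compare the density with a power of `2`. -/
theorem oracle_true_true {q x j u : List Bool} {b : Bool} (hu : u.length ≤ codeLen q)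
    (h : (verifyProblem c p).oracle (true :: true :: pair (pair q (pair x j)) u) [b]) :
    (1 / 2 ^ (j.length + u.length) ≤ density q x u → b = true) ∧
    (density q x u ≤ 1 / 2 ^ (j.length + u.length) / 2 → b = false) := by
  obtain ⟨hy, hn⟩ := PromiseProblem.oracle_singleton h
  set X := true :: true :: pair (pair q (pair x j)) u with hX
  have hm : X.length = 2 * (2 * q.length + (2 * x.length + j.length + 1) + 1) + u.length + 3 := by
    simp [hX]
  have hq := codeLen_le q
  have hT : j.length + u.length ≤ (thresholdPoly p).eval X.length := by
    rw [eval_thresholdPoly]; omega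
  have hB : numBlocks q * codeLen q ≤ (2 * X.length + 2) * X.length := by
    refine Nat.mul_le_mul ?_ ?_
    · rw [numBlocks_eq]; omega
    · omega
  -- The subtraction in `numOnes` is not truncated, by `hT`.
  have hf : numOnes (thresholdPoly p) X j u + (j.length + u.length) =
      (thresholdPoly p).eval X.length := by
    rw [numOnes]; omega
  obtain ⟨r, hR⟩ : ∃ r, (randomPoly p).eval X.length = numOnes (thresholdPoly p) X j u +
      (codeLen q + (numBlocks q * codeLen q + r)) := by
    refine ⟨(randomPoly p).eval X.length - (numOnes (thresholdPoly p) X j u +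
      (codeLen q + numBlocks q * codeLen q)), ?_⟩
    rw [eval_randomPoly]
    omega
  have e : (avg ((randomPoly p).eval X.length) fun w =>
      ind (verify c p (thresholdPoly p) X w)) =
      density q x u / 2 ^ numOnes (thresholdPoly p) X j u := by
    rw [hR, ← avg_minCheck hu r, ← avg_ones]
    refine avg_congr fun w _ => ?_
    simp [verify, hX]
  -- The threshold of a promise problem depends only on the length of the query. The required
  -- leading ones scale the density down so that this threshold corresponds to `2 ^ (-(|j| + |u|))`.
  have e₂ : (1 : ℚ) / 2 ^ (thresholdPoly p).eval X.length =
      1 / 2 ^ (j.length + u.length) / 2 ^ numOnes (thresholdPoly p) X j u := by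
    rw [← hf, pow_add]
    field_simp
  rw [mem_yes_iff, e, e₂] at hy
  rw [mem_no_iff, e, e₂] at hn
  refine ⟨fun h => hy (by gcongr), fun h => hn ?_⟩
  rw [div_right_comm]
  gcongr

end

/-! ### Approximate descent in a linear order -/

/-- The instance with code `q` describes a strict linear order. -/
structure IsOrder (q : List Bool) : Prop where
  asymm : ∀ x y : List Bool, x.length = codeLen q → y.length = codeLen q →
    codeLt q x y = true → codeLt q y x = false
  trichotomous : ∀ x y : List Bool, x.length = codeLen q → y.length = codeLen q → x ≠ y →
    codeLt q x y = false → codeLt q y x = true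
  trans : ∀ x y z : List Bool, x.length = codeLen q → y.length = codeLen q →
    z.length = codeLen q → codeLt q x y = true → codeLt q y z = true → codeLt q x z = true

theorem isOrder_of_forall_isCex {q : List Bool}
    (h : ∀ v : List Bool, v.length = cexLen q → isCex q v = false) : IsOrder q := by
  have h₂ (x y : List Bool) (hx : x.length = codeLen q) (hy : y.length = codeLen q) :=
    -- The third string is padding, so `y` can be repeated.
    (isCex_false q x y y hx hy).symm.trans (h _ (by simp [cexLen_eq, hx, hy]; ring))
  have h₃ (x y z : List Bool) (hx : x.length = codeLen q) (hy : y.length = codeLen q)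
      (hz : z.length = codeLen q) :=
    (isCex_true q x y z hx hy hz).symm.trans (h _ (by simp [cexLen_eq, hx, hy, hz]; ring))
  have asymm : ∀ x y : List Bool, x.length = codeLen q → y.length = codeLen q →
      codeLt q x y = true → codeLt q y x = false := by
    intro x y hx hy hxy
    have := h₂ x y hx hy
    simp_all
  have tri : ∀ x y : List Bool, x.length = codeLen q → y.length = codeLen q → x ≠ y →
      codeLt q x y = false → codeLt q y x = true := by
    intro x y hx hy hne hxy
    have := h₂ x y hx hy
    simp_all
  refine ⟨asymm, tri, fun x y z hx hy hz hxy hyz => ?_⟩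
  have := h₃ x y z hx hy hz
  rw [hxy, hyz, Bool.true_and, Bool.true_and] at this
  by_cases e : x = z
  · subst e
    rw [asymm _ _ hx hy hxy] at hyz
    cases hyz
  · exact tri z x hz hx (Ne.symm e) this

/-! ### Rank and density in a linear order -/

/-- The share of the strings below `x`. -/
def rank (q x : List Bool) : ℚ := avg (codeLen q) fun z => ind (codeLt q z x)

theorem rank_nonneg (q x : List Bool) : 0 ≤ rank q x := avg_nonneg fun _ _ => ind_nonneg _

theorem rank_le_one (q x : List Bool) : rank q x ≤ 1 :=
  (avg_mono fun _ _ => ind_le_one _).trans (avg_const _ 1).le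

theorem share_nonneg (q x a : List Bool) : 0 ≤ share q x a := avg_nonneg fun _ _ => ind_nonneg _

theorem share_le_rank (q x a : List Bool) : share q x a ≤ rank q x :=
  avg_mono fun z _ => ind_mono fun h => by simp at h; exact h.1

theorem density_nil (q x : List Bool) : density q x [] =
    avg (codeLen q) fun a => ind (codeLt q a x) * share q x a ^ numBlocks q := rfl

theorem density_eq_of_length {q u : List Bool} (x : List Bool) (hu : u.length = codeLen q) :
    density q x u = ind (codeLt q u x) * share q x u ^ numBlocks q := by
  simp [density, hu, avg]

/-- The density of a prefix is the mean of those of its two extensions, so one of them is at least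
as dense. The search rests on this. -/
theorem density_eq_add {q u : List Bool} (x : List Bool) (hu : u.length < codeLen q) :
    density q x u = (density q x (u ++ [false]) + density q x (u ++ [true])) / 2 := by
  obtain ⟨m, hm⟩ : ∃ m, codeLen q - u.length = m + 1 := ⟨codeLen q - u.length - 1, by omega⟩
  have hm' (b : Bool) : codeLen q - (u ++ [b]).length = m := by simp; omega
  simp only [density, hm, hm', avg]
  simp

theorem density_nil_le (q x : List Bool) : density q x [] ≤ rank q x ^ numBlocks q := by
  rw [density_nil, ← avg_const (codeLen q) (rank q x ^ numBlocks q)]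
  refine avg_mono fun a _ => ?_
  have h₁ := share_nonneg q x a
  have h₂ := share_le_rank q x a
  have h₃ := rank_nonneg q x
  calc ind (codeLt q a x) * share q x a ^ numBlocks q
      ≤ 1 * rank q x ^ numBlocks q := by
        gcongr
        exact ind_le_one _
    _ = _ := one_mul _

namespace IsOrder

variable {q : List Bool} (h : IsOrder q)
include h

/-- By transitivity, the strings below `x` are the disjoint union of those below `a` and those in
`[a, x)`. -/
theorem rank_eq_add {a x : List Bool} (ha : a.length = codeLen q) (hx : x.length = codeLen q)
    (hax : codeLt q a x = true) : rank q x = share q x a + rank q a := by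
  rw [rank, share, rank, ← avg_add]
  refine avg_congr fun z hz => ?_
  cases hza : codeLt q z a
  · simp
  · simp [h.trans z a x hz ha hx hza hax]

theorem rank_lt {a x : List Bool} (ha : a.length = codeLen q) (hx : x.length = codeLen q)
    (hax : codeLt q a x = true) : rank q a < rank q x := by
  rw [h.rank_eq_add ha hx hax]
  have haa : codeLt q a a = false := by
    by_contra hc
    have hc : codeLt q a a = true := by simpa using hc
    have := h.asymm a a ha ha hc
    simp [hc] at this
  have : (1 : ℚ) / 2 ^ codeLen q ≤ share q x a :=
    -- The interval `[a, x)` contains `a`.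
    le_avg_ind le_rfl ⟨a, ha, by simp [hax, haa]⟩
  have : (0 : ℚ) < 1 / 2 ^ codeLen q := by positivity
  linarith

theorem exists_min : ∃ m : List Bool, m.length = codeLen q ∧
    ∀ z : List Bool, z.length = codeLen q → codeLt q z m = false := by
  obtain ⟨m, hm, hmin⟩ := Set.exists_min_image {x : List Bool | x.length = codeLen q} (rank q)
    (List.finite_length_eq Bool _) ⟨List.replicate (codeLen q) true, by simp⟩
  refine ⟨m, hm, fun z hz => ?_⟩
  by_contra hc
  exact absurd (hmin z hz) (not_le.mpr (h.rank_lt hz hm (by simpa using hc)))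

/-- If `x` is not the minimum, then its density is not much smaller than a power of its rank. -/
theorem rank_pow_le {a x : List Bool} (ha : a.length = codeLen q) (hx : x.length = codeLen q)
    (hax : codeLt q a x = true) :
    rank q x ^ numBlocks q ≤ density q x [] * 2 ^ codeLen q := by
  obtain ⟨m, hm, hmin⟩ := h.exists_min
  have hmx : codeLt q m x = true := by
    refine h.trichotomous x m hx hm ?_ (hmin x hx)
    rintro rfl
    rw [hmin a ha] at hax
    cases hax
  -- Nothing lies below `m`, so `[m, x)` is everything below `x`; the single term of `m` in the
  -- average gives the bound.
  have hs : share q x m = rank q x := avg_congr fun z hz => by simp [hmin z hz]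
  have := le_avg_mul (n := codeLen q)
    (f := fun a => ind (codeLt q a x) * share q x a ^ numBlocks q)
    (fun w _ => mul_nonneg (ind_nonneg _) (pow_nonneg (share_nonneg _ _ _) _)) hm
  simpa [hmx, hs, ← density_nil] using this

/-- Both factors of each term can only grow with `x`. This handles rounds in which `x` is already
sparse and the search result is uncontrolled: moving down does no harm. -/
theorem density_mono {a x : List Bool} (ha : a.length = codeLen q) (hx : x.length = codeLen q)
    (hax : codeLt q a x = true) : density q a [] ≤ density q x [] := by
  rw [density_nil, density_nil]
  refine avg_mono fun z hz => ?_
  have h₁ : share q a z ≤ share q x z := avg_mono fun y hy => ind_mono fun hyz => by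
    simp only [Bool.and_eq_true] at hyz ⊢
    exact ⟨h.trans y a x hy ha hx hyz.1 hax, hyz.2⟩
  have h₂ := share_nonneg q a z
  have h₃ := ind_nonneg (codeLt q z x)
  have h₄ : ind (codeLt q z a) ≤ ind (codeLt q z x) :=
    ind_mono fun hza => h.trans z a x hz ha hx hza hax
  gcongr

/-- One round of the descent: if an element `u` of almost maximal density has been found, then the
density of `u` is much smaller than that of `x`. -/
theorem density_lt {x u : List Bool} {ε : ℚ} (hε : 0 < ε) (hx : x.length = codeLen q)
    (hu : u.length = codeLen q) (hlt : density q x [] < 2 * ε)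
    (hs : ε ≤ density q x [] → ε / 2 ^ (codeLen q + 1) ≤ density q x u) :
    density q (cond (codeLt q u x) u x) [] < ε := by
  -- If the density is below `ε` already, nothing is known about `u`, and monotonicity suffices. The
  -- procedure does not have to know which case occurs.
  rcases lt_or_ge (density q x []) ε with hd | hd
  · cases hux : codeLt q u x
    · exact hd
    · exact (h.density_mono hu hx hux).trans_lt hd
  · have h₁ := hs hd
    rw [density_eq_of_length x hu] at h₁
    have hpos : 0 < ε / 2 ^ (codeLen q + 1) := by positivity
    cases hux : codeLt q u x
    -- If `u` is not below `x`, its density is zero, against the positive lower bound.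
    · simp [hux] at h₁; linarith
    rw [hux, ind_true, one_mul] at h₁
    rw [cond_true]
    have h₂ := h.rank_pow_le hu hx hux
    set n := codeLen q with hn
    set k := numBlocks q with hk
    have hnk : 2 * n + 2 ≤ k := by
      have := codeLen_le q
      rw [hk, numBlocks_eq]; omega
    have hr := rank_nonneg q x
    have hpow : (2 : ℚ) ^ (2 * n + 2) ≤ 2 ^ k := pow_le_pow_right₀ (by norm_num) hnk
    -- With `k ≥ 2n + 2`, halving the rank gains at least `2 ^ (2n + 2)` in the power. This pays for
    -- the factor `2 ^ n` between density and power of the rank, the factor 2 in `hlt`, and the loss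
    -- `2 ^ (n + 1)` of the search.
    have h₃ : (rank q x / 2) ^ k ≤ density q x [] * 2 ^ n / 2 ^ (2 * n + 2) := by
      rw [div_pow]
      have : 0 ≤ density q x [] * 2 ^ n := (pow_nonneg hr _).trans h₂
      gcongr
    have h₄ : density q x [] * 2 ^ n / 2 ^ (2 * n + 2) < ε / 2 ^ (n + 1) := by
      rw [div_lt_div_iff₀ (by positivity) (by positivity)]
      have e : (2 : ℚ) ^ (2 * n + 2) = 2 ^ n * 2 ^ n * 4 := by rw [two_mul, pow_add, pow_add]; ring
      rw [e, pow_succ]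
      have : density q x [] * (2 ^ n * 2 ^ n * 2) < 2 * ε * (2 ^ n * 2 ^ n * 2) := by gcongr
      linarith
    have h₅ : rank q x / 2 < share q x u := by
      refine lt_of_pow_lt_pow_left₀ k (share_nonneg _ _ _) ?_
      linarith
    have h₆ : rank q u ≤ rank q x / 2 := by
      have := h.rank_eq_add hu hx hux
      linarith
    have h₇ : rank q u ^ k ≤ (rank q x / 2) ^ k := by
      have := rank_nonneg q u
      gcongr
    have h₈ : ε / 2 ^ (n + 1) ≤ ε := div_le_self hε.le (one_le_pow₀ (by norm_num))
    have := density_nil_le q u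
    rw [← hk] at this
    linarith

/-- An element of very small density is the minimum. -/
theorem eq_min {x : List Bool} (hx : x.length = codeLen q)
    (hd : density q x [] < 1 / 2 ^ (codeLen q * numBlocks q + codeLen q)) (z : List Bool)
    (hz : z.length = codeLen q) : codeLt q z x = false := by
  by_contra hc
  have hzx : codeLt q z x = true := by simpa using hc
  have h₁ := h.rank_pow_le hz hx hzx
  -- Anything that is not the minimum has rank at least `2 ^ (-n)`, hence density at least `2 ^
  -- (-(nk + n))`.
  have h₂ : (1 : ℚ) / 2 ^ codeLen q ≤ rank q x := le_avg_ind le_rfl ⟨z, hz, hzx⟩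
  have h₃ : ((1 : ℚ) / 2 ^ codeLen q) ^ numBlocks q ≤ rank q x ^ numBlocks q := by gcongr
  rw [lt_div_iff₀ (by positivity), pow_add, pow_mul] at hd
  rw [div_pow, one_pow] at h₃
  have h₄ := h₃.trans h₁
  rw [div_le_iff₀ (by positivity)] at h₄
  linarith

end IsOrder

/-! ### Solving `LOP` with the promise problem -/

theorem Iter.invariant {F : List Bool → List Bool → Prop} (I : ℕ → List Bool → Prop) {n : ℕ}
    {a b : List Bool} (h : Iter F n a b) (h₀ : I 0 a)
    (hs : ∀ i s s', i < n → I i s → F s s' → I (i + 1) s') : I n b := by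
  induction n generalizing b with
  | zero => rw [show b = a from h]; exact h₀
  | succ n ih =>
    obtain ⟨c, hc, hcb⟩ := h
    exact hs n c b n.lt_succ_self (ih hc fun i s s' hi => hs i s s' (by omega)) hcb

/-- One step of a search: ask the oracle whether `u` should be continued by `0`. -/
def searchStep (A : Oracle) (tag : Bool) (s s' : List Bool) : Prop :=
  ∃ b, A (true :: tag :: pair (pairFst s) (pairSnd s ++ [false])) [b] ∧
    s' = pair (pairFst s) (pairSnd s ++ [!b])

theorem Comp.ask_promise (Q : PromiseProblem) : Comp Q.oracle Q.oracle :=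
  Comp.ask Q.exists_oracle Q.length_of_oracle

theorem Comp.search (Q : PromiseProblem) (tag : Bool) :
    Comp Q.oracle fun x y => Iter (searchStep Q.oracle tag) (pairFst x).length (pairSnd x) y := by
  have h₁ : FP fun s => true :: tag :: Cplx.pair (pairFst s) (pairSnd s ++ [false]) := by fun_prop
  have h₂ : FP fun z => Cplx.pair (pairFst (pairFst z))
      (pairSnd (pairFst z) ++ [!(pairSnd z).headD false]) :=
    FP.pair (by fun_prop) (FP.append (by fun_prop) (FB.singleton (by fun_prop)))
  have step : Comp Q.oracle (searchStep Q.oracle tag) := by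
    refine ((Comp.pair (Comp.of_FP FP.id) ((Comp.of_FP h₁).bind (Comp.ask_promise Q))).bind
      (Comp.of_FP h₂)).mono ?_
    rintro s s' ⟨_, ⟨_, _, rfl, ⟨_, rfl, b, rfl, hb⟩, rfl⟩, rfl⟩
    exact ⟨b, ⟨b, rfl, hb⟩, by simp⟩
  refine step.iter ⟨3 * Polynomial.X, fun x s i hi h => ?_⟩
  have := h.invariant (fun i s => s.length ≤ (pairSnd x).length + 2 * i) (by simp) ?_
  · have h₁ := length_pairFst_le x
    have h₂ := two_mul_length_pairFst_add_length_pairSnd_le x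
    simp; omega
  · rintro j s _ - hj ⟨b, -, rfl⟩
    have := two_mul_length_pairFst_add_length_pairSnd_le s
    simp; omega

/-- The result of one round of the descent; the state consists of `q`, `x` and of the number of
the round. -/
def descentUpdate (s u : List Bool) : List Bool :=
  pair (pairFst s) (pair (cond (codeLt (pairFst s) u (pairFst (pairSnd s))) u
    (pairFst (pairSnd s)) |>.take (codeLen (pairFst s))) (true :: pairSnd (pairSnd s)))

/-- One round of the descent. -/
def descentStep (A : Oracle) (s s' : List Bool) : Prop :=
  ∃ t, Iter (searchStep A true) (codeLen (pairFst s)) (pair s []) t ∧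
    s' = descentUpdate s (pairSnd t)

/-- The truncation in `descentUpdate` has no effect on strings of length `codeLen q`, but it gives a
length bound that needs no knowledge of `u`. -/
theorem length_descentUpdate (s u : List Bool) : (descentUpdate s u).length ≤
    4 * (pairFst s).length + (pairSnd (pairSnd s)).length + 4 := by
  have h₁ := codeLen_le (pairFst s)
  have h₂ := List.length_take_le (codeLen (pairFst s))
    (cond (codeLt (pairFst s) u (pairFst (pairSnd s))) u (pairFst (pairSnd s)))
  simp only [descentUpdate, length_pair, List.length_cons]
  omega

theorem Comp.descent (Q : PromiseProblem) :
    Comp Q.oracle fun x y => Iter (descentStep Q.oracle) (pairFst x).length (pairSnd x) y := by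
  have h₁ : FP fun s => Cplx.pair (ones (pairFst s)) (Cplx.pair s []) := by fun_prop
  have h₂ : FP fun z => descentUpdate (pairFst z) (pairSnd (pairSnd z)) := by
    unfold descentUpdate
    fun_prop
  have step : Comp Q.oracle (descentStep Q.oracle) := by
    refine ((Comp.pair (Comp.of_FP FP.id) ((Comp.of_FP h₁).bind (Comp.search Q true))).bind
      (Comp.of_FP h₂)).mono ?_
    rintro s s' ⟨_, ⟨_, t, rfl, ⟨_, rfl, ht⟩, rfl⟩, rfl⟩
    rw [pairFst_pair, pairSnd_pair] at ht
    exact ⟨t, ht, by simp⟩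
  refine step.iter ⟨6 * Polynomial.X + 4, fun x s i hi h => ?_⟩
  -- The first component never changes, the round counter gains one bit per round, and the element
  -- is cut to `codeLen` bits; the total length stays linear.
  have := (h.invariant (fun i s => pairFst s = pairFst (pairSnd x) ∧
    (pairSnd (pairSnd s)).length ≤ (pairSnd x).length + i ∧
    s.length ≤ 5 * (pairSnd x).length + i + 4) ?_ ?_).2.2
  · have h₁ := length_pairFst_le x
    have h₂ := two_mul_length_pairFst_add_length_pairSnd_le x
    simp; omega
  · have h₁ := length_pairSnd_le (pairSnd x)
    have h₂ := length_pairSnd_le (pairSnd (pairSnd x))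
    exact ⟨rfl, by omega, by omega⟩
  · rintro j s _ - ⟨h₁, h₂, -⟩ ⟨t, -, rfl⟩
    have h₃ := length_descentUpdate s (pairSnd t)
    have h₄ := length_pairFst_le (pairSnd x)
    rw [h₁] at h₃
    refine ⟨by simp [descentUpdate, h₁], by simp [descentUpdate]; omega, by omega⟩

/-- The number of rounds of the descent. -/
noncomputable def roundsPoly : Polynomial ℕ :=
  Polynomial.X * (2 * Polynomial.X + 2) + Polynomial.X + 1

/-- The answer to the query with code `q`: the candidate `u` for a counterexample if it is one, and
the candidate `x` for a minimum otherwise. -/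
def lopAnswer (q u x : List Bool) : List Bool :=
  bif isCex q u then
    -- The type bit of `u` serves as the second tag of the answer. A pair is cut after `2n + 1`
    -- bits, which removes the padding.
    true :: bif u.headD false then u else u.take (true :: (ones q ++ ones q)).length
  else false :: x

/-- The relation between queries and the answers found with the oracle `A`. -/
def SolveLOP (A : Oracle) (q y : List Bool) : Prop :=
  ∃ s t, Iter (searchStep A false) (cexLen q) (pair q []) s ∧
    Iter (descentStep A) (roundsPoly.eval q.length) (pair q (pair (ones q) [])) t ∧
    y = lopAnswer q (pairSnd s) (pairFst (pairSnd t))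

theorem Comp.solveLOP (Q : PromiseProblem) : Comp Q.oracle (SolveLOP Q.oracle) := by
  have h₁ : FP fun q => Cplx.pair (true :: (ones q ++ ones q ++ ones q)) (Cplx.pair q []) := by
    fun_prop
  have h₂ : FP fun q => Cplx.pair (List.replicate (roundsPoly.eval q.length) true)
      (Cplx.pair q (Cplx.pair (ones q) [])) :=
    FP.pair (FP.replicate_eval _) (by fun_prop)
  have h₃ : FP fun z => lopAnswer (pairFst z) (pairSnd (pairFst (pairSnd z)))
      (pairFst (pairSnd (pairSnd (pairSnd z)))) := by
    unfold lopAnswer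
    fun_prop
  refine ((Comp.pair (Comp.of_FP FP.id) (Comp.pair ((Comp.of_FP h₁).bind (Comp.search Q false))
    ((Comp.of_FP h₂).bind (Comp.descent Q)))).bind (Comp.of_FP h₃)).mono ?_
  rintro q y ⟨_, ⟨_, _, rfl, ⟨s, t, ⟨_, rfl, hs⟩, ⟨_, rfl, ht⟩, rfl⟩, rfl⟩, rfl⟩
  simp only [pairFst_pair, pairSnd_pair, List.length_replicate] at hs ht
  exact ⟨s, t, hs, ht, by simp⟩

/-! ### Correctness of the search and of the descent -/

section

variable {c : List Bool → Bool} {p : Polynomial ℕ}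

/-- The search for a counterexample has a unique result, and succeeds if there is one. -/
theorem exists_search_result (q : List Bool) : ∃ u : List Bool, u.length = cexLen q ∧
    ((∃ v : List Bool, v.length = cexLen q ∧ isCex q v = true) → isCex q u = true) ∧
    ∀ s, Iter (searchStep (verifyProblem c p).oracle false) (cexLen q) (pair q []) s →
      s = pair q u := by
  -- Every prefix is forced, because existential queries lie in the promise: `0` is appended if it
  -- can be completed to a counterexample, and `1` otherwise. Without any counterexample the result
  -- is the string of ones.
  suffices H : ∀ i ≤ cexLen q, ∃ u : List Bool, u.length = i ∧
      ((∃ v : List Bool, v.length = cexLen q ∧ isCex q v = true) →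
        ∃ w : List Bool, w.length = cexLen q - i ∧ isCex q (u ++ w) = true) ∧
      ∀ s, Iter (searchStep (verifyProblem c p).oracle false) i (pair q []) s → s = pair q u by
    obtain ⟨u, hu, hv, hs⟩ := H _ le_rfl
    refine ⟨u, hu, fun h => ?_, hs⟩
    obtain ⟨w, hw, hc⟩ := hv h
    rw [Nat.sub_self, List.length_eq_zero_iff] at hw
    simpa [hw] using hc
  intro i hi
  induction i with
  | zero =>
    refine ⟨[], rfl, fun ⟨v, hv, h⟩ => ⟨v, by simpa using hv, by simpa using h⟩, fun s hs => hs⟩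
  | succ i ih =>
    obtain ⟨u, hu, hv, hs⟩ := ih (by omega)
    have hl : (u ++ [false]).length ≤ cexLen q := by simp; omega
    have hl' : cexLen q - (u ++ [false]).length = cexLen q - (i + 1) := by simp [hu]
    by_cases hex : ∃ w : List Bool, w.length = cexLen q - (u ++ [false]).length ∧
        isCex q (u ++ [false] ++ w) = true
    · refine ⟨u ++ [false], by simp [hu], fun _ => hl' ▸ hex, ?_⟩
      rintro s ⟨t, ht, b, hb, rfl⟩
      rw [hs t ht, pairFst_pair, pairSnd_pair] at hb ⊢
      rw [(oracle_true_false_iff hl hb).mpr hex]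
      rfl
    · refine ⟨u ++ [true], by simp [hu], fun h => ?_, ?_⟩
      · obtain ⟨w, hw, hc⟩ := hv h
        obtain ⟨b, w, rfl⟩ := List.exists_cons_of_length_eq_add_one
          (n := cexLen q - (i + 1)) (by omega : w.length = cexLen q - (i + 1) + 1)
        cases b
        · refine (hex ⟨w, ?_, by simpa using hc⟩).elim
          rw [hl']; simp at hw; omega
        · exact ⟨w, by simp at hw; omega, by simpa using hc⟩
      · rintro s ⟨t, ht, b, hb, rfl⟩
        rw [hs t ht, pairFst_pair, pairSnd_pair] at hb ⊢
        have : b = false := by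
          by_contra hbt
          exact hex ((oracle_true_false_iff hl hb).mp (by simpa using hbt))
        rw [this]
        rfl

/-- The search for an element of large density. -/
theorem density_of_search {q x j t : List Bool}
    (h : Iter (searchStep (verifyProblem c p).oracle true) (codeLen q)
      (pair (pair q (pair x j)) []) t) :
    (pairSnd t).length = codeLen q ∧ ((1 : ℚ) / 2 ^ j.length ≤ density q x [] →
      1 / 2 ^ j.length / 2 ^ (codeLen q + 1) ≤ density q x (pairSnd t)) := by
  have key := h.invariant (fun i t => ∃ u, t = pair (pair q (pair x j)) u ∧
    u.length = i ∧ ((1 : ℚ) / 2 ^ j.length ≤ density q x [] →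
      1 / 2 ^ j.length / 2 ^ (i + 1) ≤ density q x u)) ⟨[], rfl, rfl, fun hd => ?_⟩ ?_
  · obtain ⟨u, rfl, hu, hd⟩ := key
    rw [pairSnd_pair]
    exact ⟨hu, hd⟩
  -- At the start the invariant has a factor 2 to spare; this makes the first comparison, with a
  -- prefix of length 1, use the bound known for the empty prefix.
  · refine le_trans (div_le_self (by positivity) ?_) hd
    norm_num
  · rintro i _ _ hi ⟨u, rfl, hu, hd⟩ ⟨b, hb, rfl⟩
    rw [pairFst_pair, pairSnd_pair] at hb ⊢
    refine ⟨u ++ [!b], rfl, by simp [hu], fun h => ?_⟩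
    obtain ⟨hy, hn⟩ := oracle_true_true (by simp; omega) hb
    have hd := hd h
    have hl : (u ++ [false]).length = i + 1 := by simp [hu]
    rw [hl, pow_add, ← div_div] at hy hn
    have e : (1 : ℚ) / 2 ^ j.length / 2 ^ (i + 1 + 1) = 1 / 2 ^ j.length / 2 ^ (i + 1) / 2 := by
      rw [pow_succ 2 (i + 1), div_div _ _ (2 : ℚ)]
    have hpos : (0 : ℚ) < 1 / 2 ^ j.length / 2 ^ (i + 1) := by positivity
    rw [e]
    -- The query compares `u0` with the lower bound known for `u`. On the answer `no`, `u0` lies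
    -- below this bound, so `u1` lies above it, as `u` is the mean of both. On the answer `yes`,
    -- `u0` exceeds half the bound: one factor 2 is lost per bit.
    cases b
    · have h₁ : density q x (u ++ [false]) < 1 / 2 ^ j.length / 2 ^ (i + 1) := by
        by_contra hc
        simpa using hy (not_lt.mp hc)
      rw [density_eq_add x (by omega)] at hd
      simp only [Bool.not_false]
      linarith
    · have h₁ : 1 / 2 ^ j.length / 2 ^ (i + 1) / 2 < density q x (u ++ [false]) := by
        by_contra hc
        simpa using hn (not_lt.mp hc)
      exact h₁.le

/-- In a linear order, the descent arrives at the minimum. -/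
theorem min_of_descent {q t : List Bool} (h : IsOrder q)
    (ht : Iter (descentStep (verifyProblem c p).oracle) (roundsPoly.eval q.length)
      (pair q (pair (ones q) [])) t) :
    (pairFst (pairSnd t)).length = codeLen q ∧
      ∀ z : List Bool, z.length = codeLen q → codeLt q z (pairFst (pairSnd t)) = false := by
  have key := ht.invariant (fun i t => ∃ x j, t = pair q (pair x j) ∧
    x.length = codeLen q ∧ j.length = i ∧ density q x [] < 2 * (1 / 2 ^ i))
    -- Any string of length `codeLen q` could be the start, since densities are at most 1; `ones q`
    -- has this length by definition.
    ⟨ones q, [], rfl, rfl, rfl, ?_⟩ ?_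
  · obtain ⟨x, j, rfl, hx, hj, hd⟩ := key
    rw [pairSnd_pair, pairFst_pair]
    refine ⟨hx, h.eq_min hx (hd.trans_le ?_)⟩
    have hq := codeLen_le q
    -- The summand 1 cancels the factor 2 of the invariant.
    have hr : codeLen q * numBlocks q + codeLen q + 1 ≤ roundsPoly.eval q.length := by
      have e : roundsPoly.eval q.length = q.length * numBlocks q + q.length + 1 := by
        simp [roundsPoly, numBlocks_eq]
      rw [e]
      gcongr
    have hp : (2 : ℚ) ^ (codeLen q * numBlocks q + codeLen q + 1) ≤
        2 ^ roundsPoly.eval q.length := pow_le_pow_right₀ (by norm_num) hr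
    rw [pow_succ] at hp
    rw [mul_one_div, div_le_div_iff₀ (by positivity) (by positivity)]
    linarith
  · have h₁ := density_nil_le q (ones q)
    have h₂ := pow_le_one₀ (n := numBlocks q) (rank_nonneg q (ones q)) (rank_le_one q (ones q))
    norm_num
    linarith
  · rintro i _ _ - ⟨x, j, rfl, hx, rfl, hd⟩ ⟨t, ht, rfl⟩
    rw [pairFst_pair] at ht
    obtain ⟨hu, hd'⟩ := density_of_search ht
    have key := h.density_lt (by positivity) hx hu hd hd'
    refine ⟨cond (codeLt q (pairSnd t) x) (pairSnd t) x, true :: j, ?_, ?_, rfl, ?_⟩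
    · simp only [descentUpdate, pairFst_pair, pairSnd_pair]
      rw [List.take_of_length_le]
      cases codeLt q (pairSnd t) x
      · exact hx.le
      · exact hu.le
    · cases codeLt q (pairSnd t) x
      · exact hx
      · exact hu
    · have e : (2 : ℚ) * (1 / 2 ^ (j.length + 1)) = 1 / 2 ^ j.length := by
        rw [pow_succ]; field_simp
      rw [e]
      exact key

theorem lopAnswer_of_isCex {n : ℕ} {E : Circuit} {u : List Bool} (x : List Bool)
    (hu : u.length = cexLen (encodeLOP n E)) (h : isCex (encodeLOP n E) u = true) :
    LOPAnswer n E (lopAnswer (encodeLOP n E) u x) := by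
  set q := encodeLOP n E with hq
  have hn : codeLen q = n := codeLen_encodeLOP n E
  have hl : (true :: (ones q ++ ones q)).length = n + n + 1 := by
    rw [← hn]; simp [codeLen]
  rw [lopAnswer, h, cond_true, hl]
  obtain ⟨b, x, y, z, hx, hy, hz, rfl⟩ := exists_of_length_eq_cexLen hu
  have hlt (x y : List Bool) : codeLt q x y = true ↔ E.Lt x y := codeLt_encodeLOP n E x y
  cases b
  · have ht : (false :: (x ++ y ++ z)).take (n + n + 1) = false :: (x ++ y) := by
      rw [List.take_succ_cons, List.take_left' (by simp [hx, hy, hn])]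
    rw [isCex_false q x y z hx hy] at h
    rw [List.headD_cons, cond_false, ht]
    simp only [Bool.or_eq_true, Bool.and_eq_true, Bool.not_eq_true', ← Bool.not_eq_true, hlt,
      decide_eq_true_eq] at h
    rcases h with h | h
    · exact .twoCycle x y (hx.trans hn) (hy.trans hn) h.1 h.2
    · exact .incomparable x y (hx.trans hn) (hy.trans hn) h.2 h.1.1 h.1.2
  · rw [isCex_true q x y z hx hy hz] at h
    simp only [Bool.and_eq_true, hlt] at h
    exact .threeCycle x y z (hx.trans hn) (hy.trans hn) (hz.trans hn) h.1.1 h.1.2 h.2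

/-- The answers found with the promise problem are unique and correct. -/
theorem exists_answer (q : List Bool) : ∃ y : List Bool,
    (∀ y', SolveLOP (verifyProblem c p).oracle q y' → y' = y) ∧ y.length ≤ 3 * q.length + 2 ∧
    ∀ n E, q = encodeLOP n E → LOPAnswer n E y := by
  obtain ⟨u, hu, hcex, huniq⟩ := exists_search_result (c := c) (p := p) q
  have hq := codeLen_le q
  cases hc : isCex q u
  · have ho : IsOrder q := isOrder_of_forall_isCex fun v hv => by
      by_contra hv'
      rw [hcex ⟨v, hv, by simpa using hv'⟩] at hc
      cases hc
    obtain ⟨m, hm, hmin⟩ := ho.exists_min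
    -- The elements met on the way may vary with the answers outside the promise, but the minimum is
    -- unique, so all runs end alike.
    have huni : ∀ x : List Bool, x.length = codeLen q →
        (∀ z : List Bool, z.length = codeLen q → codeLt q z x = false) → x = m := by
      intro x hx hxmin
      by_contra hne
      have := ho.trichotomous x m hx hm hne (hmin x hx)
      rw [hxmin m hm] at this
      cases this
    refine ⟨false :: m, ?_, by simp; omega, ?_⟩
    · rintro _ ⟨s, t, hs, ht, rfl⟩
      obtain ⟨h₁, h₂⟩ := min_of_descent ho ht
      rw [lopAnswer, huniq s hs, pairSnd_pair, hc, cond_false, huni _ h₁ h₂]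
    · rintro n E rfl
      rw [codeLen_encodeLOP] at hm
      refine .min m hm fun y hy hne => ?_
      rw [← codeLt_encodeLOP n E]
      rw [← codeLen_encodeLOP n E] at hm hy
      exact ho.trichotomous y m hy hm hne (hmin y hy)
  -- With a counterexample the outcome of the descent is ignored; `[]` stands for it.
  · refine ⟨lopAnswer q u [], ?_, ?_, ?_⟩
    · rintro _ ⟨s, t, hs, ht, rfl⟩
      rw [huniq s hs, pairSnd_pair, lopAnswer, lopAnswer, hc]
      rfl
    · rw [cexLen_eq] at hu
      rw [lopAnswer, hc, cond_true, List.length_cons]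
      cases u.headD false
      · rw [cond_false, List.length_take]
        omega
      · rw [cond_true]
        omega
    · rintro n E rfl
      exact lopAnswer_of_isCex _ hu hc

end

/-! ### The reduction -/

open Classical in
/-- A function that answers the queries to `joinOracle A f`. -/
noncomputable def joinFun (A : Language Bool) (f : List Bool → List Bool) : List Bool → List Bool
  | [] => []
  | false :: q => [decide (q ∈ A)]
  | true :: q => f q

theorem joinOracle_eq (A : Language Bool) (f : List Bool → List Bool) :
    joinOracle A f = fun q a => a = joinFun A f q := by
  funext q a
  match q with
  | [] => rfl
  | false :: q => rfl
  | true :: q => rfl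

/-- Every query is both passed to the promise oracle and, without its first bit, submitted to the
`LOP` procedure; the first bit then selects the result. Computing the irrelevant one is harmless, as
both are total in polynomial time on arbitrary strings. -/
theorem comp_joinFun {A V : Language Bool} {c : List Bool → Bool} {p : Polynomial ℕ}
    {f : List Bool → List Bool} (hV : ∀ v, v ∈ V ↔ c v = true)
    (hA : ∀ x : List Bool, x ∈ A ↔ ∃ w : List Bool, w.length = p.eval x.length ∧ pair x w ∈ V)
    (hf : ∀ q y, SolveLOP (verifyProblem c p).oracle q y → y = f q) :
    Comp (verifyProblem c p).oracle fun q a => a = joinFun A f q := by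
  classical
  have h₁ : FP fun z => bif (pairFst z).isEmpty then [] else
      bif (pairFst z).headD false then pairSnd (pairSnd z) else pairFst (pairSnd z) := by
    fun_prop
  refine ((Comp.pair (Comp.of_FP FP.id) (Comp.pair (Comp.ask_promise _)
    ((Comp.of_FP FP.tail').bind (Comp.solveLOP (verifyProblem c p))))).bind
    (Comp.of_FP h₁)).mono ?_
  rintro q y ⟨_, ⟨q', _, hq, ⟨a, r, ha, ⟨_, rfl, hr⟩, rfl⟩, rfl⟩, rfl⟩
  have hq : q' = q := hq
  subst hq
  obtain ⟨b, rfl, hb⟩ := id ha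
  simp only [pairFst_pair, pairSnd_pair]
  match q', ha, hr with
  | [], _, _ => rfl
  | true :: q, _, hr => exact hf q r hr
  | false :: q, ha, _ =>
    have h := oracle_false_iff (c := c) (p := p) (y := q) (b := b) ha
    have : b = decide (q ∈ A) := by
      rw [Bool.eq_iff_iff, h, decide_eq_true_iff, hA]
      simp only [hV]
    rw [this]
    simp [Cplx.joinFun]

theorem length_joinFun_le {A : Language Bool} {f : List Bool → List Bool}
    (hf : ∀ q, (f q).length ≤ 3 * q.length + 2) (q : List Bool) :
    (joinFun A f q).length ≤ 3 * q.length + 2 := by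
  match q with
  | [] => simp [joinFun]
  | false :: q => simp [joinFun]
  | true :: q =>
    have := hf q
    simp only [joinFun, List.length_cons]
    omega

end Cplx

open Cplx in
theorem theorem3 : Cplx.L2P ⊆ Cplx.PWith Cplx.prSBP := by
  classical
  rintro L ⟨A, ⟨V, hV, p, hA⟩, M, r, hM⟩
  obtain ⟨c, hc, hcV⟩ : ∃ c : List Bool → Bool, FB c ∧ ∀ v, v ∈ V ↔ c v = true :=
    ⟨_, FB.of_mem_P hV, fun v => by simp⟩
  -- The machine works with every solver, so it may be given the function that the procedure itself
  -- computes; it is defined on all strings, codes of instances or not.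
  choose f hf₁ hf₂ hf₃ using fun q => exists_answer (c := c) (p := p) q
  refine ⟨verifyProblem c p, verifyProblem_mem p hc, ?_⟩
  have hdec := hM f fun n E _ => hf₃ _ n E rfl
  rw [joinOracle_eq] at hdec
  refine Comp.decidesIn (Comp.of_decidesIn hdec (comp_joinFun hcV hA hf₁)
    (r := 3 * Polynomial.X + 2) fun q => ?_)
  simpa using length_joinFun_le hf₂ q
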